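/- Let $\mathcal V$ be a complete and cocomplete symmetric monoidal closed category, and let $\mathcal A$ be a small closed monoidal $\mathcal V$-category: for all $A, C$ there are objects $C^A$ and ${}^A C$ with evaluations $e_r : A\otimes C^A\to C$ and $e_l : {}^A C\otimes A\to C$ inducing isomorphisms $\mathcal A(B,C^A)\cong\mathcal A(A\otimes B,C)$ and $\mathcal A(B,{}^A C)\cong\mathcal A(B\otimes A,C)$ in $\mathcal V$; let $d_r : B\to (A\otimes B)^A$ and $d_l : A\to {}^B(A\otimes B)$ be the coevaluations. The canonical isomorphisms ${}^{A\otimes B}C\cong{}^A({}^B C)$, $C^{A\otimes B}\cong (C^A)^B$, $({}^B C)^A\cong{}^B(C^A)$, ${}^I C\cong C\cong C^I$ and the associativity and unit constraints of $\mathcal A$ are suppressed below. The lax centre $\mathcal Z_l[\mathcal A,\mathcal V]$ (with respect to Day convolution) is the $\mathcal V$-category whose objects are the pairs $(F,\theta)$ of a $\mathcal V$-functor $F:\mathcal A\to\mathcal V$ and a $\mathcal V$-natural family $\theta_{A,B} : F({}^A B)\to F(B^A)$ with $\theta_{A\otimes B,C}=\theta_{B,C^A}\circ\theta_{A,{}^B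 C}$ and $\theta_{I,A}=1$, and whose hom object from $(F,\theta)$ to $(G,\phi)$ is the subobject of $[\mathcal A,\mathcal V](F,G)=\int_A\mathcal V(FA,GA)$ of transformations commuting with $\theta$ and $\phi$ (an intersection of equalizers). The centre $\mathcal Z[\mathcal A,\mathcal V]$ is the full sub-$\mathcal V$-category of those $(F,\theta)$ with $\theta$ invertible. A Tambara module on $\mathcal A$ is a $\mathcal V$-functor $T:\mathcal A^{\mathrm{op}}\otimes\mathcal A\to\mathcal V$ with families $\alpha_l(A,X,Y):T(X,Y)\to T(A\otimes X,A\otimes Y)$ and $\alpha_r(B,X,Y):T(X,Y)\to T(X\otimes B,Y\otimes B)$, $\mathcal V$-natural in each variable, such that $\alpha_l(I,X,Y)=1$, $\alpha_l(A\otimes A',X,Y)=\alpha_l(A,A'\otimes X,A'\otimes Y)\circ\alpha_l(A',X,Y)$, $\alpha_r(I,X,Y)=1$, $\alpha_r(B\otimes B',X,Y)=\alpha_r(B',X\otimes B,Y\otimes B)\circ\alpha_r(B,X,Y)$ and $\alpha_r(B,A\otimes X,A\otimes Y)\circ\alpha_l(A,X,Y)=\alpha_l(A,X\otimes B,Y\otimes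 B)\circ\alpha_r(B,X,Y)$. Hom objects of Tambara modules are the subobjects of $[\mathcal A^{\mathrm{op}}\otimes\mathcal A,\mathcal V](T,T')$ of transformations commuting with $\alpha_l$ and $\alpha_r$ (an intersection of equalizers). $T$ is left strong if all $\beta_l(A,X,Y)=T(1,e_r)\circ\alpha_l(A,X,Y^A):T(X,Y^A)\to T(A\otimes X,Y)$ are invertible, right strong if all $\beta_r(B,X,Y)=T(1,e_l)\circ\alpha_r(B,X,{}^B Y):T(X,{}^B Y)\to T(X\otimes B,Y)$ are invertible, and strong if both hold. Let $\mathrm{Tamb}_{ls}(\mathcal A)$ and $\mathrm{Tamb}_s(\mathcal A)$ be the $\mathcal V$-categories of left strong and of strong Tambara modules. The Cayley $\mathcal V$-functor $\hat\Upsilon$ sends $(F,\theta)$ to $T_F(X,Y)=F(Y^X)$ with $\alpha_l(A,X,Y)=F((d_r)^X):F(Y^X)\to F((A\otimes Y)^{A\otimes X})$ and $\alpha_r(B,X,Y)=\theta_{B,(Y\otimes B)^X}\circ F((d_l)^X):F(Y^X)\to F({}^B(Y\otimes B)^X)\to F((Y\otimes B)^{X\otimes B})$; on hom objects it is determined by $\mathrm{pr}_{X,Y}\circ\hat\Upsilon=\mathrm{pr}_{Y^X}$.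 Then $\hat\Upsilon$ takes values in left strong Tambara modules, and $\hat\Upsilon:\mathcal Z_l[\mathcal A,\mathcal V]\to\mathrm{Tamb}_{ls}(\mathcal A)$ is an equivalence of $\mathcal V$-categories, which restricts to an equivalence $\hat\Upsilon:\mathcal Z[\mathcal A,\mathcal V]\to\mathrm{Tamb}_s(\mathcal A)$ of $\mathcal V$-categories. -/

import Mathlib

open CategoryTheory MonoidalCategory Limits Opposite

universe w u u₁ u₂ u₃

noncomputable section

set_option linter.unusedSectionVars false

namespace Tambara

section Enriched

variable (V : Type u) [Category.{w} V] [MonoidalCategory V]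

/-- A family `t c : 𝟙 ⟶ D(F c, G c)` is `V`-natural: the two morphisms
`C(c, d) ⟶ D(F c, G d)` it induces agree. -/
def IsVNatural {C : Type u₁} [EnrichedCategory V C] {D : Type u₂} [EnrichedCategory V D]
    (F G : EnrichedFunctor V C D) (t : ∀ c, 𝟙_ V ⟶ (F.obj c ⟶[V] G.obj c)) : Prop :=
  ∀ c d, (ρ_ (c ⟶[V] d)).inv ≫ (F.map c d ⊗ₘ t d) ≫ eComp V _ _ _ =
    (λ_ (c ⟶[V] d)).inv ≫ (t c ⊗ₘ G.map c d) ≫ eComp V _ _ _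

/-- There is a `V`-natural isomorphism between the `V`-functors `F` and `G`. -/
def VNatIso {C : Type u₁} [EnrichedCategory V C] {D : Type u₂} [EnrichedCategory V D]
    (F G : EnrichedFunctor V C D) : Prop :=
  ∃ t : ∀ c, 𝟙_ V ⟶ (F.obj c ⟶[V] G.obj c), IsVNatural V F G t ∧
    ∀ c, IsIso (ForgetEnrichment.homOf V (t c))

/-- The `V`-functor `F` is an equivalence of `V`-categories: it has a quasi-inverse up to
`V`-natural isomorphism. -/
def IsVEquivalence {C : Type u₁} [EnrichedCategory V C] {D : Type u₂} [EnrichedCategory V D]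
    (F : EnrichedFunctor V C D) : Prop :=
  ∃ G : EnrichedFunctor V D C,
    VNatIso V (F.comp V G) (EnrichedFunctor.id V C) ∧
    VNatIso V (G.comp V F) (EnrichedFunctor.id V D)

/-- The full sub-`V`-category of `C` on the objects satisfying `P`. -/
structure FullSub {C : Type u₁} (P : C → Prop) where
  obj : C
  property : P obj

instance {C : Type u₁} [EnrichedCategory V C] (P : C → Prop) :
    EnrichedCategory V (FullSub P) where
  Hom x y := x.obj ⟶[V] y.obj
  id x := eId V x.obj
  comp x y z := eComp V x.obj y.obj z.obj

/-- The restriction of a `V`-functor to full sub-`V`-categories. -/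
def restrict {C : Type u₁} [EnrichedCategory V C] {D : Type u₂} [EnrichedCategory V D]
    (F : EnrichedFunctor V C D) {P : C → Prop} {Q : D → Prop} (h : ∀ c, P c → Q (F.obj c)) :
    EnrichedFunctor V (FullSub P) (FullSub Q) where
  obj x := ⟨F.obj x.obj, h _ x.property⟩
  map x y := F.map x.obj y.obj
  map_id x := F.map_id x.obj
  map_comp x y z := F.map_comp x.obj y.obj z.obj

/-- Objects of the tensor product `C ⊗ D` of two `V`-categories. -/
structure TProd (C : Type u₁) (D : Type u₂) where
  fst : C
  snd : D

variable [BraidedCategory V]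

/-- The tensor product of `V`-categories:
`(C ⊗ D)((c, d), (c', d')) = C(c, c') ⊗ D(d, d')`. -/
instance {C : Type u₁} [EnrichedCategory V C] {D : Type u₂} [EnrichedCategory V D] :
    EnrichedCategory V (TProd C D) where
  Hom x y := (x.fst ⟶[V] y.fst) ⊗ (x.snd ⟶[V] y.snd)
  id x := (λ_ (𝟙_ V)).inv ≫ (eId V x.fst ⊗ₘ eId V x.snd)
  comp x y z := tensorμ _ _ _ _ ≫ (eComp V x.fst y.fst z.fst ⊗ₘ eComp V x.snd y.snd z.snd)
  id_comp x y := by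
    rw [← cancel_epi (λ_ _).hom, Iso.hom_inv_id_assoc, tensor_left_unitality]
    simp only [comp_whiskerRight, Category.assoc, Category.comp_id]
    congr 1
    rw [tensorμ_natural_left_assoc]
    congr 1
    rw [tensorHom_comp_tensorHom]
    congr 1 <;> rw [← cancel_epi (λ_ _).inv] <;> simp
  comp_id x y := by
    rw [← cancel_epi (ρ_ _).hom, Iso.hom_inv_id_assoc, tensor_right_unitality]
    simp only [MonoidalCategory.whiskerLeft_comp, Category.assoc, Category.comp_id]
    congr 1
    rw [tensorμ_natural_right_assoc]
    congr 1
    rw [tensorHom_comp_tensorHom]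
    congr 1 <;> rw [← cancel_epi (ρ_ _).inv] <;> simp
  assoc a b c d := by
    rw [← cancel_epi (α_ _ _ _).hom, Iso.hom_inv_id_assoc]
    simp only [comp_whiskerRight, MonoidalCategory.whiskerLeft_comp, Category.assoc]
    rw [tensorμ_natural_left_assoc, tensorμ_natural_right_assoc,
      ← reassoc_of% (tensor_associativity (C := V))]
    simp only [tensorHom_comp_tensorHom, e_assoc']

end Enriched

section Lemmas

variable {V : Type u} [Category.{w} V] [MonoidalCategory V] {D : Type u₁} [EnrichedCategory V D]

theorem eId_comp' {X Y : D} {W : V} (f : W ⟶ (X ⟶[V] Y)) :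
    (eId V X ⊗ₘ f) ≫ eComp V X X Y = (λ_ W).hom ≫ f := by
  rw [← cancel_epi (λ_ W).inv, Iso.inv_hom_id_assoc, MonoidalCategory.tensorHom_def',
    Category.assoc, ← leftUnitor_inv_naturality_assoc, e_id_comp, Category.comp_id]

theorem comp_eId' {X Y : D} {W : V} (f : W ⟶ (X ⟶[V] Y)) :
    (f ⊗ₘ eId V Y) ≫ eComp V X Y Y = (ρ_ W).hom ≫ f := by
  rw [← cancel_epi (ρ_ W).inv, Iso.inv_hom_id_assoc, MonoidalCategory.tensorHom_def,
    Category.assoc, ← rightUnitor_inv_naturality_assoc, e_comp_id, Category.comp_id]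

theorem eComp_assoc' {X Y Z T : D} {W W' W'' : V} (f : W ⟶ (X ⟶[V] Y)) (g : W' ⟶ (Y ⟶[V] Z))
    (h : W'' ⟶ (Z ⟶[V] T)) :
    (f ⊗ₘ ((g ⊗ₘ h) ≫ eComp V Y Z T)) ≫ eComp V X Y T =
      (α_ W W' W'').inv ≫ (((f ⊗ₘ g) ≫ eComp V X Y Z) ⊗ₘ h) ≫ eComp V X Z T := by
  have h1 : f ⊗ₘ ((g ⊗ₘ h) ≫ eComp V Y Z T) = (f ⊗ₘ (g ⊗ₘ h)) ≫ (_ ◁ eComp V Y Z T) := by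
    rw [← id_tensorHom, tensorHom_comp_tensorHom, Category.comp_id]
  have h2 : ((f ⊗ₘ g) ≫ eComp V X Y Z) ⊗ₘ h = ((f ⊗ₘ g) ⊗ₘ h) ≫ (eComp V X Y Z ▷ _) := by
    rw [← tensorHom_id, tensorHom_comp_tensorHom, Category.comp_id]
  rw [h1, h2, Category.assoc, Category.assoc, ← e_assoc, associator_inv_naturality_assoc]

theorem eComp_whisker_middle {A : Type u₁} [Category.{u₂} A] [EnrichedOrdinaryCategory V A]
    {X Y Y' Z : A} (h : Y ⟶ Y') :
    (eHomWhiskerLeft V X h ▷ _) ≫ eComp V X Y' Z = (_ ◁ eHomWhiskerRight V h Z) ≫ eComp V X Y Z := by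
  simp only [eHomWhiskerLeft, eHomWhiskerRight, comp_whiskerRight, Category.assoc,
    MonoidalCategory.whiskerLeft_comp]
  rw [← e_assoc']
  simp

theorem eId_eHomWhiskerLeft {A : Type u₁} [Category.{u₂} A] [EnrichedOrdinaryCategory V A]
    {X Y : A} (f : X ⟶ Y) : eId V X ≫ eHomWhiskerLeft V X f = eHomEquiv V f := by
  rw [eHomWhiskerLeft, rightUnitor_inv_naturality_assoc, ← MonoidalCategory.tensorHom_def_assoc,
    eId_comp', ← unitors_inv_equal, Iso.inv_hom_id_assoc]

theorem eId_eHomWhiskerRight {A : Type u₁} [Category.{u₂} A] [EnrichedOrdinaryCategory V A]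
    {X Y : A} (f : X ⟶ Y) : eId V Y ≫ eHomWhiskerRight V f Y = eHomEquiv V f := by
  rw [eHomWhiskerRight, leftUnitor_inv_naturality_assoc, ← MonoidalCategory.tensorHom_def'_assoc,
    comp_eId', unitors_inv_equal, Iso.inv_hom_id_assoc]

end Lemmas

section FunctorCategory

attribute [local instance] MonoidalClosed.enrichedOrdinaryCategorySelf

variable {V : Type u} [Category.{w} V] [MonoidalCategory V] [BraidedCategory V]
  [MonoidalClosed V] [HasLimits V]
variable {C : Type w} [EnrichedCategory V C]

/-- The morphism `∏_c [F c, G c] ⟶ ∏_{c, d} [C(c, d), [F c, G d]]` given by the action of `F`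
on homs. -/
def natHom.left (F G : EnrichedFunctor V C V) :
    (∏ᶜ fun c : C => (EnrichedCategory.Hom (F.obj c) (G.obj c) : V)) ⟶
      ∏ᶜ fun p : C × C => (ihom (p.1 ⟶[V] p.2)).obj
        (EnrichedCategory.Hom (F.obj p.1) (G.obj p.2)) :=
  Pi.lift fun p => MonoidalClosed.curry
    ((F.map p.1 p.2 ⊗ₘ Pi.π _ p.2) ≫ eComp V (F.obj p.1) (F.obj p.2) (G.obj p.2))

/-- The morphism `∏_c [F c, G c] ⟶ ∏_{c, d} [C(c, d), [F c, G d]]` given by the action of `G`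
on homs. -/
def natHom.right (F G : EnrichedFunctor V C V) :
    (∏ᶜ fun c : C => (EnrichedCategory.Hom (F.obj c) (G.obj c) : V)) ⟶
      ∏ᶜ fun p : C × C => (ihom (p.1 ⟶[V] p.2)).obj
        (EnrichedCategory.Hom (F.obj p.1) (G.obj p.2)) :=
  Pi.lift fun p => MonoidalClosed.curry
    ((β_ _ _).hom ≫ (Pi.π _ p.1 ⊗ₘ G.map p.1 p.2) ≫
      eComp V (F.obj p.1) (G.obj p.1) (G.obj p.2))

/-- The hom object `[C, V](F, G) = ∫_c [F c, G c]` of the functor `V`-category. -/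
abbrev natHom (F G : EnrichedFunctor V C V) : V :=
  equalizer (natHom.left F G) (natHom.right F G)

/-- The projection `pr_c : [C, V](F, G) ⟶ [F c, G c]`. -/
def natHom.pr (F G : EnrichedFunctor V C V) (c : C) :
    natHom F G ⟶ EnrichedCategory.Hom (F.obj c) (G.obj c) :=
  equalizer.ι (natHom.left F G) (natHom.right F G) ≫ Pi.π _ c

theorem natHom.ext {F G : EnrichedFunctor V C V} {W : V} {f g : W ⟶ natHom F G}
    (h : ∀ c, f ≫ natHom.pr F G c = g ≫ natHom.pr F G c) : f = g := by
  apply equalizer.hom_ext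
  apply Pi.hom_ext
  intro c
  simpa only [natHom.pr, Category.assoc] using h c

/-- `V`-naturality in `c`, `d` of a `W`-indexed family `W ⟶ [F c, G c]`. -/
def IsNatFamily (F G : EnrichedFunctor V C V) {W : V}
    (t : ∀ c, W ⟶ EnrichedCategory.Hom (F.obj c) (G.obj c)) : Prop :=
  ∀ c d, (F.map c d ⊗ₘ t d) ≫ eComp V (F.obj c) (F.obj d) (G.obj d) =
    (β_ _ _).hom ≫ (t c ⊗ₘ G.map c d) ≫ eComp V (F.obj c) (G.obj c) (G.obj d)

theorem isNatFamily_iff (F G : EnrichedFunctor V C V) {W : V}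
    (t : ∀ c, W ⟶ EnrichedCategory.Hom (F.obj c) (G.obj c)) :
    IsNatFamily F G t ↔ Pi.lift t ≫ natHom.left F G = Pi.lift t ≫ natHom.right F G := by
  have hl : ∀ p : C × C, (Pi.lift t ≫ natHom.left F G) ≫ Pi.π _ p =
      MonoidalClosed.curry ((F.map p.1 p.2 ⊗ₘ t p.2) ≫ eComp V _ _ _) := by
    intro p
    rw [natHom.left, Category.assoc, Limits.Pi.lift_π, ← MonoidalClosed.curry_natural_left,
      ← id_tensorHom, tensorHom_comp_tensorHom_assoc, Category.id_comp, Limits.Pi.lift_π]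
  have hr : ∀ p : C × C, (Pi.lift t ≫ natHom.right F G) ≫ Pi.π _ p =
      MonoidalClosed.curry ((β_ _ _).hom ≫ (t p.1 ⊗ₘ G.map p.1 p.2) ≫ eComp V _ _ _) := by
    intro p
    rw [natHom.right, Category.assoc, Limits.Pi.lift_π, ← MonoidalClosed.curry_natural_left,
      ← id_tensorHom, BraidedCategory.braiding_naturality_assoc, tensorHom_comp_tensorHom_assoc,
      Category.id_comp, Limits.Pi.lift_π]
  constructor
  · intro h
    apply Pi.hom_ext
    intro p
    rw [hl, hr, h p.1 p.2]
  · intro h c d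
    have := congrArg (· ≫ Pi.π _ (c, d)) h
    simp only [hl, hr] at this
    exact MonoidalClosed.curry_injective this

theorem natHom.isNatFamily_pr (F G : EnrichedFunctor V C V) :
    IsNatFamily F G (natHom.pr F G) := by
  rw [isNatFamily_iff]
  have : Pi.lift (natHom.pr F G) = equalizer.ι (natHom.left F G) (natHom.right F G) := by
    apply Pi.hom_ext
    intro c
    rw [Limits.Pi.lift_π, natHom.pr]
  rw [this]
  exact equalizer.condition _ _

/-- The morphism `W ⟶ [C, V](F, G)` induced by a `V`-natural family `W ⟶ [F c, G c]`. -/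
def natHom.lift {F G : EnrichedFunctor V C V} {W : V}
    (t : ∀ c, W ⟶ EnrichedCategory.Hom (F.obj c) (G.obj c)) (ht : IsNatFamily F G t) :
    W ⟶ natHom F G :=
  equalizer.lift (Pi.lift t) ((isNatFamily_iff F G t).1 ht)

theorem natHom.lift_pr {F G : EnrichedFunctor V C V} {W : V}
    (t : ∀ c, W ⟶ EnrichedCategory.Hom (F.obj c) (G.obj c)) (ht : IsNatFamily F G t) (c : C) :
    natHom.lift t ht ≫ natHom.pr F G c = t c := by
  rw [natHom.lift, natHom.pr, equalizer.lift_ι_assoc, Limits.Pi.lift_π]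

theorem IsNatFamily.precomp {F G : EnrichedFunctor V C V} {W W' : V}
    {t : ∀ c, W ⟶ EnrichedCategory.Hom (F.obj c) (G.obj c)} (ht : IsNatFamily F G t)
    (f : W' ⟶ W) : IsNatFamily F G (fun c => f ≫ t c) := by
  intro c d
  have := congrArg (fun k => (𝟙 _ ⊗ₘ f) ≫ k) (ht c d)
  simp only [BraidedCategory.braiding_naturality_assoc, tensorHom_comp_tensorHom_assoc,
    Category.id_comp] at this
  exact this

theorem isNatFamily_eId (F : EnrichedFunctor V C V) :
    IsNatFamily F F (fun c => eId V (F.obj c)) := by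
  intro c d
  rw [comp_eId', eId_comp', braiding_leftUnitor_assoc]

theorem IsNatFamily.comp {F G H : EnrichedFunctor V C V} {W W' : V}
    {t : ∀ c, W ⟶ EnrichedCategory.Hom (F.obj c) (G.obj c)} (ht : IsNatFamily F G t)
    {s : ∀ c, W' ⟶ EnrichedCategory.Hom (G.obj c) (H.obj c)} (hs : IsNatFamily G H s) :
    IsNatFamily F H (fun c => (t c ⊗ₘ s c) ≫ eComp V (F.obj c) (G.obj c) (H.obj c)) := by
  intro c d
  have key : ∀ {X Y Z : V} (f : X ⟶ Y) (k : Y ⟶ Z) {X' Z' : V} (g : X' ⟶ Z'),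
      (f ≫ k) ⊗ₘ g = (f ▷ X') ≫ (k ⊗ₘ g) := by
    intros; rw [← tensorHom_id, tensorHom_comp_tensorHom, Category.id_comp]
  have key' : ∀ {X Y Z : V} (f : X ⟶ Y) (k : Y ⟶ Z) {X' Z' : V} (g : X' ⟶ Z'),
      g ⊗ₘ (f ≫ k) = (X' ◁ f) ≫ (g ⊗ₘ k) := by
    intros; rw [← id_tensorHom, tensorHom_comp_tensorHom, Category.id_comp]
  have e1 := eComp_assoc' (F.map c d) (t d) (s d)
  rw [ht c d, key, Category.assoc] at e1
  have e2 := eComp_assoc' (t c) (G.map c d) (s d)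
  rw [hs c d, key', Category.assoc, eComp_assoc'] at e2
  rw [← cancel_epi (α_ _ _ _).hom, Iso.hom_inv_id_assoc] at e2
  rw [e1, ← e2, BraidedCategory.braiding_tensor_right_hom]
  simp only [Category.assoc]

/-- A `V`-functor `F : C ⟶ V` together with a family of morphisms `F (s j) ⟶ F (t j)`. -/
structure OpFunctor (V : Type u) [Category.{w} V] [MonoidalCategory V] [MonoidalClosed V]
    {C : Type w} [EnrichedCategory V C] {J : Type w} (s t : J → C) where
  functor : EnrichedFunctor V C V
  op : ∀ j, functor.obj (s j) ⟶ functor.obj (t j)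

namespace OpFunctor

variable {J : Type w} {s t : J → C}

/-- `pr_{s j}` followed by the operation of the target. -/
def left (P Q : OpFunctor V s t) : natHom P.functor Q.functor ⟶
    ∏ᶜ fun j => (EnrichedCategory.Hom (P.functor.obj (s j)) (Q.functor.obj (t j)) : V) :=
  Pi.lift fun j => natHom.pr P.functor Q.functor (s j) ≫ eHomWhiskerLeft V _ (Q.op j)

/-- `pr_{t j}` preceded by the operation of the source. -/
def right (P Q : OpFunctor V s t) : natHom P.functor Q.functor ⟶
    ∏ᶜ fun j => (EnrichedCategory.Hom (P.functor.obj (s j)) (Q.functor.obj (t j)) : V) :=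
  Pi.lift fun j => natHom.pr P.functor Q.functor (t j) ≫ eHomWhiskerRight V (P.op j) _

/-- The intersection over all `j` of the equalizers of
`[C, V](F, G) ⇉ [F (s j), G (t j)]`: the `V`-natural transformations commuting with the
operations. -/
abbrev hom (P Q : OpFunctor V s t) : V := equalizer (left P Q) (right P Q)

/-- The projection `pr_c` from the hom object to `[F c, G c]`. -/
def pr (P Q : OpFunctor V s t) (c : C) :
    hom P Q ⟶ EnrichedCategory.Hom (P.functor.obj c) (Q.functor.obj c) :=
  equalizer.ι (left P Q) (right P Q) ≫ natHom.pr P.functor Q.functor c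

theorem hom_ext {P Q : OpFunctor V s t} {W : V} {f g : W ⟶ hom P Q}
    (h : ∀ c, f ≫ pr P Q c = g ≫ pr P Q c) : f = g := by
  apply equalizer.hom_ext
  apply natHom.ext
  intro c
  simpa only [pr, Category.assoc] using h c

theorem isNatFamily_pr (P Q : OpFunctor V s t) : IsNatFamily P.functor Q.functor (pr P Q) :=
  (natHom.isNatFamily_pr P.functor Q.functor).precomp _

theorem pr_op (P Q : OpFunctor V s t) (j : J) :
    pr P Q (s j) ≫ eHomWhiskerLeft V _ (Q.op j) =
      pr P Q (t j) ≫ eHomWhiskerRight V (P.op j) _ := by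
  have hl : left P Q ≫ Pi.π _ j = natHom.pr P.functor Q.functor (s j) ≫
      eHomWhiskerLeft V _ (Q.op j) := by rw [left, Limits.Pi.lift_π]
  have hr : right P Q ≫ Pi.π _ j = natHom.pr P.functor Q.functor (t j) ≫
      eHomWhiskerRight V (P.op j) _ := by rw [right, Limits.Pi.lift_π]
  have h := (equalizer.condition (left P Q) (right P Q)) =≫ Pi.π _ j
  rw [Category.assoc, Category.assoc, hl, hr] at h
  rw [pr, pr, Category.assoc, Category.assoc]
  exact h

/-- The morphism into the hom object induced by a `V`-natural family commuting with the
operations. -/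
def homLift {P Q : OpFunctor V s t} {W : V}
    (k : ∀ c, W ⟶ EnrichedCategory.Hom (P.functor.obj c) (Q.functor.obj c))
    (hk : IsNatFamily P.functor Q.functor k)
    (hk' : ∀ j, k (s j) ≫ eHomWhiskerLeft V _ (Q.op j) =
      k (t j) ≫ eHomWhiskerRight V (P.op j) _) :
    W ⟶ hom P Q :=
  equalizer.lift (natHom.lift k hk) (by
    apply Pi.hom_ext
    intro j
    simp only [left, right, Category.assoc, Limits.Pi.lift_π]
    rw [reassoc_of% natHom.lift_pr k hk, reassoc_of% natHom.lift_pr k hk, hk' j])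

theorem homLift_pr {P Q : OpFunctor V s t} {W : V}
    (k : ∀ c, W ⟶ EnrichedCategory.Hom (P.functor.obj c) (Q.functor.obj c))
    (hk : IsNatFamily P.functor Q.functor k)
    (hk' : ∀ j, k (s j) ≫ eHomWhiskerLeft V _ (Q.op j) =
      k (t j) ≫ eHomWhiskerRight V (P.op j) _) (c : C) :
    homLift k hk hk' ≫ pr P Q c = k c := by
  rw [homLift, pr, equalizer.lift_ι_assoc, natHom.lift_pr]

/-- Identities: `pr_c` of the identity of `F` is the identity of `F c`. -/
def homId (P : OpFunctor V s t) : 𝟙_ V ⟶ hom P P :=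
  homLift (fun c => eId V (P.functor.obj c)) (isNatFamily_eId P.functor) (fun j => by
    rw [eId_eHomWhiskerLeft, eId_eHomWhiskerRight])

/-- Composition: `pr_c` of a composite is the composite of the `pr_c`. -/
def homComp (P Q R : OpFunctor V s t) : hom P Q ⊗ hom Q R ⟶ hom P R :=
  homLift (fun c => (pr P Q c ⊗ₘ pr Q R c) ≫ eComp V _ _ _)
    ((isNatFamily_pr P Q).comp (isNatFamily_pr Q R)) (fun j => by
      have e1 : ∀ {X Y Z : V} (f : X ⟶ Y) (k : Y ⟶ Z) {X' Z' : V} (g : X' ⟶ Z'),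
          (f ⊗ₘ g) ≫ (k ▷ Z') = (f ≫ k) ⊗ₘ g := by
        intros; rw [← tensorHom_id, tensorHom_comp_tensorHom, Category.comp_id]
      have e2 : ∀ {X Y Z : V} (f : X ⟶ Y) (k : Y ⟶ Z) {X' Z' : V} (g : X' ⟶ Z'),
          (g ⊗ₘ f) ≫ (Z' ◁ k) = g ⊗ₘ (f ≫ k) := by
        intros; rw [← id_tensorHom, tensorHom_comp_tensorHom, Category.comp_id]
      rw [Category.assoc, Category.assoc, eComp_eHomWhiskerLeft, eComp_eHomWhiskerRight,
        reassoc_of% e2, reassoc_of% e1, pr_op, ← pr_op P Q, ← reassoc_of% e1, ← reassoc_of% e2,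
        eComp_whisker_middle])

theorem homId_pr (P : OpFunctor V s t) (c : C) : homId P ≫ pr P P c = eId V (P.functor.obj c) :=
  homLift_pr _ _ _ c

theorem homComp_pr (P Q R : OpFunctor V s t) (c : C) :
    homComp P Q R ≫ pr P R c = (pr P Q c ⊗ₘ pr Q R c) ≫ eComp V _ _ _ :=
  homLift_pr _ _ _ c

instance : EnrichedCategory V (OpFunctor V s t) where
  Hom := hom
  id := homId
  comp := homComp
  id_comp P Q := by
    apply hom_ext
    intro c
    rw [Category.assoc, Category.assoc, homComp_pr, Category.id_comp, ← tensorHom_id,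
      tensorHom_comp_tensorHom_assoc, homId_pr, Category.id_comp, eId_comp',
      Iso.inv_hom_id_assoc]
  comp_id P Q := by
    apply hom_ext
    intro c
    rw [Category.assoc, Category.assoc, homComp_pr, Category.id_comp, ← id_tensorHom,
      tensorHom_comp_tensorHom_assoc, homId_pr, Category.id_comp, comp_eId',
      Iso.inv_hom_id_assoc]
  assoc P Q R S := by
    apply hom_ext
    intro c
    simp only [Category.assoc]
    rw [homComp_pr, homComp_pr, ← tensorHom_id, ← id_tensorHom,
      tensorHom_comp_tensorHom_assoc, tensorHom_comp_tensorHom_assoc,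
      homComp_pr, homComp_pr, Category.id_comp, Category.id_comp, eComp_assoc']

end OpFunctor

end FunctorCategory

section Monoidal

/-- A monoidal `V`-category: a `V`-category `A` (with underlying category `A`) whose underlying
category is monoidal, with the tensor product enriched to a `V`-functor `A ⊗ A ⟶ A` and with
`V`-natural associativity and unit constraints. -/
class MonoidalVCategory (V : Type u) [Category.{w} V] [MonoidalCategory V] [BraidedCategory V]
    (A : Type u₁) [Category.{u₂} A] [MonoidalCategory A] [EnrichedOrdinaryCategory V A] where
  /-- The action of the tensor product on hom objects. -/
  tensorMap (X X' Y Y' : A) : (X ⟶[V] X') ⊗ (Y ⟶[V] Y') ⟶ ((X ⊗ Y : A) ⟶[V] (X' ⊗ Y' : A))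
  /-- On underlying morphisms, it is the tensor product of the underlying category. -/
  tensorMap_underlying {X X' Y Y' : A} (f : X ⟶ X') (g : Y ⟶ Y') :
    (λ_ (𝟙_ V)).inv ≫ (eHomEquiv V f ⊗ₘ eHomEquiv V g) ≫ tensorMap X X' Y Y' =
      eHomEquiv V (f ⊗ₘ g)
  tensorMap_comp (X X' X'' Y Y' Y'' : A) :
    tensorμ (X ⟶[V] X') (Y ⟶[V] Y') (X' ⟶[V] X'') (Y' ⟶[V] Y'') ≫
        (eComp V X X' X'' ⊗ₘ eComp V Y Y' Y'') ≫ tensorMap X X'' Y Y'' =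
      (tensorMap X X' Y Y' ⊗ₘ tensorMap X' X'' Y' Y'') ≫ eComp V _ _ _
  associator_natural (X X' Y Y' Z Z' : A) :
    (tensorMap X X' Y Y' ▷ (Z ⟶[V] Z')) ≫ tensorMap (X ⊗ Y) (X' ⊗ Y') Z Z' ≫
        eHomWhiskerLeft V _ (α_ X' Y' Z').hom =
      (α_ _ _ _).hom ≫ ((X ⟶[V] X') ◁ tensorMap Y Y' Z Z') ≫
        tensorMap X X' (Y ⊗ Z) (Y' ⊗ Z') ≫ eHomWhiskerRight V (α_ X Y Z).hom _
  leftUnitor_natural (X X' : A) :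
    (λ_ (X ⟶[V] X')).inv ≫ (eId V (𝟙_ A) ▷ _) ≫ tensorMap (𝟙_ A) (𝟙_ A) X X' ≫
        eHomWhiskerLeft V _ (λ_ X').hom = eHomWhiskerRight V (λ_ X).hom X'
  rightUnitor_natural (X X' : A) :
    (ρ_ (X ⟶[V] X')).inv ≫ (_ ◁ eId V (𝟙_ A)) ≫ tensorMap X X' (𝟙_ A) (𝟙_ A) ≫
        eHomWhiskerLeft V _ (ρ_ X').hom = eHomWhiskerRight V (ρ_ X).hom X'

variable (V : Type u) [Category.{w} V] [MonoidalCategory V]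
variable {A : Type u₁} [Category.{u₂} A] [MonoidalCategory A] [EnrichedOrdinaryCategory V A]

section Braided

variable [BraidedCategory V] [MonoidalVCategory V A]

/-- The action `A(Y, Y') ⟶ A(X ⊗ Y, X ⊗ Y')` on homs of the `V`-functor `X ⊗ -`. -/
def tensL (X Y Y' : A) : (Y ⟶[V] Y') ⟶ ((X ⊗ Y : A) ⟶[V] (X ⊗ Y' : A)) :=
  (λ_ _).inv ≫ (eId V X ▷ _) ≫ MonoidalVCategory.tensorMap X X Y Y'

/-- The action `A(X, X') ⟶ A(X ⊗ Y, X' ⊗ Y)` on homs of the `V`-functor `- ⊗ Y`. -/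
def tensR (X X' Y : A) : (X ⟶[V] X') ⟶ ((X ⊗ Y : A) ⟶[V] (X' ⊗ Y : A)) :=
  (ρ_ _).inv ≫ (_ ◁ eId V Y) ≫ MonoidalVCategory.tensorMap X X' Y Y

end Braided

/-- A closed monoidal `V`-category: the `V`-functors `X ⊗ -` and `- ⊗ X` have right adjoints
`Y ↦ Y^X` (written `rhom X Y`) and `Y ↦ ^X Y` (written `lhom X Y`), given by evaluation morphisms
`e_r : X ⊗ Y^X ⟶ Y` and `e_l : ^X Y ⊗ X ⟶ Y` that induce isomorphisms
`A(B, Y^X) ≅ A(X ⊗ B, Y)` and `A(B, ^X Y) ≅ A(B ⊗ X, Y)` in `V`. -/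
class ClosedVCategory (V : Type u) [Category.{w} V] [MonoidalCategory V] [BraidedCategory V]
    (A : Type u₁) [Category.{u₂} A] [MonoidalCategory A] [EnrichedOrdinaryCategory V A]
    [MonoidalVCategory V A] where
  rhom : A → A → A
  rev (X Y : A) : X ⊗ rhom X Y ⟶ Y
  isIso_rev (X Y B : A) : IsIso (tensL V X B (rhom X Y) ≫ eHomWhiskerLeft V (X ⊗ B) (rev X Y))
  lhom : A → A → A
  lev (X Y : A) : lhom X Y ⊗ X ⟶ Y
  isIso_lev (X Y B : A) : IsIso (tensR V B (lhom X Y) X ≫ eHomWhiskerLeft V (B ⊗ X) (lev X Y))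

end Monoidal

section Parametrized

variable {V : Type u} [Category.{w} V] [MonoidalCategory V]

theorem tensorμ_braiding [SymmetricCategory V] (a b c d : V) :
    tensorμ a b c d ≫ (β_ (a ⊗ c) (b ⊗ d)).hom =
      ((β_ a b).hom ⊗ₘ (β_ c d).hom) ≫ tensorμ b a d c := by
  simp [tensorμ, SymmetricCategory.braiding_swap_eq_inv_braiding c b,
    MonoidalCategory.tensorHom_def]

theorem tensorμ_coherence [BraidedCategory V] (a b c d : V) :
    tensorμ a b c d ≫ (α_ (a ⊗ c) b d).inv ≫ (((β_ a c).hom ▷ b) ▷ d) =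
      (α_ (a ⊗ b) c d).inv ≫ (((β_ (a ⊗ b) c).hom ≫ (α_ c a b).inv) ▷ d) := by
  rw [BraidedCategory.braiding_tensor_left_hom]
  simp only [tensorμ]
  monoidal

variable [BraidedCategory V]

theorem coherence_ll (b c : V) : ((λ_ b).inv ⊗ₘ (λ_ c).inv) ≫ tensorμ (𝟙_ V) b (𝟙_ V) c =
    (λ_ (b ⊗ c)).inv ≫ ((λ_ (𝟙_ V)).inv ▷ _) := by
  rw [← cancel_mono (((λ_ (𝟙_ V)).hom ▷ (b ⊗ c)) ≫ (λ_ (b ⊗ c)).hom), Category.assoc,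
    ← leftUnitor_monoidal, tensorHom_comp_tensorHom]
  simp

theorem coherence_rr (b c : V) : ((ρ_ b).inv ⊗ₘ (ρ_ c).inv) ≫ tensorμ b (𝟙_ V) c (𝟙_ V) =
    (ρ_ (b ⊗ c)).inv ≫ (_ ◁ (λ_ (𝟙_ V)).inv) := by
  rw [← cancel_mono (((b ⊗ c) ◁ (λ_ (𝟙_ V)).hom) ≫ (ρ_ (b ⊗ c)).hom), Category.assoc,
    ← rightUnitor_monoidal, tensorHom_comp_tensorHom]
  simp

theorem coherence_lr (b c : V) : ((λ_ b).inv ⊗ₘ (ρ_ c).inv) ≫ tensorμ (𝟙_ V) b c (𝟙_ V) =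
    (β_ b c).hom ≫ ((λ_ c).inv ⊗ₘ (ρ_ b).inv) := by
  simp only [tensorμ]
  monoidal

theorem coherence_rl (b c : V) : ((ρ_ b).inv ⊗ₘ (λ_ c).inv) ≫ tensorμ b (𝟙_ V) (𝟙_ V) c =
    ((ρ_ b).inv ⊗ₘ (λ_ c).inv) := by
  simp only [tensorμ, braiding_tensorUnit_left]
  monoidal

variable {A : Type u₁} [Category.{u₂} A] [EnrichedOrdinaryCategory V A]

section

variable (M : EnrichedFunctor V (TProd A A) A)

/-- The action on homs of a `V`-functor of two variables. -/
def bimap (X X' B B' : A) :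
    (X ⟶[V] X') ⊗ (B ⟶[V] B') ⟶ (M.obj ⟨X, B⟩ ⟶[V] M.obj ⟨X', B'⟩) :=
  M.map ⟨X, B⟩ ⟨X', B'⟩

theorem bimap_id (X B : A) :
    (λ_ (𝟙_ V)).inv ≫ (eId V X ⊗ₘ eId V B) ≫ bimap M X X B B = eId V (M.obj ⟨X, B⟩) :=
  (Category.assoc _ _ _).symm.trans (M.map_id ⟨X, B⟩)

theorem bimap_comp (X X' X'' B B' B'' : A) :
    (bimap M X X' B B' ⊗ₘ bimap M X' X'' B' B'') ≫ eComp V _ _ _ =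
      tensorμ _ _ _ _ ≫ (eComp V X X' X'' ⊗ₘ eComp V B B' B'') ≫ bimap M X X'' B B'' :=
  (M.map_comp ⟨X, B⟩ ⟨X', B'⟩ ⟨X'', B''⟩).symm.trans (Category.assoc _ _ _)

theorem bimap_elt {X X' X'' B B' B'' : A} {P Q P' Q' : V} (f : P ⟶ (X ⟶[V] X'))
    (g : Q ⟶ (B ⟶[V] B')) (f' : P' ⟶ (X' ⟶[V] X'')) (g' : Q' ⟶ (B' ⟶[V] B'')) :
    (((f ⊗ₘ g) ≫ bimap M X X' B B') ⊗ₘ ((f' ⊗ₘ g') ≫ bimap M X' X'' B' B'')) ≫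
        eComp V _ _ _ =
      tensorμ _ _ _ _ ≫ (((f ⊗ₘ f') ≫ eComp V X X' X'') ⊗ₘ ((g ⊗ₘ g') ≫ eComp V B B' B'')) ≫
        bimap M X X'' B B'' := by
  rw [← tensorHom_comp_tensorHom_assoc, bimap_comp, tensorμ_natural_assoc,
    tensorHom_comp_tensorHom_assoc]

/-- The action on homs of `M(X, -)`. -/
def partL (X B B' : A) : (B ⟶[V] B') ⟶ (M.obj ⟨X, B⟩ ⟶[V] M.obj ⟨X, B'⟩) :=
  (λ_ _).inv ≫ (eId V X ▷ _) ≫ bimap M X X B B'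

/-- The action on homs of `M(-, B)`. -/
def partR (X X' B : A) : (X ⟶[V] X') ⟶ (M.obj ⟨X, B⟩ ⟶[V] M.obj ⟨X', B⟩) :=
  (ρ_ _).inv ≫ (_ ◁ eId V B) ≫ bimap M X X' B B

theorem partL_eq (X B B' : A) :
    partL M X B B' = (λ_ _).inv ≫ (eId V X ⊗ₘ 𝟙 (B ⟶[V] B')) ≫ bimap M X X B B' := by
  rw [tensorHom_id, partL]

theorem partR_eq (X X' B : A) :
    partR M X X' B = (ρ_ _).inv ≫ (𝟙 (X ⟶[V] X') ⊗ₘ eId V B) ≫ bimap M X X' B B := by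
  rw [id_tensorHom, partR]

theorem partL_id (X B : A) : eId V B ≫ partL M X B B = eId V (M.obj ⟨X, B⟩) := by
  rw [partL, leftUnitor_inv_naturality_assoc, ← MonoidalCategory.tensorHom_def'_assoc,
    bimap_id]

theorem partR_id (X B : A) : eId V X ≫ partR M X X B = eId V (M.obj ⟨X, B⟩) := by
  rw [partR, rightUnitor_inv_naturality_assoc, ← MonoidalCategory.tensorHom_def_assoc,
    ← unitors_inv_equal, bimap_id]

theorem partL_comp (X B B' B'' : A) :
    (partL M X B B' ⊗ₘ partL M X B' B'') ≫ eComp V _ _ _ =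
      eComp V B B' B'' ≫ partL M X B B'' := by
  rw [partL_eq, partL_eq, partL_eq, ← tensorHom_comp_tensorHom_assoc, bimap_elt,
    reassoc_of% coherence_ll, eId_comp', leftUnitor_inv_naturality_assoc,
    ← tensorHom_id (λ_ (𝟙_ V)).inv, tensorHom_comp_tensorHom_assoc, Iso.inv_hom_id_assoc,
    Category.id_comp, id_tensorHom_id, Category.id_comp, ← id_tensorHom,
    tensorHom_comp_tensorHom_assoc, Category.id_comp, Category.comp_id]

theorem partR_comp (X X' X'' B : A) :
    (partR M X X' B ⊗ₘ partR M X' X'' B) ≫ eComp V _ _ _ =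
      eComp V X X' X'' ≫ partR M X X'' B := by
  rw [partR_eq, partR_eq, partR_eq, ← tensorHom_comp_tensorHom_assoc, bimap_elt,
    reassoc_of% coherence_rr, eId_comp', rightUnitor_inv_naturality_assoc,
    ← id_tensorHom _ (λ_ (𝟙_ V)).inv, tensorHom_comp_tensorHom_assoc, Iso.inv_hom_id_assoc,
    Category.id_comp, id_tensorHom_id, Category.id_comp, ← tensorHom_id,
    tensorHom_comp_tensorHom_assoc, Category.id_comp, Category.comp_id]

theorem part_interchange (X X' B B' : A) :
    (partL M X B B' ⊗ₘ partR M X X' B') ≫ eComp V _ _ _ =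
      (β_ _ _).hom ≫ (partR M X X' B ⊗ₘ partL M X' B B') ≫ eComp V _ _ _ := by
  have h1 : (partL M X B B' ⊗ₘ partR M X X' B') ≫ eComp V _ _ _ =
      (β_ _ _).hom ≫ bimap M X X' B B' := by
    rw [partL_eq, partR_eq, ← tensorHom_comp_tensorHom_assoc, bimap_elt, eId_comp', comp_eId',
      reassoc_of% coherence_lr, tensorHom_comp_tensorHom_assoc]
    simp
  have h2 : (partR M X X' B ⊗ₘ partL M X' B B') ≫ eComp V _ _ _ = bimap M X X' B B' := by
    rw [partL_eq, partR_eq, ← tensorHom_comp_tensorHom_assoc, bimap_elt, eId_comp', comp_eId',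
      reassoc_of% coherence_rl, tensorHom_comp_tensorHom_assoc]
    simp
  rw [h1, h2]

end

end Parametrized

section InternalHom

variable {V : Type u} [Category.{w} V] [MonoidalCategory V] [BraidedCategory V]
variable {A : Type u₁} [Category.{u₂} A] [EnrichedOrdinaryCategory V A]
variable (M : EnrichedFunctor V (TProd A A) A) (h : A → A → A)
  (ev : ∀ X Y, M.obj ⟨X, h X Y⟩ ⟶ Y)

/-- The morphism `A(B, h X Y) ⟶ A(M(X, B), Y)` induced by `ev : M(X, h X Y) ⟶ Y`. -/
def transp (X Y B : A) : (B ⟶[V] h X Y) ⟶ (M.obj ⟨X, B⟩ ⟶[V] Y) :=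
  partL M X B (h X Y) ≫ eHomWhiskerLeft V _ (ev X Y)

/-- The morphism `A(X', X) ⟶ A(M(X', h X Y), Y)` induced by `ev`. -/
def evMap (X' X Y : A) : (X' ⟶[V] X) ⟶ (M.obj ⟨X', h X Y⟩ ⟶[V] Y) :=
  partR M X' X (h X Y) ≫ eHomWhiskerLeft V _ (ev X Y)

theorem elt_eHomWhiskerLeft {X Y Z Z' : A} {W W' : V} (f : W ⟶ (X ⟶[V] Y)) (g : W' ⟶ (Y ⟶[V] Z))
    (k : Z ⟶ Z') :
    (f ⊗ₘ g) ≫ eComp V X Y Z ≫ eHomWhiskerLeft V X k =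
      (f ⊗ₘ (g ≫ eHomWhiskerLeft V Y k)) ≫ eComp V X Y Z' := by
  rw [eComp_eHomWhiskerLeft, ← id_tensorHom, tensorHom_comp_tensorHom_assoc, Category.comp_id]

theorem transp_comp {X Y B B' : A} {W W' : V} (f : W ⟶ (B ⟶[V] B'))
    (g : W' ⟶ (B' ⟶[V] h X Y)) :
    (f ⊗ₘ g) ≫ eComp V B B' (h X Y) ≫ transp M h ev X Y B =
      ((f ≫ partL M X B B') ⊗ₘ (g ≫ transp M h ev X Y B')) ≫ eComp V _ _ _ := by
  rw [transp, ← reassoc_of% partL_comp, tensorHom_comp_tensorHom_assoc, elt_eHomWhiskerLeft,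
    transp, Category.assoc]

theorem evMap_comp {X'' X' X Y : A} :
    eComp V X'' X' X ≫ evMap M h ev X'' X Y =
      (partR M X'' X' (h X Y) ⊗ₘ evMap M h ev X' X Y) ≫ eComp V _ _ _ := by
  rw [evMap, ← reassoc_of% partR_comp, elt_eHomWhiskerLeft, evMap]

variable [∀ X Y B, IsIso (transp M h ev X Y B)]

/-- The action on homs `A(X', X) ⊗ A(Y, Y') ⟶ A(h X Y, h X' Y')`. -/
def homMap (X X' Y Y' : A) : (X' ⟶[V] X) ⊗ (Y ⟶[V] Y') ⟶ (h X Y ⟶[V] h X' Y') :=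
  (evMap M h ev X' X Y ▷ _) ≫ eComp V _ _ _ ≫ inv (transp M h ev X' Y' (h X Y))

theorem homMap_transp (X X' Y Y' : A) :
    homMap M h ev X X' Y Y' ≫ transp M h ev X' Y' (h X Y) =
      (evMap M h ev X' X Y ⊗ₘ 𝟙 (Y ⟶[V] Y')) ≫ eComp V _ _ _ := by
  rw [homMap, Category.assoc, Category.assoc, IsIso.inv_hom_id, Category.comp_id, tensorHom_id]

theorem homMap_id (X Y : A) :
    (λ_ (𝟙_ V)).inv ≫ (eId V X ⊗ₘ eId V Y) ≫ homMap M h ev X X Y Y = eId V (h X Y) := by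
  rw [← cancel_mono (transp M h ev X Y (h X Y)), Category.assoc, Category.assoc, homMap_transp,
    tensorHom_comp_tensorHom_assoc, Category.comp_id, comp_eId', evMap, reassoc_of% partR_id,
    transp, reassoc_of% partL_id, unitors_inv_equal, Iso.inv_hom_id_assoc]

theorem homMap_partL_evMap (X X' X'' Y Y' : A) :
    (homMap M h ev X X' Y Y' ⊗ₘ 𝟙 (X'' ⟶[V] X')) ≫
        (partL M X'' (h X Y) (h X' Y') ⊗ₘ evMap M h ev X'' X' Y') ≫ eComp V _ _ _ =
      (β_ _ _).hom ≫ (α_ _ _ _).inv ≫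
        ((eComp V X'' X' X ≫ evMap M h ev X'' X Y) ⊗ₘ 𝟙 (Y ⟶[V] Y')) ≫ eComp V _ _ _ := by
  rw [evMap, ← elt_eHomWhiskerLeft, reassoc_of% part_interchange,
    BraidedCategory.braiding_naturality_assoc, elt_eHomWhiskerLeft,
    tensorHom_comp_tensorHom_assoc, Category.id_comp]
  have e : homMap M h ev X X' Y Y' ≫ partL M X' (h X Y) (h X' Y') ≫
      eHomWhiskerLeft V _ (ev X' Y') = (evMap M h ev X' X Y ⊗ₘ 𝟙 (Y ⟶[V] Y')) ≫ eComp V _ _ _ :=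
    homMap_transp M h ev X X' Y Y'
  rw [e, eComp_assoc', ← evMap_comp]

theorem homMap_comp (X X' X'' Y Y' Y'' : A) :
    (homMap M h ev X X' Y Y' ⊗ₘ homMap M h ev X' X'' Y' Y'') ≫ eComp V _ _ _ =
      tensorμ _ _ _ _ ≫ (((β_ _ _).hom ≫ eComp V X'' X' X) ⊗ₘ eComp V Y Y' Y'') ≫
        homMap M h ev X X'' Y Y'' := by
  rw [← cancel_mono (transp M h ev X'' Y'' (h X Y))]
  simp only [Category.assoc]
  rw [transp_comp, homMap_transp, homMap_transp, tensorHom_comp_tensorHom_assoc, eComp_assoc',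
    ← Category.id_comp (evMap M h ev X'' X' Y'), ← tensorHom_comp_tensorHom_assoc,
    homMap_partL_evMap]
  have e : eComp V Y Y' Y'' ≫ 𝟙 (Y ⟶[V] Y'') =
      (𝟙 (Y ⟶[V] Y') ⊗ₘ 𝟙 (Y' ⟶[V] Y'')) ≫ eComp V Y Y' Y'' := by simp
  rw [e, eComp_assoc']
  have k : ∀ {P Q R S : V} (f : P ⟶ Q) (g : Q ⟶ R), (f ≫ g) ⊗ₘ 𝟙 S = (f ▷ S) ≫ (g ⊗ₘ 𝟙 S) := by
    intros
    simp
  have c := tensorμ_coherence (X' ⟶[V] X) (Y ⟶[V] Y') (X'' ⟶[V] X') (Y' ⟶[V] Y'')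
  simp only [k, Category.assoc] at c ⊢
  simp only [comp_whiskerRight] at c ⊢
  rw [← reassoc_of% c]

/-- The `V`-functor `Aᵒᵖ ⊗ A ⟶ A`, `(X, Y) ↦ h X Y`, right adjoint to `M` with parameter. -/
def homFunctor : EnrichedFunctor V (TProd Aᵒᵖ A) A where
  obj x := h x.fst.unop x.snd
  map x y := homMap M h ev x.fst.unop y.fst.unop x.snd y.snd
  map_id x := (Category.assoc _ _ _).trans (homMap_id M h ev x.fst.unop x.snd)
  map_comp x y z := (Category.assoc _ _ _).trans
    (homMap_comp M h ev x.fst.unop y.fst.unop z.fst.unop x.snd y.snd z.snd).symm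

end InternalHom

section ClosedMonoidal

variable (V : Type u) [Category.{w} V] [MonoidalCategory V] [SymmetricCategory V]
variable {A : Type u₁} [Category.{u₂} A] [MonoidalCategory A] [EnrichedOrdinaryCategory V A]
  [MonoidalVCategory V A]

/-- The tensor product `V`-functor `(X, Y) ↦ X ⊗ Y`. -/
def tensorFunctor : EnrichedFunctor V (TProd A A) A where
  obj x := x.fst ⊗ x.snd
  map x y := MonoidalVCategory.tensorMap x.fst y.fst x.snd y.snd
  map_id x := by
    have h := MonoidalVCategory.tensorMap_underlying (V := V) (𝟙 x.fst) (𝟙 x.snd)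
    rw [eHomEquiv_id, eHomEquiv_id, id_tensorHom_id, eHomEquiv_id] at h
    exact (Category.assoc _ _ _).trans h
  map_comp x y z := (Category.assoc _ _ _).trans
    (MonoidalVCategory.tensorMap_comp x.fst y.fst z.fst x.snd y.snd z.snd)

/-- The reversed tensor product `V`-functor `(X, Y) ↦ Y ⊗ X`. -/
def revTensorFunctor : EnrichedFunctor V (TProd A A) A where
  obj x := x.snd ⊗ x.fst
  map x y := (β_ _ _).hom ≫ MonoidalVCategory.tensorMap x.snd y.snd x.fst y.fst
  map_id x := by
    have h := MonoidalVCategory.tensorMap_underlying (V := V) (𝟙 x.snd) (𝟙 x.fst)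
    rw [eHomEquiv_id, eHomEquiv_id, id_tensorHom_id, eHomEquiv_id] at h
    refine Eq.trans ?_ h
    refine (Category.assoc _ _ _).trans ?_
    rw [BraidedCategory.braiding_naturality_assoc, braiding_tensorUnit_left, Category.assoc,
      ← unitors_inv_equal, Iso.inv_hom_id_assoc]
  map_comp x y z := by
    refine (Category.assoc _ _ _).trans ?_
    rw [BraidedCategory.braiding_naturality_assoc, reassoc_of% tensorμ_braiding,
      MonoidalVCategory.tensorMap_comp, tensorHom_comp_tensorHom_assoc]

variable [ClosedVCategory V A]

/-- The right internal hom `Y^X`. -/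
abbrev rhom (X Y : A) : A := ClosedVCategory.rhom V X Y

/-- The left internal hom `^X Y`. -/
abbrev lhom (X Y : A) : A := ClosedVCategory.lhom V X Y

/-- The evaluation `e_r : X ⊗ Y^X ⟶ Y`. -/
abbrev rev (X Y : A) : X ⊗ rhom V X Y ⟶ Y := ClosedVCategory.rev X Y

/-- The evaluation `e_l : ^X Y ⊗ X ⟶ Y`. -/
abbrev lev (X Y : A) : lhom V X Y ⊗ X ⟶ Y := ClosedVCategory.lev X Y

instance (X Y B : A) :
    IsIso (tensL V X B (rhom V X Y) ≫ eHomWhiskerLeft V (X ⊗ B) (rev V X Y)) :=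
  ClosedVCategory.isIso_rev X Y B

instance (X Y B : A) :
    IsIso (tensR V B (lhom V X Y) X ≫ eHomWhiskerLeft V (B ⊗ X) (lev V X Y)) :=
  ClosedVCategory.isIso_lev X Y B

instance (X Y B : A) :
    IsIso (transp (tensorFunctor V) (rhom V) (fun X Y : A => rev V X Y) X Y B) :=
  ClosedVCategory.isIso_rev X Y B

instance (X Y B : A) :
    IsIso (transp (revTensorFunctor V) (lhom V) (fun X Y : A => lev V X Y) X Y B) := by
  have h : partL (revTensorFunctor V) X B (lhom V X Y) = tensR V B (lhom V X Y) X := by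
    simp only [partL, bimap, revTensorFunctor, tensR]
    rw [BraidedCategory.braiding_naturality_left_assoc]
    simp
  change IsIso (partL (revTensorFunctor V) X B (lhom V X Y) ≫
    eHomWhiskerLeft V (B ⊗ X) (lev V X Y))
  rw [h]
  exact ClosedVCategory.isIso_lev X Y B

/-- The right internal hom as a `V`-functor `Aᵒᵖ ⊗ A ⟶ A`, `(X, Y) ↦ Y^X`. -/
def rhomFunctor : EnrichedFunctor V (TProd Aᵒᵖ A) A :=
  homFunctor (tensorFunctor V) (rhom V) (fun X Y => rev V X Y)

/-- The left internal hom as a `V`-functor `Aᵒᵖ ⊗ A ⟶ A`, `(X, Y) ↦ ^X Y`. -/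
def lhomFunctor : EnrichedFunctor V (TProd Aᵒᵖ A) A :=
  homFunctor (revTensorFunctor V) (lhom V) (fun X Y => lev V X Y)

/-- The morphism `B ⟶ Y^X` corresponding to `X ⊗ B ⟶ Y`. -/
def rcurry {X B Y : A} (f : X ⊗ B ⟶ Y) : B ⟶ rhom V X Y :=
  (eHomEquiv V).symm (eHomEquiv V f ≫
    inv (tensL V X B (rhom V X Y) ≫ eHomWhiskerLeft V (X ⊗ B) (rev V X Y)))

/-- The morphism `B ⟶ ^X Y` corresponding to `B ⊗ X ⟶ Y`. -/
def lcurry {X B Y : A} (f : B ⊗ X ⟶ Y) : B ⟶ lhom V X Y :=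
  (eHomEquiv V).symm (eHomEquiv V f ≫
    inv (tensR V B (lhom V X Y) X ≫ eHomWhiskerLeft V (B ⊗ X) (lev V X Y)))

/-- The morphism `f^X : Y^X ⟶ Z^X`. -/
def rpost (X : A) {Y Z : A} (f : Y ⟶ Z) : rhom V X Y ⟶ rhom V X Z :=
  rcurry V (rev V X Y ≫ f)

/-- The coevaluation `d_r : Y ⟶ (X ⊗ Y)^X`. -/
def rcoev (X Y : A) : Y ⟶ rhom V X (X ⊗ Y) := rcurry V (𝟙 (X ⊗ Y))

/-- The coevaluation `d_l : Y ⟶ ^X (Y ⊗ X)`. -/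
def lcoev (X Y : A) : Y ⟶ lhom V X (Y ⊗ X) := lcurry V (𝟙 (Y ⊗ X))

/-- The canonical isomorphism `(Z^X)^Y ⟶ Z^(X ⊗ Y)`. -/
def rassoc (X Y Z : A) : rhom V Y (rhom V X Z) ⟶ rhom V (X ⊗ Y) Z :=
  rcurry V ((α_ X Y _).hom ≫ (X ◁ rev V Y (rhom V X Z)) ≫ rev V X Z)

/-- The canonical isomorphism `^(X ⊗ Y) Z ⟶ ^X (^Y Z)`. -/
def lassoc (X Y Z : A) : lhom V (X ⊗ Y) Z ⟶ lhom V X (lhom V Y Z) :=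
  lcurry V (lcurry V ((α_ _ X Y).hom ≫ lev V (X ⊗ Y) Z))

/-- The canonical isomorphism `(^Y Z)^X ⟶ ^Y (Z^X)`. -/
def lrswap (X Y Z : A) : rhom V X (lhom V Y Z) ⟶ lhom V Y (rhom V X Z) :=
  lcurry V (rcurry V ((α_ X _ Y).inv ≫ (rev V X (lhom V Y Z) ▷ Y) ≫ lev V Y Z))

/-- The canonical isomorphism `Y^I ⟶ Y`. -/
def runit (Y : A) : rhom V (𝟙_ A) Y ⟶ Y := (λ_ _).inv ≫ rev V (𝟙_ A) Y

/-- The canonical isomorphism `^I Y ⟶ Y`. -/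
def lunit (Y : A) : lhom V (𝟙_ A) Y ⟶ Y := (ρ_ _).inv ≫ lev V (𝟙_ A) Y

end ClosedMonoidal

section Modules

attribute [local instance] MonoidalClosed.enrichedOrdinaryCategorySelf

variable (V : Type u) [Category.{w} V] [MonoidalCategory V] [SymmetricCategory V]
  [MonoidalClosed V]

section Actions

variable {V}

/-- The morphism `F X ⟶ F Y` in `V` given by the value of a `V`-functor `F` on an underlying
morphism `X ⟶ Y`. -/
def mapHom {A : Type u₁} [Category.{u₂} A] [EnrichedOrdinaryCategory V A]
    (F : EnrichedFunctor V A V) {X Y : A} (f : X ⟶ Y) : F.obj X ⟶ F.obj Y :=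
  (eHomEquiv V).symm (eHomEquiv V f ≫ F.map X Y)

variable {A : Type u₁} [Category.{u₂} A] [EnrichedOrdinaryCategory V A]
  (T : EnrichedFunctor V (TProd Aᵒᵖ A) V)

/-- The action `A(X', X) ⟶ [T(X, Y), T(X', Y)]`. -/
def modL (X' X Y : A) :
    (X' ⟶[V] X) ⟶ EnrichedCategory.Hom (T.obj ⟨op X, Y⟩) (T.obj ⟨op X', Y⟩) :=
  (ρ_ _).inv ≫ (_ ◁ eId V Y) ≫ T.map ⟨op X, Y⟩ ⟨op X', Y⟩

/-- The action `A(Y, Y') ⟶ [T(X, Y), T(X, Y')]`. -/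
def modR (X Y Y' : A) :
    (Y ⟶[V] Y') ⟶ EnrichedCategory.Hom (T.obj ⟨op X, Y⟩) (T.obj ⟨op X, Y'⟩) :=
  (λ_ _).inv ≫ (eId V X ▷ _) ≫ T.map ⟨op X, Y⟩ ⟨op X, Y'⟩

/-- The morphism `T(f, g) : T(X, Y) ⟶ T(X', Y')` for underlying morphisms `f : X' ⟶ X` and
`g : Y ⟶ Y'`. -/
def modMap {X X' Y Y' : A} (f : X' ⟶ X) (g : Y ⟶ Y') :
    T.obj ⟨op X, Y⟩ ⟶ T.obj ⟨op X', Y'⟩ :=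
  (eHomEquiv V).symm
    ((λ_ (𝟙_ V)).inv ≫ (eHomEquiv V f ⊗ₘ eHomEquiv V g) ≫ T.map ⟨op X, Y⟩ ⟨op X', Y'⟩)

end Actions

section Tambara

variable (A : Type w) [Category.{u₂} A] [MonoidalCategory A] [EnrichedOrdinaryCategory V A]

/-- A `V`-functor `T : Aᵒᵖ ⊗ A ⟶ V` with families `α_l` and `α_r` of morphisms, subject to no
axioms. -/
structure TambaraData where
  functor : EnrichedFunctor V (TProd Aᵒᵖ A) V
  αl (B X Y : A) : functor.obj ⟨op X, Y⟩ ⟶ functor.obj ⟨op (B ⊗ X), B ⊗ Y⟩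
  αr (B X Y : A) : functor.obj ⟨op X, Y⟩ ⟶ functor.obj ⟨op (X ⊗ B), Y ⊗ B⟩

namespace TambaraData

variable {V A}

/-- Sources of the operations `α_l(B, X, Y)` and `α_r(B, X, Y)`. -/
def src : (A × A × A) ⊕ (A × A × A) → TProd Aᵒᵖ A
  | .inl p => ⟨op p.2.1, p.2.2⟩
  | .inr p => ⟨op p.2.1, p.2.2⟩

/-- Targets of the operations `α_l(B, X, Y)` and `α_r(B, X, Y)`. -/
def tgt : (A × A × A) ⊕ (A × A × A) → TProd Aᵒᵖ A
  | .inl p => ⟨op (p.1 ⊗ p.2.1), p.1 ⊗ p.2.2⟩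
  | .inr p => ⟨op (p.2.1 ⊗ p.1), p.2.2 ⊗ p.1⟩

/-- The families `α_l` and `α_r` as one family of operations. -/
def toOps (T : TambaraData V A) : OpFunctor V (src (A := A)) (tgt (A := A)) where
  functor := T.functor
  op
    | .inl p => T.αl p.1 p.2.1 p.2.2
    | .inr p => T.αr p.1 p.2.1 p.2.2

/-- The hom object from `T` to `T'` is the intersection of the equalizers of
`[Aᵒᵖ ⊗ A, V](T, T') ⇉ [T(X, Y), T'(B ⊗ X, B ⊗ Y)]` and
`[Aᵒᵖ ⊗ A, V](T, T') ⇉ [T(X, Y), T'(X ⊗ B, Y ⊗ B)]` over all `B`, `X`, `Y`. -/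
instance [HasLimits V] : EnrichedCategory V (TambaraData V A) where
  Hom S T := S.toOps ⟶[V] T.toOps
  id S := eId V S.toOps
  comp R S T := eComp V R.toOps S.toOps T.toOps

variable [MonoidalVCategory V A]

/-- The axioms of a (two-sided) Tambara module: `α_l` and `α_r` are `V`-natural in each variable,
satisfy the unit and associativity laws, and are compatible with each other. -/
structure IsTambara (T : TambaraData V A) : Prop where
  αl_natural_right (B X Y Y' : A) :
    modR T.functor X Y Y' ≫ eHomWhiskerLeft V _ (T.αl B X Y') =
      tensL V B Y Y' ≫ modR T.functor (B ⊗ X) (B ⊗ Y) (B ⊗ Y') ≫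
        eHomWhiskerRight V (T.αl B X Y) _
  αl_natural_left (B X' X Y : A) :
    modL T.functor X' X Y ≫ eHomWhiskerLeft V _ (T.αl B X' Y) =
      tensL V B X' X ≫ modL T.functor (B ⊗ X') (B ⊗ X) (B ⊗ Y) ≫
        eHomWhiskerRight V (T.αl B X Y) _
  αl_extranatural (B B' X Y : A) :
    tensR V B B' Y ≫ modR T.functor (B ⊗ X) (B ⊗ Y) (B' ⊗ Y) ≫
        eHomWhiskerRight V (T.αl B X Y) _ =
      tensR V B B' X ≫ modL T.functor (B ⊗ X) (B' ⊗ X) (B' ⊗ Y) ≫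
        eHomWhiskerRight V (T.αl B' X Y) _
  αl_unit (X Y : A) :
    T.αl (𝟙_ A) X Y ≫ modMap T.functor (λ_ X).inv (λ_ Y).hom = 𝟙 _
  αl_tensor (B B' X Y : A) :
    T.αl (B ⊗ B') X Y =
      T.αl B' X Y ≫ T.αl B (B' ⊗ X) (B' ⊗ Y) ≫
        modMap T.functor (α_ B B' X).hom (α_ B B' Y).inv
  αr_natural_right (B X Y Y' : A) :
    modR T.functor X Y Y' ≫ eHomWhiskerLeft V _ (T.αr B X Y') =
      tensR V Y Y' B ≫ modR T.functor (X ⊗ B) (Y ⊗ B) (Y' ⊗ B) ≫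
        eHomWhiskerRight V (T.αr B X Y) _
  αr_natural_left (B X' X Y : A) :
    modL T.functor X' X Y ≫ eHomWhiskerLeft V _ (T.αr B X' Y) =
      tensR V X' X B ≫ modL T.functor (X' ⊗ B) (X ⊗ B) (Y ⊗ B) ≫
        eHomWhiskerRight V (T.αr B X Y) _
  αr_extranatural (B B' X Y : A) :
    tensL V Y B B' ≫ modR T.functor (X ⊗ B) (Y ⊗ B) (Y ⊗ B') ≫
        eHomWhiskerRight V (T.αr B X Y) _ =
      tensL V X B B' ≫ modL T.functor (X ⊗ B) (X ⊗ B') (Y ⊗ B') ≫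
        eHomWhiskerRight V (T.αr B' X Y) _
  αr_unit (X Y : A) :
    T.αr (𝟙_ A) X Y ≫ modMap T.functor (ρ_ X).inv (ρ_ Y).hom = 𝟙 _
  αr_tensor (B B' X Y : A) :
    T.αr (B ⊗ B') X Y =
      T.αr B X Y ≫ T.αr B' (X ⊗ B) (Y ⊗ B) ≫
        modMap T.functor (α_ X B B').inv (α_ Y B B').hom
  bimodule (B B' X Y : A) :
    T.αl B X Y ≫ T.αr B' (B ⊗ X) (B ⊗ Y) =
      T.αr B' X Y ≫ T.αl B (X ⊗ B') (Y ⊗ B') ≫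
        modMap T.functor (α_ B X B').hom (α_ B Y B').inv

variable [ClosedVCategory V A]

/-- The morphism `β_l(B, X, Y) : T(X, Y^B) ⟶ T(B ⊗ X, Y)` corresponding to `α_l`. -/
def βl (T : TambaraData V A) (B X Y : A) :
    T.functor.obj ⟨op X, rhom V B Y⟩ ⟶ T.functor.obj ⟨op (B ⊗ X), Y⟩ :=
  T.αl B X (rhom V B Y) ≫ modMap T.functor (𝟙 (B ⊗ X)) (rev V B Y)

/-- The morphism `β_r(B, X, Y) : T(X, ^B Y) ⟶ T(X ⊗ B, Y)` corresponding to `α_r`. -/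
def βr (T : TambaraData V A) (B X Y : A) :
    T.functor.obj ⟨op X, lhom V B Y⟩ ⟶ T.functor.obj ⟨op (X ⊗ B), Y⟩ :=
  T.αr B X (lhom V B Y) ≫ modMap T.functor (𝟙 (X ⊗ B)) (lev V B Y)

/-- `T` is left strong if all `β_l` are invertible. -/
def LeftStrong (T : TambaraData V A) : Prop := ∀ B X Y, IsIso (T.βl B X Y)

/-- `T` is right strong if all `β_r` are invertible. -/
def RightStrong (T : TambaraData V A) : Prop := ∀ B X Y, IsIso (T.βr B X Y)

end TambaraData

variable [MonoidalVCategory V A] [ClosedVCategory V A]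

/-- The `V`-category `Tamb_ls(A)` of left strong Tambara modules. -/
abbrev TambLS := FullSub (fun T : TambaraData V A => T.IsTambara ∧ T.LeftStrong)

/-- The `V`-category `Tamb_s(A)` of strong Tambara modules. -/
abbrev TambS := FullSub (fun T : TambaraData V A =>
  T.IsTambara ∧ T.LeftStrong ∧ T.RightStrong)

/-- A `V`-functor `F : A ⟶ V` with a family of morphisms `θ_{X, Y} : F(^X Y) ⟶ F(Y^X)`, subject
to no axioms. -/
structure HalfBraidingData where
  functor : EnrichedFunctor V A V
  θ (X Y : A) : functor.obj (lhom V X Y) ⟶ functor.obj (rhom V X Y)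

namespace HalfBraidingData

variable {V A}

/-- The family `θ` as a family of operations. -/
def toOps (P : HalfBraidingData V A) :
    OpFunctor V (fun p : A × A => lhom V p.1 p.2) (fun p : A × A => rhom V p.1 p.2) where
  functor := P.functor
  op p := P.θ p.1 p.2

/-- The hom object from `(F, θ)` to `(G, φ)` is the intersection of the equalizers of
`[A, V](F, G) ⇉ [F(^X Y), G(Y^X)]` over all `X`, `Y`. -/
instance [HasLimits V] : EnrichedCategory V (HalfBraidingData V A) where
  Hom P Q := P.toOps ⟶[V] Q.toOps
  id P := eId V P.toOps
  comp P Q R := eComp V P.toOps Q.toOps R.toOps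

/-- The axioms of an object `(F, θ)` of the lax centre: `θ` is `V`-natural and compatible with
the tensor product and the unit of `A`. -/
structure IsLaxCentral (P : HalfBraidingData V A) : Prop where
  natural : IsVNatural V ((lhomFunctor V).comp V P.functor) ((rhomFunctor V).comp V P.functor)
    (fun x => eHomEquiv V (P.θ x.fst.unop x.snd))
  tensor (X Y Z : A) :
    P.θ (X ⊗ Y) Z =
      mapHom P.functor (lassoc V X Y Z) ≫ P.θ X (lhom V Y Z) ≫
        mapHom P.functor (lrswap V X Y Z) ≫ P.θ Y (rhom V X Z) ≫
          mapHom P.functor (rassoc V X Y Z)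
  unit (Y : A) : P.θ (𝟙_ A) Y ≫ mapHom P.functor (runit V Y) = mapHom P.functor (lunit V Y)

/-- `θ` is invertible. -/
def Invertible (P : HalfBraidingData V A) : Prop := ∀ X Y, IsIso (P.θ X Y)

end HalfBraidingData

/-- The lax centre `Z_l[A, V]`. As the representables are dense in `[A, V]`, with
`(F * A(X, -)) Y ≅ F(^X Y)` and `(A(X, -) * F) Y ≅ F(Y^X)` for Day convolution, a lax half
braiding on `F` is a family `θ_{X, Y} : F(^X Y) ⟶ F(Y^X)` as above. -/
abbrev LaxCentre := FullSub (fun P : HalfBraidingData V A => P.IsLaxCentral)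

/-- The centre `Z[A, V]`: the full sub-`V`-category of `Z_l[A, V]` on the `(F, θ)` with `θ`
invertible. -/
abbrev Centre := FullSub (fun P : HalfBraidingData V A => P.IsLaxCentral ∧ P.Invertible)

section Cayley

variable {V A}
variable [HasLimits V]

theorem isNatFamily_whisker {C D : Type w} [EnrichedCategory V C] [EnrichedCategory V D]
    (H : EnrichedFunctor V C D) {F G : EnrichedFunctor V D V} {W : V}
    {t : ∀ d, W ⟶ EnrichedCategory.Hom (F.obj d) (G.obj d)} (ht : IsNatFamily F G t) :
    IsNatFamily (H.comp V F) (H.comp V G) (fun c => t (H.obj c)) := by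
  intro c d
  have e := (H.map c d ⊗ₘ 𝟙 W) ≫= ht (H.obj c) (H.obj d)
  rw [tensorHom_comp_tensorHom_assoc, BraidedCategory.braiding_naturality_assoc,
    tensorHom_comp_tensorHom_assoc, Category.id_comp, Category.id_comp] at e
  exact e

theorem IsNatFamily.whisker_mapHom {F G : EnrichedFunctor V A V} {W : V}
    {t : ∀ X, W ⟶ EnrichedCategory.Hom (F.obj X) (G.obj X)} (ht : IsNatFamily F G t)
    {X Y : A} (f : X ⟶ Y) :
    t X ≫ eHomWhiskerLeft V _ (mapHom G f) = t Y ≫ eHomWhiskerRight V (mapHom F f) _ := by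
  have e := ((λ_ W).inv ≫ (eHomEquiv V f ⊗ₘ 𝟙 W)) ≫= ht X Y
  simp only [Category.assoc] at e
  rw [tensorHom_comp_tensorHom_assoc, BraidedCategory.braiding_naturality_assoc,
    tensorHom_comp_tensorHom_assoc, Category.id_comp, Category.id_comp,
    braiding_tensorUnit_left] at e
  have e1 : eHomEquiv V (mapHom F f) = eHomEquiv V f ≫ F.map X Y :=
    (eHomEquiv V).apply_symm_apply _
  have e2 : eHomEquiv V (mapHom G f) = eHomEquiv V f ≫ G.map X Y :=
    (eHomEquiv V).apply_symm_apply _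
  rw [eHomWhiskerLeft, eHomWhiskerRight, e1, e2, rightUnitor_inv_naturality_assoc,
    ← MonoidalCategory.tensorHom_def_assoc, leftUnitor_inv_naturality_assoc,
    ← MonoidalCategory.tensorHom_def'_assoc, e]
  simp

theorem square_comp {W x y z x' y' z' : V} {a : W ⟶ EnrichedCategory.Hom x x'}
    {b : W ⟶ EnrichedCategory.Hom y y'} {c : W ⟶ EnrichedCategory.Hom z z'}
    {f : x ⟶ y} {g : y ⟶ z} {f' : x' ⟶ y'} {g' : y' ⟶ z'}
    (h₁ : a ≫ eHomWhiskerLeft V x f' = b ≫ eHomWhiskerRight V f y')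
    (h₂ : b ≫ eHomWhiskerLeft V y g' = c ≫ eHomWhiskerRight V g z') :
    a ≫ eHomWhiskerLeft V x (f' ≫ g') = c ≫ eHomWhiskerRight V (f ≫ g) z' := by
  rw [eHomWhiskerLeft_comp, reassoc_of% h₁, ← eHom_whisker_exchange, reassoc_of% h₂,
    eHomWhiskerRight_comp]

/-- The `V`-functor `T_F`, `T_F(X, Y) = F(Y^X)`, with the families
`α_l(B, X, Y) : F(Y^X) ⟶ F(((B ⊗ Y)^B)^X) = F((B ⊗ Y)^(B ⊗ X))` and
`α_r(B, X, Y) : F(Y^X) ⟶ F((^B (Y ⊗ B))^X) = F(^B ((Y ⊗ B)^X)) ⟶ F(((Y ⊗ B)^X)^B) =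
F((Y ⊗ B)^(X ⊗ B))`. -/
def cayleyObj (P : HalfBraidingData V A) : TambaraData V A where
  functor := (rhomFunctor V).comp V P.functor
  αl B X Y := mapHom P.functor (rpost V X (rcoev V B Y) ≫ rassoc V B X (B ⊗ Y))
  αr B X Y := mapHom P.functor (rpost V X (lcoev V B Y) ≫ lrswap V X B (Y ⊗ B)) ≫
    P.θ B (rhom V X (Y ⊗ B)) ≫ mapHom P.functor (rassoc V X B (Y ⊗ B))

/-- The effect of the Cayley `V`-functor on homs: `pr_{X, Y} ∘ Υ = pr_{Y^X}`. -/
def cayleyHom (P Q : HalfBraidingData V A) :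
    OpFunctor.hom P.toOps Q.toOps ⟶ OpFunctor.hom (cayleyObj P).toOps (cayleyObj Q).toOps :=
  OpFunctor.homLift (P := (cayleyObj P).toOps) (Q := (cayleyObj Q).toOps)
    (fun x => OpFunctor.pr P.toOps Q.toOps (rhom V x.fst.unop x.snd))
    (isNatFamily_whisker (rhomFunctor V) (OpFunctor.isNatFamily_pr P.toOps Q.toOps))
    (by
      have hm : ∀ {X Y : A} (f : X ⟶ Y),
          OpFunctor.pr P.toOps Q.toOps X ≫ eHomWhiskerLeft V _ (mapHom Q.functor f) =
            OpFunctor.pr P.toOps Q.toOps Y ≫ eHomWhiskerRight V (mapHom P.functor f) _ :=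
        fun f => (OpFunctor.isNatFamily_pr P.toOps Q.toOps).whisker_mapHom f
      have hθ : ∀ X Y : A,
          OpFunctor.pr P.toOps Q.toOps (lhom V X Y) ≫ eHomWhiskerLeft V _ (Q.θ X Y) =
            OpFunctor.pr P.toOps Q.toOps (rhom V X Y) ≫ eHomWhiskerRight V (P.θ X Y) _ :=
        fun X Y => OpFunctor.pr_op P.toOps Q.toOps (X, Y)
      rintro (⟨B, X, Y⟩ | ⟨B, X, Y⟩)
      · exact hm _
      · exact square_comp (hm _) (square_comp (hθ _ _) (hm _)))

theorem cayleyHom_pr (P Q : HalfBraidingData V A) (x : TProd Aᵒᵖ A) :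
    cayleyHom P Q ≫ OpFunctor.pr (cayleyObj P).toOps (cayleyObj Q).toOps x =
      OpFunctor.pr P.toOps Q.toOps (rhom V x.fst.unop x.snd) :=
  OpFunctor.homLift_pr _ _ _ x

/-- The Cayley `V`-functor `(F, θ) ↦ T_F`. -/
def cayley : EnrichedFunctor V (HalfBraidingData V A) (TambaraData V A) where
  obj := cayleyObj
  map := cayleyHom
  map_id P := by
    change OpFunctor.homId P.toOps ≫ cayleyHom P P = OpFunctor.homId (cayleyObj P).toOps
    apply OpFunctor.hom_ext
    intro c
    rw [OpFunctor.homId_pr, Category.assoc, cayleyHom_pr]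
    exact OpFunctor.homId_pr P.toOps _
  map_comp P Q R := by
    change OpFunctor.homComp P.toOps Q.toOps R.toOps ≫ cayleyHom P R =
      (cayleyHom P Q ⊗ₘ cayleyHom Q R) ≫
        OpFunctor.homComp (cayleyObj P).toOps (cayleyObj Q).toOps (cayleyObj R).toOps
    apply OpFunctor.hom_ext
    intro c
    rw [Category.assoc, Category.assoc, OpFunctor.homComp_pr, tensorHom_comp_tensorHom_assoc,
      cayleyHom_pr, cayleyHom_pr, cayleyHom_pr]
    exact OpFunctor.homComp_pr P.toOps Q.toOps R.toOps _

end Cayley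

end Tambara

end Modules

end Tambara

end

-- The quasi-inverse of the Cayley `V`-functor evaluates at the unit: it sends a left strong Tambara
-- module `T` to `T(I, -)`. The two actions give comparison morphisms `T(I, Y^X) ⟶ T(X, Y)`
-- (`fromRhom`, built from `α_l` and `e_r`) and `T(I, ^X Y) ⟶ T(X, Y)` (`fromLhom`, built from `α_r`
-- and `e_l`). Up to unit constraints these are `β_l(X, I, Y)` and `β_r(X, I, Y)`. Left strength
-- makes the first invertible, and `θ` is the second followed by the inverse of the first; right
-- strength makes `θ` invertible too.
--
-- The axioms of a lax half-braiding for this `θ` mirror those of a Tambara module. `V`-naturality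
-- of `θ` comes from (extra)naturality of the actions. Its tensor law comes from the tensor laws of
-- `α_l` and `α_r` and the bimodule axiom (`rassoc_fromRhom`, `lassoc_fromLhom`, `lrswap_fromLhom`),
-- and its unit law from their unit laws.
--
-- Conversely, on `T_F(X, Y) = F(Y^X)` the left action is the image under `F` of a morphism `ract`
-- of `A`, whose transpose is `B ⊗ e_r`. The right action is the image of a morphism `lact`, whose
-- double transpose is `e_r ⊗ B`, followed by `θ` and the image of the canonical isomorphism
-- `rassoc`. The Tambara axioms thus reduce to the axioms of `θ` and to identities in `A`, which are
-- checked by transposing to evaluations. The triangle identities turn `β_l` of `T_F` into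
-- `F(rassoc)`, always invertible, and `β_r` into `θ` composed with images of isomorphisms.
--
-- Essential surjectivity: the `fromRhom` are invertible, `V`-natural and compatible with both
-- actions (`isMorphism_fromRhom`), so they form an isomorphism from the Cayley image of `(T(I, -),
-- θ)` to `T`.
--
-- Full faithfulness in the enriched sense: a transformation `T_F ⟶ T_G` restricts along `F(Z^I) ≅ F
-- Z` to a transformation `F ⟶ G`. Compatibility with `α_l` determines the component at `(X, Y)`
-- from the one at `(I, Y^X)` (`cayleyRes_rhom`). Compatibility with `α_r` at `X = I` amounts to
-- compatibility with `θ` (`cayleyRes_θ`). All of this is done on hom objects of `V`, so `cayleyHom`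
-- is an isomorphism in `V`, and a fully faithful, essentially surjective `V`-functor with chosen
-- preimages is an equivalence.

universe v₁ v₂ v₃

noncomputable section

set_option linter.unusedSectionVars false

namespace Tambara

/-! ### `V`-functors on underlying morphisms, and whiskering. -/

section UnderlyingMaps

variable {V : Type u} [Category.{w} V] [MonoidalCategory V]

section

variable {C : Type u₁} [Category.{v₁} C] [EnrichedOrdinaryCategory V C]

theorem eHomEquiv_eHomWhiskerLeft {X Y Z : C} (f : X ⟶ Y) (g : Y ⟶ Z) :
    eHomEquiv V f ≫ eHomWhiskerLeft V X g = eHomEquiv V (f ≫ g) := by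
  rw [← eId_eHomWhiskerLeft, ← eId_eHomWhiskerLeft, eHomWhiskerLeft_comp, Category.assoc]

theorem eHomEquiv_eHomWhiskerRight {X Y Z : C} (f : X ⟶ Y) (g : Y ⟶ Z) :
    eHomEquiv V g ≫ eHomWhiskerRight V f Z = eHomEquiv V (f ≫ g) := by
  rw [← eId_eHomWhiskerRight, ← eId_eHomWhiskerRight, eHomWhiskerRight_comp, Category.assoc]

/-- Whiskering by `g` is composition with the name of `g`. This lemma and the next trade composites
with names for whiskerings, the form in which all naturality squares below are handled. -/
theorem elt_eHomEquiv {X Y Z : C} {W : V} (f : W ⟶ (X ⟶[V] Y)) (g : Y ⟶ Z) :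
    (f ⊗ₘ eHomEquiv V g) ≫ eComp V X Y Z = (ρ_ W).hom ≫ f ≫ eHomWhiskerLeft V X g := by
  rw [eHomWhiskerLeft, rightUnitor_inv_naturality_assoc, Iso.hom_inv_id_assoc,
    MonoidalCategory.tensorHom_def_assoc]

theorem eHomEquiv_elt {X Y Z : C} {W : V} (f : X ⟶ Y) (g : W ⟶ (Y ⟶[V] Z)) :
    (eHomEquiv V f ⊗ₘ g) ≫ eComp V X Y Z = (λ_ W).hom ≫ g ≫ eHomWhiskerRight V f Z := by
  rw [eHomWhiskerRight, leftUnitor_inv_naturality_assoc, Iso.hom_inv_id_assoc,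
    MonoidalCategory.tensorHom_def'_assoc]

end

variable {C : Type u₁} [Category.{v₁} C] [EnrichedOrdinaryCategory V C]
variable {D : Type u₂} [Category.{v₂} D] [EnrichedOrdinaryCategory V D]
variable (F : EnrichedFunctor V C D)

/-- The value of a `V`-functor on an underlying morphism. -/
def onHom {X Y : C} (f : X ⟶ Y) : F.obj X ⟶ F.obj Y :=
  (eHomEquiv V).symm (eHomEquiv V f ≫ F.map X Y)

theorem eHomEquiv_onHom {X Y : C} (f : X ⟶ Y) :
    eHomEquiv V (onHom F f) = eHomEquiv V f ≫ F.map X Y :=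
  (eHomEquiv V).apply_symm_apply _

theorem onHom_eq_iff {X Y : C} (f : X ⟶ Y) (g : F.obj X ⟶ F.obj Y) :
    onHom F f = g ↔ eHomEquiv V f ≫ F.map X Y = eHomEquiv V g := by
  rw [← eHomEquiv_onHom, EmbeddingLike.apply_eq_iff_eq]

/-- This is preservation of composition by `F` with the second factor specialised to the name of
`g`. -/
theorem eHomWhiskerLeft_map (X : C) {Y Z : C} (g : Y ⟶ Z) :
    eHomWhiskerLeft V X g ≫ F.map X Z = F.map X Y ≫ eHomWhiskerLeft V _ (onHom F g) := by
  have h : (F.map X Y ⊗ₘ (eHomEquiv V g ≫ F.map Y Z)) =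
      (𝟙 _ ⊗ₘ eHomEquiv V g) ≫ (F.map X Y ⊗ₘ F.map Y Z) := by
    rw [tensorHom_comp_tensorHom, Category.id_comp]
  rw [← cancel_epi (ρ_ _).hom, ← elt_eHomEquiv, eHomEquiv_onHom, h, Category.assoc,
    ← F.map_comp, ← Category.assoc, ← Category.assoc, elt_eHomEquiv, Category.id_comp]

theorem eHomWhiskerRight_map {X Y : C} (f : X ⟶ Y) (Z : C) :
    eHomWhiskerRight V f Z ≫ F.map X Z = F.map Y Z ≫ eHomWhiskerRight V (onHom F f) _ := by
  have h : ((eHomEquiv V f ≫ F.map X Y) ⊗ₘ F.map Y Z) =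
      (eHomEquiv V f ⊗ₘ 𝟙 _) ≫ (F.map X Y ⊗ₘ F.map Y Z) := by
    rw [tensorHom_comp_tensorHom, Category.id_comp]
  rw [← cancel_epi (λ_ _).hom, ← eHomEquiv_elt, eHomEquiv_onHom, h, Category.assoc,
    ← F.map_comp, ← Category.assoc, ← Category.assoc, eHomEquiv_elt, Category.id_comp]

@[simp]
theorem onHom_id (X : C) : onHom F (𝟙 X) = 𝟙 (F.obj X) := by
  rw [onHom_eq_iff, eHomEquiv_id, F.map_id, eHomEquiv_id]

theorem onHom_comp {X Y Z : C} (f : X ⟶ Y) (g : Y ⟶ Z) :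
    onHom F (f ≫ g) = onHom F f ≫ onHom F g := by
  rw [onHom_eq_iff, ← eHomEquiv_eHomWhiskerLeft, Category.assoc, eHomWhiskerLeft_map,
    ← Category.assoc, ← eHomEquiv_onHom, eHomEquiv_eHomWhiskerLeft]

instance onHom_isIso {X Y : C} (f : X ⟶ Y) [IsIso f] : IsIso (onHom F f) :=
  ⟨onHom F (inv f), by rw [← onHom_comp, IsIso.hom_inv_id, onHom_id],
    by rw [← onHom_comp, IsIso.inv_hom_id, onHom_id]⟩

/-- When the components are names of ordinary morphisms, both legs of the naturality square are
whiskerings up to unitors, and the unitors cancel. -/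
theorem isVNatural_iff {C : Type u₁} [EnrichedCategory V C] (F G : EnrichedFunctor V C D)
    (t : ∀ c, F.obj c ⟶ G.obj c) :
    IsVNatural V F G (fun c => eHomEquiv V (t c)) ↔
      ∀ c d, F.map c d ≫ eHomWhiskerLeft V _ (t d) = G.map c d ≫ eHomWhiskerRight V (t c) _ := by
  simp only [IsVNatural, elt_eHomEquiv, eHomEquiv_elt, Iso.inv_hom_id_assoc]

end UnderlyingMaps

/-! ### Fully faithful `V`-functors with chosen preimages are equivalences. -/

section Equivalence

variable {V : Type u} [Category.{w} V] [MonoidalCategory V]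
variable {C : Type u₁} [Category.{v₁} C] [EnrichedOrdinaryCategory V C]
variable {D : Type u₂} [Category.{v₂} D] [EnrichedOrdinaryCategory V D]

/-- The whiskerings by `g.inv` and `g.hom` meet at the middle object and cancel. This is what makes
conjugation by the isomorphisms `F (G d) ≅ d` functorial. -/
theorem eComp_conj {X Y Z X' Y' Z' : D} (f : X' ⟶ X) (g : Y' ≅ Y) (h : Z ⟶ Z') :
    ((eHomWhiskerRight V f Y ≫ eHomWhiskerLeft V X' g.inv) ⊗ₘ
        (eHomWhiskerRight V g.hom Z ≫ eHomWhiskerLeft V Y' h)) ≫ eComp V X' Y' Z' =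
      eComp V X Y Z ≫ eHomWhiskerRight V f Z ≫ eHomWhiskerLeft V X' h := by
  rw [eComp_eHomWhiskerRight_assoc, eComp_eHomWhiskerLeft, ← eHom_whisker_cancel V g.symm,
    MonoidalCategory.tensorHom_def, comp_whiskerRight, Category.assoc, Category.assoc,
    ← eHom_whisker_exchange, MonoidalCategory.whiskerLeft_comp, Category.assoc, Iso.symm_hom,
    Iso.symm_inv, whisker_exchange_assoc]

/-- The action on homs of a quasi-inverse of a fully faithful `V`-functor. -/
def quasiInverseMap (F : EnrichedFunctor V C D) (hF : ∀ x y, IsIso (F.map x y)) {G : D → C}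
    (e : ∀ d, F.obj (G d) ≅ d) (x y : D) : (x ⟶[V] y) ⟶ (G x ⟶[V] G y) :=
  (eHomWhiskerRight V (e x).hom y ≫ eHomWhiskerLeft V _ (e y).inv) ≫
    @inv _ _ _ _ (F.map (G x) (G y)) (hF _ _)

theorem quasiInverseMap_map (F : EnrichedFunctor V C D) (hF : ∀ x y, IsIso (F.map x y)) {G : D → C}
    (e : ∀ d, F.obj (G d) ≅ d) (x y : D) :
    quasiInverseMap F hF e x y ≫ F.map (G x) (G y) =
      eHomWhiskerRight V (e x).hom y ≫ eHomWhiskerLeft V _ (e y).inv := by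
  have := hF
  simp [quasiInverseMap]

/-- A quasi-inverse of a fully faithful `V`-functor `F`, given by a choice of preimages up to
isomorphism. -/
def quasiInverse (F : EnrichedFunctor V C D) (hF : ∀ x y, IsIso (F.map x y)) (G : D → C)
    (e : ∀ d, F.obj (G d) ≅ d) : EnrichedFunctor V D C where
  obj := G
  map x y := quasiInverseMap F hF e x y
  map_id x := by
    have := hF (G x) (G x)
    rw [← cancel_mono (F.map (G x) (G x)), Category.assoc, quasiInverseMap_map,
      F.map_id, ← Category.assoc, eId_eHomWhiskerRight,
      eHomEquiv_eHomWhiskerLeft, Iso.hom_inv_id, eHomEquiv_id]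
  map_comp x y z := by
    have := hF (G x) (G z)
    rw [← cancel_mono (F.map (G x) (G z)), Category.assoc, quasiInverseMap_map,
      Category.assoc, F.map_comp, tensorHom_comp_tensorHom_assoc,
      quasiInverseMap_map, quasiInverseMap_map, eComp_conj]

theorem exists_onHom_eq (F : EnrichedFunctor V C D) (hF : ∀ x y, IsIso (F.map x y)) {x y : C}
    (f : F.obj x ≅ F.obj y) : ∃ g : x ⟶ y, onHom F g = f.hom ∧ IsIso g := by
  have := hF
  -- Invertibility of `F.map` on hom objects gives a bijection on names, so every morphism between
  -- images has a unique lift; the lifts of `f.hom` and `f.inv` are inverse by uniqueness.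
  let s : ∀ {x y : C}, (F.obj x ⟶ F.obj y) → (x ⟶ y) := fun f =>
    (eHomEquiv V).symm (eHomEquiv V f ≫ inv (F.map _ _))
  have hs : ∀ {x y : C} (f : F.obj x ⟶ F.obj y), onHom F (s f) = f := by
    intro x y f
    rw [onHom_eq_iff, Equiv.apply_symm_apply, Category.assoc, IsIso.inv_hom_id, Category.comp_id]
  have inj : ∀ {x y : C} {f g : x ⟶ y}, onHom F f = onHom F g → f = g := by
    intro x y f g h
    rw [onHom_eq_iff, eHomEquiv_onHom, cancel_mono] at h
    exact (eHomEquiv V).injective h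
  exact ⟨s f.hom, hs _, s f.inv, inj (by rw [onHom_comp, hs, hs, f.hom_inv_id, onHom_id]),
    inj (by rw [onHom_comp, hs, hs, f.inv_hom_id, onHom_id])⟩

theorem quasiInverse_comp (F : EnrichedFunctor V C D) (hF : ∀ x y, IsIso (F.map x y)) (G : D → C)
    (e : ∀ d, F.obj (G d) ≅ d) :
    ∃ t : ∀ d, F.obj (G d) ⟶ d, IsVNatural V ((quasiInverse F hF G e).comp V F)
      (EnrichedFunctor.id V D) (fun d => eHomEquiv V (t d)) ∧ ∀ d, IsIso (t d) := by
  have h : ∀ x y, (quasiInverseMap F hF e x y ≫ F.map (G x) (G y)) ≫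
      eHomWhiskerLeft V (F.obj (G x)) (e y).hom = 𝟙 _ ≫ eHomWhiskerRight V (e x).hom y := by
    intro x y
    rw [quasiInverseMap_map, Category.assoc, ← eHomWhiskerLeft_comp, Iso.inv_hom_id,
      eHomWhiskerLeft_id, Category.comp_id, Category.id_comp]
  exact ⟨fun d => (e d).hom, (isVNatural_iff ((quasiInverse F hF G e).comp V F)
    (EnrichedFunctor.id V D) (fun d => (e d).hom)).2 h, fun d => inferInstance⟩

/-- The component at `c` is the lift through `F` of the chosen isomorphism `F (G (F c)) ≅ F c`.
Naturality may be tested after applying `F`, because `F.map` is monic. -/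
theorem comp_quasiInverse (F : EnrichedFunctor V C D) (hF : ∀ x y, IsIso (F.map x y)) (G : D → C)
    (e : ∀ d, F.obj (G d) ≅ d) :
    ∃ t : ∀ c, G (F.obj c) ⟶ c, IsVNatural V (F.comp V (quasiInverse F hF G e))
      (EnrichedFunctor.id V C) (fun c => eHomEquiv V (t c)) ∧ ∀ c, IsIso (t c) := by
  choose t ht ht' using fun c : C => exists_onHom_eq F hF (e (F.obj c))
  have h : ∀ x y, (F.map x y ≫ quasiInverseMap F hF e (F.obj x) (F.obj y)) ≫
      eHomWhiskerLeft V (G (F.obj x)) (t y) = 𝟙 _ ≫ eHomWhiskerRight V (t x) y := by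
    intro x y
    have := hF (G (F.obj x)) y
    rw [← cancel_mono (F.map (G (F.obj x)) y), Category.assoc, Category.assoc,
      eHomWhiskerLeft_map, reassoc_of% quasiInverseMap_map, ht, Category.id_comp,
      eHomWhiskerRight_map, ht, ← eHomWhiskerLeft_comp, Iso.inv_hom_id, eHomWhiskerLeft_id,
      Category.comp_id]
  exact ⟨t, (isVNatural_iff (F.comp V (quasiInverse F hF G e)) (EnrichedFunctor.id V C) t).2 h,
    ht'⟩

end Equivalence

/-- A bare `V`-category is first given its underlying category `ForgetEnrichment`, where the
isomorphisms `e` live and the preceding lemmas apply. `G` is only a function on objects: its action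
on homs is forced. -/
theorem isVEquivalence_of_isIso_map {V : Type u} [Category.{w} V] [MonoidalCategory V]
    {C : Type u₁} [EnrichedCategory V C] {D : Type u₂} [EnrichedCategory V D]
    (F : EnrichedFunctor V C D) (hF : ∀ x y, IsIso (F.map x y)) (G : D → C)
    (e : ∀ d, ForgetEnrichment.of V (F.obj (G d)) ≅ ForgetEnrichment.of V d) :
    IsVEquivalence V F :=
  ⟨quasiInverse (C := ForgetEnrichment V C) (D := ForgetEnrichment V D) F hF G e,
    comp_quasiInverse (C := ForgetEnrichment V C) (D := ForgetEnrichment V D) F hF G e,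
    quasiInverse_comp (C := ForgetEnrichment V C) (D := ForgetEnrichment V D) F hF G e⟩

end Tambara

namespace Tambara

/-! ### `V`-functors of two variables and naturality in each variable. -/

section Bifunctor

variable {V : Type u} [Category.{w} V] [MonoidalCategory V] [BraidedCategory V]
variable {C : Type u₁} [EnrichedCategory V C] {D : Type u₂} [EnrichedCategory V D]
  {E : Type u₃} [EnrichedCategory V E]
variable (M : EnrichedFunctor V (TProd C D) E)

/-- The action on homs of a `V`-functor of two variables. -/
def homMap₂ (X X' : C) (B B' : D) :
    (X ⟶[V] X') ⊗ (B ⟶[V] B') ⟶ (M.obj ⟨X, B⟩ ⟶[V] M.obj ⟨X', B'⟩) :=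
  M.map ⟨X, B⟩ ⟨X', B'⟩

theorem homMap₂_id (X : C) (B : D) :
    (λ_ (𝟙_ V)).inv ≫ (eId V X ⊗ₘ eId V B) ≫ homMap₂ M X X B B = eId V (M.obj ⟨X, B⟩) :=
  (Category.assoc _ _ _).symm.trans (M.map_id ⟨X, B⟩)

theorem homMap₂_comp (X X' X'' : C) (B B' B'' : D) :
    (homMap₂ M X X' B B' ⊗ₘ homMap₂ M X' X'' B' B'') ≫ eComp V _ _ _ =
      tensorμ _ _ _ _ ≫ (eComp V X X' X'' ⊗ₘ eComp V B B' B'') ≫ homMap₂ M X X'' B B'' :=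
  (M.map_comp ⟨X, B⟩ ⟨X', B'⟩ ⟨X'', B''⟩).symm.trans (Category.assoc _ _ _)

theorem homMap₂_elt {X X' X'' : C} {B B' B'' : D} {P Q P' Q' : V} (f : P ⟶ (X ⟶[V] X'))
    (g : Q ⟶ (B ⟶[V] B')) (f' : P' ⟶ (X' ⟶[V] X'')) (g' : Q' ⟶ (B' ⟶[V] B'')) :
    (((f ⊗ₘ g) ≫ homMap₂ M X X' B B') ⊗ₘ ((f' ⊗ₘ g') ≫ homMap₂ M X' X'' B' B'')) ≫
        eComp V _ _ _ =
      tensorμ _ _ _ _ ≫ (((f ⊗ₘ f') ≫ eComp V X X' X'') ⊗ₘ ((g ⊗ₘ g') ≫ eComp V B B' B'')) ≫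
        homMap₂ M X X'' B B'' := by
  rw [← tensorHom_comp_tensorHom_assoc, homMap₂_comp, tensorμ_natural_assoc,
    tensorHom_comp_tensorHom_assoc]

/-- The action on homs of `M(X, -)`. -/
def mapSnd (X : C) (B B' : D) : (B ⟶[V] B') ⟶ (M.obj ⟨X, B⟩ ⟶[V] M.obj ⟨X, B'⟩) :=
  (λ_ _).inv ≫ (eId V X ▷ _) ≫ homMap₂ M X X B B'

/-- The action on homs of `M(-, B)`. -/
def mapFst (X X' : C) (B : D) : (X ⟶[V] X') ⟶ (M.obj ⟨X, B⟩ ⟶[V] M.obj ⟨X', B⟩) :=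
  (ρ_ _).inv ≫ (_ ◁ eId V B) ≫ homMap₂ M X X' B B

theorem mapSnd_eq (X : C) (B B' : D) :
    mapSnd M X B B' = (λ_ _).inv ≫ (eId V X ⊗ₘ 𝟙 (B ⟶[V] B')) ≫ homMap₂ M X X B B' := by
  rw [tensorHom_id, mapSnd]

theorem mapFst_eq (X X' : C) (B : D) :
    mapFst M X X' B = (ρ_ _).inv ≫ (𝟙 (X ⟶[V] X') ⊗ₘ eId V B) ≫ homMap₂ M X X' B B := by
  rw [id_tensorHom, mapFst]

theorem mapSnd_id (X : C) (B : D) : eId V B ≫ mapSnd M X B B = eId V (M.obj ⟨X, B⟩) := by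
  rw [mapSnd, leftUnitor_inv_naturality_assoc, ← MonoidalCategory.tensorHom_def'_assoc,
    homMap₂_id]

theorem mapFst_id (X : C) (B : D) : eId V X ≫ mapFst M X X B = eId V (M.obj ⟨X, B⟩) := by
  rw [mapFst, rightUnitor_inv_naturality_assoc, ← MonoidalCategory.tensorHom_def_assoc,
    ← unitors_inv_equal, homMap₂_id]

theorem mapSnd_comp (X : C) (B B' B'' : D) :
    (mapSnd M X B B' ⊗ₘ mapSnd M X B' B'') ≫ eComp V _ _ _ =
      eComp V B B' B'' ≫ mapSnd M X B B'' := by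
  rw [mapSnd_eq, mapSnd_eq, mapSnd_eq, ← tensorHom_comp_tensorHom_assoc, homMap₂_elt,
    reassoc_of% coherence_ll, eId_comp', leftUnitor_inv_naturality_assoc,
    ← tensorHom_id (λ_ (𝟙_ V)).inv, tensorHom_comp_tensorHom_assoc, Iso.inv_hom_id_assoc,
    Category.id_comp, id_tensorHom_id, Category.id_comp, ← id_tensorHom,
    tensorHom_comp_tensorHom_assoc, Category.id_comp, Category.comp_id]

theorem mapFst_comp (X X' X'' : C) (B : D) :
    (mapFst M X X' B ⊗ₘ mapFst M X' X'' B) ≫ eComp V _ _ _ =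
      eComp V X X' X'' ≫ mapFst M X X'' B := by
  rw [mapFst_eq, mapFst_eq, mapFst_eq, ← tensorHom_comp_tensorHom_assoc, homMap₂_elt,
    reassoc_of% coherence_rr, eId_comp', rightUnitor_inv_naturality_assoc,
    ← id_tensorHom _ (λ_ (𝟙_ V)).inv, tensorHom_comp_tensorHom_assoc, Iso.inv_hom_id_assoc,
    Category.id_comp, id_tensorHom_id, Category.id_comp, ← tensorHom_id,
    tensorHom_comp_tensorHom_assoc, Category.id_comp, Category.comp_id]

/-- Moving in the second variable first puts the two hom objects in the wrong order, whence the
braiding; `mapFst_mapSnd` is the order without it. Together they recover the joint action from the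
partial ones. -/
theorem mapSnd_mapFst (X X' : C) (B B' : D) :
    (mapSnd M X B B' ⊗ₘ mapFst M X X' B') ≫ eComp V _ _ _ =
      (β_ _ _).hom ≫ homMap₂ M X X' B B' := by
  rw [mapSnd_eq, mapFst_eq, ← tensorHom_comp_tensorHom_assoc, homMap₂_elt, eId_comp', comp_eId',
    reassoc_of% coherence_lr, tensorHom_comp_tensorHom_assoc]
  simp

theorem mapFst_mapSnd (X X' : C) (B B' : D) :
    (mapFst M X X' B ⊗ₘ mapSnd M X' B B') ≫ eComp V _ _ _ = homMap₂ M X X' B B' := by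
  rw [mapSnd_eq, mapFst_eq, ← tensorHom_comp_tensorHom_assoc, homMap₂_elt, eId_comp', comp_eId',
    reassoc_of% coherence_rl, tensorHom_comp_tensorHom_assoc]
  simp

/-- The `V`-functor `M(X, -)`. -/
def fixFst (X : C) : EnrichedFunctor V D E where
  obj B := M.obj ⟨X, B⟩
  map B B' := mapSnd M X B B'
  map_id B := mapSnd_id M X B
  map_comp B B' B'' := (mapSnd_comp M X B B' B'').symm

/-- The `V`-functor `M(-, B)`. -/
def fixSnd (B : D) : EnrichedFunctor V C E where
  obj X := M.obj ⟨X, B⟩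
  map X X' := mapFst M X X' B
  map_id X := mapFst_id M X B
  map_comp X X' X'' := (mapFst_comp M X X' X'' B).symm

end Bifunctor

section OrdinaryBifunctor

variable {V : Type u} [Category.{w} V] [MonoidalCategory V] [BraidedCategory V]
variable {C : Type u₁} [Category.{v₁} C] [EnrichedOrdinaryCategory V C]
  {D : Type u₂} [Category.{v₂} D] [EnrichedOrdinaryCategory V D]
  {E : Type u₃} [Category.{v₃} E] [EnrichedOrdinaryCategory V E]
variable (M : EnrichedFunctor V (TProd C D) E)

/-- The morphism `M(f, B)`. -/
def onFst {X X' : C} (f : X ⟶ X') (B : D) : M.obj ⟨X, B⟩ ⟶ M.obj ⟨X', B⟩ :=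
  onHom (fixSnd M B) f

/-- The morphism `M(X, g)`. -/
def onSnd (X : C) {B B' : D} (g : B ⟶ B') : M.obj ⟨X, B⟩ ⟶ M.obj ⟨X, B'⟩ :=
  onHom (fixFst M X) g

/-- The morphism `M(f, g)`. -/
def onPair {X X' : C} {B B' : D} (f : X ⟶ X') (g : B ⟶ B') : M.obj ⟨X, B⟩ ⟶ M.obj ⟨X', B'⟩ :=
  (eHomEquiv V).symm
    ((λ_ (𝟙_ V)).inv ≫ (eHomEquiv V f ⊗ₘ eHomEquiv V g) ≫ homMap₂ M X X' B B')

theorem eHomEquiv_onFst {X X' : C} (f : X ⟶ X') (B : D) :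
    eHomEquiv V (onFst M f B) = eHomEquiv V f ≫ mapFst M X X' B :=
  eHomEquiv_onHom (fixSnd M B) f

theorem eHomEquiv_onSnd (X : C) {B B' : D} (g : B ⟶ B') :
    eHomEquiv V (onSnd M X g) = eHomEquiv V g ≫ mapSnd M X B B' :=
  eHomEquiv_onHom (fixFst M X) g

@[simp]
theorem onFst_id (X : C) (B : D) : onFst M (𝟙 X) B = 𝟙 _ := onHom_id (fixSnd M B) X

@[simp]
theorem onSnd_id (X : C) (B : D) : onSnd M X (𝟙 B) = 𝟙 _ := onHom_id (fixFst M X) B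

theorem onFst_comp {X X' X'' : C} (f : X ⟶ X') (f' : X' ⟶ X'') (B : D) :
    onFst M (f ≫ f') B = onFst M f B ≫ onFst M f' B := onHom_comp (fixSnd M B) f f'

theorem onSnd_comp (X : C) {B B' B'' : D} (g : B ⟶ B') (g' : B' ⟶ B'') :
    onSnd M X (g ≫ g') = onSnd M X g ≫ onSnd M X g' := onHom_comp (fixFst M X) g g'

theorem eHomWhiskerLeft_mapFst (X : C) {Y Z : C} (g : Y ⟶ Z) (B : D) :
    eHomWhiskerLeft V X g ≫ mapFst M X Z B = mapFst M X Y B ≫ eHomWhiskerLeft V _ (onFst M g B) :=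
  eHomWhiskerLeft_map (fixSnd M B) X g

theorem eHomWhiskerRight_mapFst {X Y : C} (f : X ⟶ Y) (Z : C) (B : D) :
    eHomWhiskerRight V f Z ≫ mapFst M X Z B = mapFst M Y Z B ≫ eHomWhiskerRight V (onFst M f B) _ :=
  eHomWhiskerRight_map (fixSnd M B) f Z

theorem eHomWhiskerLeft_mapSnd (X : C) (B : D) {Y Z : D} (g : Y ⟶ Z) :
    eHomWhiskerLeft V B g ≫ mapSnd M X B Z = mapSnd M X B Y ≫ eHomWhiskerLeft V _ (onSnd M X g) :=
  eHomWhiskerLeft_map (fixFst M X) B g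

theorem eHomWhiskerRight_mapSnd (X : C) {B Y : D} (f : B ⟶ Y) (Z : D) :
    eHomWhiskerRight V f Z ≫ mapSnd M X B Z = mapSnd M X Y Z ≫ eHomWhiskerRight V (onSnd M X f) _ :=
  eHomWhiskerRight_map (fixFst M X) f Z

theorem onPair_eq {X X' : C} {B B' : D} (f : X ⟶ X') (g : B ⟶ B') :
    onPair M f g = onFst M f B ≫ onSnd M X' g := by
  rw [onPair, Equiv.symm_apply_eq, eHomEquiv_comp, eHomEquiv_onFst, eHomEquiv_onSnd,
    ← tensorHom_comp_tensorHom_assoc, mapFst_mapSnd]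

theorem onPair_eq' {X X' : C} {B B' : D} (f : X ⟶ X') (g : B ⟶ B') :
    onPair M f g = onSnd M X g ≫ onFst M f B' := by
  rw [onPair, Equiv.symm_apply_eq, eHomEquiv_comp, eHomEquiv_onFst, eHomEquiv_onSnd,
    ← tensorHom_comp_tensorHom_assoc, mapSnd_mapFst, BraidedCategory.braiding_naturality_assoc,
    braiding_tensorUnit_left, Category.assoc, ← unitors_inv_equal, Iso.inv_hom_id_assoc]

theorem onSnd_onFst {X X' : C} {B B' : D} (f : X ⟶ X') (g : B ⟶ B') :
    onSnd M X g ≫ onFst M f B' = onFst M f B ≫ onSnd M X' g := by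
  rw [← onPair_eq, onPair_eq']

/-- Both sides are the joint action of `M` on `f` and on the hom object from `B` to `B'`, decomposed
in the two possible orders. So `M(f, -)` is a `V`-natural transformation; `mapFst_onSnd` is the
mirror image. -/
theorem mapSnd_onFst {X X' : C} (f : X ⟶ X') (B B' : D) :
    mapSnd M X B B' ≫ eHomWhiskerLeft V _ (onFst M f B') =
      mapSnd M X' B B' ≫ eHomWhiskerRight V (onFst M f B) _ := by
  rw [← cancel_epi (ρ_ _).hom, ← elt_eHomEquiv, eHomEquiv_onFst,
    ← Category.id_comp (mapSnd M X B B'), ← tensorHom_comp_tensorHom_assoc, mapSnd_mapFst,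
    BraidedCategory.braiding_naturality_assoc, ← mapFst_mapSnd, tensorHom_comp_tensorHom_assoc,
    ← eHomEquiv_onFst, eHomEquiv_elt, Category.id_comp, braiding_tensorUnit_right, Category.assoc,
    Iso.inv_hom_id_assoc]

theorem mapFst_onSnd (X X' : C) {B B' : D} (g : B ⟶ B') :
    mapFst M X X' B ≫ eHomWhiskerLeft V _ (onSnd M X' g) =
      mapFst M X X' B' ≫ eHomWhiskerRight V (onSnd M X g) _ := by
  rw [← cancel_epi (ρ_ _).hom, ← elt_eHomEquiv, eHomEquiv_onSnd,
    ← Category.id_comp (mapFst M X X' B), ← tensorHom_comp_tensorHom_assoc, mapFst_mapSnd,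
    ← cancel_epi (β_ _ _).hom, ← BraidedCategory.braiding_naturality_assoc, ← mapSnd_mapFst,
    tensorHom_comp_tensorHom_assoc, ← eHomEquiv_onSnd, eHomEquiv_elt, Category.id_comp,
    braiding_tensorUnit_left, Category.assoc, Iso.inv_hom_id_assoc]

end OrdinaryBifunctor

section Naturality

variable {V : Type u} [Category.{w} V] [MonoidalCategory V] [BraidedCategory V]
variable {C : Type u₁} [EnrichedCategory V C] {D : Type u₂} [EnrichedCategory V D]
  {E : Type u₃} [Category.{v₃} E] [EnrichedOrdinaryCategory V E]
variable (M N : EnrichedFunctor V (TProd C D) E)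

/-- The joint action factors through `M(X', B)`. The component of `t` is pushed through the second
factor by `h₂`, carried across the composition by `eComp_whisker_middle`, and then pushed through
the first factor by `h₁`. -/
theorem homMap₂_natural_of_partial (t : ∀ X B, M.obj ⟨X, B⟩ ⟶ N.obj ⟨X, B⟩)
    (h₁ : ∀ X X' B, mapFst M X X' B ≫ eHomWhiskerLeft V _ (t X' B) =
      mapFst N X X' B ≫ eHomWhiskerRight V (t X B) _)
    (h₂ : ∀ X B B', mapSnd M X B B' ≫ eHomWhiskerLeft V _ (t X B') =
      mapSnd N X B B' ≫ eHomWhiskerRight V (t X B) _) (X X' : C) (B B' : D) :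
    homMap₂ M X X' B B' ≫ eHomWhiskerLeft V _ (t X' B') =
      homMap₂ N X X' B B' ≫ eHomWhiskerRight V (t X B) _ := by
  rw [← mapFst_mapSnd, ← mapFst_mapSnd, Category.assoc, Category.assoc,
    elt_eHomWhiskerLeft, h₂, ← Category.comp_id (mapFst M X X' B),
    ← tensorHom_comp_tensorHom_assoc, id_tensorHom, ← eComp_whisker_middle, ← tensorHom_id,
    tensorHom_comp_tensorHom_assoc, h₁, Category.comp_id, eComp_eHomWhiskerRight, ← tensorHom_id,
    tensorHom_comp_tensorHom_assoc, Category.comp_id]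

theorem isVNatural_of_partial (t : ∀ X B, M.obj ⟨X, B⟩ ⟶ N.obj ⟨X, B⟩)
    (h₁ : ∀ X X' B, mapFst M X X' B ≫ eHomWhiskerLeft V _ (t X' B) =
      mapFst N X X' B ≫ eHomWhiskerRight V (t X B) _)
    (h₂ : ∀ X B B', mapSnd M X B B' ≫ eHomWhiskerLeft V _ (t X B') =
      mapSnd N X B B' ≫ eHomWhiskerRight V (t X B) _) :
    IsVNatural V M N (fun x => eHomEquiv V (t x.fst x.snd)) :=
  (isVNatural_iff M N (fun x => t x.fst x.snd)).2
    fun x y => homMap₂_natural_of_partial M N t h₁ h₂ x.fst y.fst x.snd y.snd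

variable {M N}

theorem IsVNatural.homMap₂ {t : ∀ X B, M.obj ⟨X, B⟩ ⟶ N.obj ⟨X, B⟩}
    (h : IsVNatural V M N (fun x => eHomEquiv V (t x.fst x.snd))) (X X' : C) (B B' : D) :
    homMap₂ M X X' B B' ≫ eHomWhiskerLeft V _ (t X' B') =
      homMap₂ N X X' B B' ≫ eHomWhiskerRight V (t X B) _ :=
  (isVNatural_iff M N (fun x => t x.fst x.snd)).1 h ⟨X, B⟩ ⟨X', B'⟩

theorem IsVNatural.mapFst {t : ∀ X B, M.obj ⟨X, B⟩ ⟶ N.obj ⟨X, B⟩}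
    (h : IsVNatural V M N (fun x => eHomEquiv V (t x.fst x.snd))) (X X' : C) (B : D) :
    mapFst M X X' B ≫ eHomWhiskerLeft V _ (t X' B) =
      mapFst N X X' B ≫ eHomWhiskerRight V (t X B) _ := by
  simp only [Tambara.mapFst, Category.assoc, h.homMap₂]

theorem IsVNatural.mapSnd {t : ∀ X B, M.obj ⟨X, B⟩ ⟶ N.obj ⟨X, B⟩}
    (h : IsVNatural V M N (fun x => eHomEquiv V (t x.fst x.snd))) (X : C) (B B' : D) :
    mapSnd M X B B' ≫ eHomWhiskerLeft V _ (t X B') =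
      mapSnd N X B B' ≫ eHomWhiskerRight V (t X B) _ := by
  simp only [Tambara.mapSnd, Category.assoc, h.homMap₂]

end Naturality

end Tambara

namespace Tambara

/-! ### The actions of a parametrized right adjoint, seen through the evaluation. -/

section InternalHom

variable {V : Type u} [Category.{w} V] [MonoidalCategory V] [BraidedCategory V]
variable {A : Type u₁} [Category.{u₂} A] [EnrichedOrdinaryCategory V A]
variable (M : EnrichedFunctor V (TProd A A) A) (h : A → A → A)
  (ev : ∀ X Y, M.obj ⟨X, h X Y⟩ ⟶ Y) [∀ X Y B, IsIso (transp M h ev X Y B)]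

/-- `homMap` is defined by inverting the transposition, so its transpose is explicit; placing an
identity in the first variable leaves precomposition with `ev`. In other words, `ev` is natural in
`Y`, and by the next lemma extranatural in `X`. -/
theorem mapSnd_homFunctor_transp (X Y Y' : A) :
    mapSnd (homFunctor M h ev) (op X) Y Y' ≫ transp M h ev X Y' (h X Y) =
      eHomWhiskerRight V (ev X Y) Y' := by
  change ((λ_ _).inv ≫ (eId V X ▷ _) ≫ homMap M h ev X X Y Y') ≫ _ = _
  rw [Category.assoc, Category.assoc, homMap_transp, ← tensorHom_id,
    tensorHom_comp_tensorHom_assoc, evMap, reassoc_of% partR_id, eId_eHomWhiskerLeft,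
    Category.comp_id, eHomEquiv_elt, Iso.inv_hom_id_assoc, Category.id_comp]

theorem mapFst_homFunctor_transp (X' X Y : A) :
    mapFst (homFunctor M h ev) (op X) (op X') Y ≫ transp M h ev X' Y (h X Y) =
      evMap M h ev X' X Y := by
  change ((ρ_ _).inv ≫ (_ ◁ eId V Y) ≫ homMap M h ev X X' Y Y) ≫ _ = _
  rw [Category.assoc, Category.assoc, homMap_transp, ← id_tensorHom,
    tensorHom_comp_tensorHom_assoc, Category.id_comp, Category.comp_id, comp_eId',
    Iso.inv_hom_id_assoc]

end InternalHom

/-! ### The enriched tensor product and its constraints. -/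

section Tensor

variable (V : Type u) [Category.{w} V] [MonoidalCategory V] [SymmetricCategory V]
variable {A : Type u₁} [Category.{u₂} A] [MonoidalCategory A] [EnrichedOrdinaryCategory V A]
  [MonoidalVCategory V A]

theorem tensL_eq (X Y Y' : A) :
    tensL V X Y Y' = (λ_ _).inv ≫ (eId V X ⊗ₘ 𝟙 _) ≫ MonoidalVCategory.tensorMap X X Y Y' := by
  rw [tensorHom_id, tensL]

theorem tensR_eq (X X' Y : A) :
    tensR V X X' Y = (ρ_ _).inv ≫ (𝟙 _ ⊗ₘ eId V Y) ≫ MonoidalVCategory.tensorMap X X' Y Y := by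
  rw [id_tensorHom, tensR]

theorem eId_tensorMap (X Y : A) :
    (λ_ (𝟙_ V)).inv ≫ (eId V X ⊗ₘ eId V Y) ≫ MonoidalVCategory.tensorMap X X Y Y =
      eId V (X ⊗ Y) :=
  (Category.assoc _ _ _).symm.trans ((tensorFunctor V).map_id ⟨X, Y⟩)

theorem eHomEquiv_tensL (X : A) {Y Y' : A} (g : Y ⟶ Y') :
    eHomEquiv V g ≫ tensL V X Y Y' = eHomEquiv V (X ◁ g) := by
  rw [tensL, leftUnitor_inv_naturality_assoc, ← MonoidalCategory.tensorHom_def'_assoc,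
    ← eHomEquiv_id, MonoidalVCategory.tensorMap_underlying, id_tensorHom]

theorem eHomEquiv_tensR {X X' : A} (f : X ⟶ X') (Y : A) :
    eHomEquiv V f ≫ tensR V X X' Y = eHomEquiv V (f ▷ Y) := by
  rw [tensR, rightUnitor_inv_naturality_assoc, ← MonoidalCategory.tensorHom_def_assoc,
    ← unitors_inv_equal, ← eHomEquiv_id, MonoidalVCategory.tensorMap_underlying, tensorHom_id]

theorem onSnd_tensorFunctor (X : A) {Y Y' : A} (g : Y ⟶ Y') :
    onSnd (tensorFunctor V) X g = X ◁ g :=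
  (onHom_eq_iff _ _ _).2 (eHomEquiv_tensL V X g)

theorem onFst_tensorFunctor {X X' : A} (f : X ⟶ X') (Y : A) :
    onFst (tensorFunctor V) f Y = f ▷ Y :=
  (onHom_eq_iff _ _ _).2 (eHomEquiv_tensR V f Y)

theorem eHomWhiskerLeft_tensL (X Y : A) {Z Z' : A} (g : Z ⟶ Z') :
    eHomWhiskerLeft V Y g ≫ tensL V X Y Z' = tensL V X Y Z ≫ eHomWhiskerLeft V _ (X ◁ g) := by
  rw [← onSnd_tensorFunctor V]
  exact eHomWhiskerLeft_mapSnd (tensorFunctor V) X Y g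

theorem eHomWhiskerRight_tensL (X : A) {Y Y' : A} (f : Y ⟶ Y') (Z : A) :
    eHomWhiskerRight V f Z ≫ tensL V X Y Z = tensL V X Y' Z ≫ eHomWhiskerRight V (X ◁ f) _ := by
  rw [← onSnd_tensorFunctor V]
  exact eHomWhiskerRight_mapSnd (tensorFunctor V) X f Z

theorem eHomWhiskerLeft_tensR (Y : A) {Z Z' : A} (g : Z ⟶ Z') (X : A) :
    eHomWhiskerLeft V Y g ≫ tensR V Y Z' X = tensR V Y Z X ≫ eHomWhiskerLeft V _ (g ▷ X) := by
  rw [← onFst_tensorFunctor V]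
  exact eHomWhiskerLeft_mapFst (tensorFunctor V) Y g X

theorem eHomWhiskerRight_tensR {Y Y' : A} (f : Y ⟶ Y') (Z X : A) :
    eHomWhiskerRight V f Z ≫ tensR V Y Z X = tensR V Y' Z X ≫ eHomWhiskerRight V (f ▷ X) _ := by
  rw [← onFst_tensorFunctor V]
  exact eHomWhiskerRight_mapFst (tensorFunctor V) f Z X

/-- Interchange law: an ordinary morphism in one tensor factor commutes with the action of a hom
object on the other. -/
theorem tensL_exchange {X X' : A} (f : X ⟶ X') (Y Y' : A) :
    tensL V X Y Y' ≫ eHomWhiskerLeft V _ (f ▷ Y') =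
      tensL V X' Y Y' ≫ eHomWhiskerRight V (f ▷ Y) _ := by
  rw [← onFst_tensorFunctor V, ← onFst_tensorFunctor V]
  exact mapSnd_onFst (tensorFunctor V) f Y Y'

theorem tensR_exchange (X X' : A) {Y Y' : A} (g : Y ⟶ Y') :
    tensR V X X' Y ≫ eHomWhiskerLeft V _ (X' ◁ g) =
      tensR V X X' Y' ≫ eHomWhiskerRight V (X ◁ g) _ := by
  rw [← onSnd_tensorFunctor V, ← onSnd_tensorFunctor V]
  exact mapFst_onSnd (tensorFunctor V) X X' g

theorem tensL_unit (X X' : A) :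
    tensL V (𝟙_ A) X X' ≫ eHomWhiskerLeft V _ (λ_ X').hom = eHomWhiskerRight V (λ_ X).hom X' := by
  rw [← MonoidalVCategory.leftUnitor_natural, tensL, Category.assoc, Category.assoc]

theorem tensR_unit (X X' : A) :
    tensR V X X' (𝟙_ A) ≫ eHomWhiskerLeft V _ (ρ_ X').hom = eHomWhiskerRight V (ρ_ X).hom X' := by
  rw [← MonoidalVCategory.rightUnitor_natural, tensR, Category.assoc, Category.assoc]

/-- Naturality of the associator on generalised elements. Putting identities in two of the three
slots yields its naturality in each single variable, which is `tensL_tensL`, `tensR_tensR` and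
`tensL_tensR`. -/
theorem associator_elt {X X' Y Y' Z Z' : A} {P Q R : V} (f : P ⟶ (X ⟶[V] X'))
    (g : Q ⟶ (Y ⟶[V] Y')) (k : R ⟶ (Z ⟶[V] Z')) :
    (((f ⊗ₘ g) ≫ MonoidalVCategory.tensorMap X X' Y Y') ⊗ₘ k) ≫
        MonoidalVCategory.tensorMap (X ⊗ Y) (X' ⊗ Y') Z Z' ≫
          eHomWhiskerLeft V _ (α_ X' Y' Z').hom =
      (α_ _ _ _).hom ≫ (f ⊗ₘ ((g ⊗ₘ k) ≫ MonoidalVCategory.tensorMap Y Y' Z Z')) ≫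
        MonoidalVCategory.tensorMap X X' (Y ⊗ Z) (Y' ⊗ Z') ≫
          eHomWhiskerRight V (α_ X Y Z).hom _ := by
  have e := ((f ⊗ₘ g) ⊗ₘ k) ≫= MonoidalVCategory.associator_natural (V := V) X X' Y Y' Z Z'
  rw [← tensorHom_id, tensorHom_comp_tensorHom_assoc, Category.comp_id,
    associator_naturality_assoc, ← id_tensorHom, tensorHom_comp_tensorHom_assoc,
    Category.comp_id] at e
  exact e

theorem elt_tensL (X : A) {Y Y' : A} {W : V} (f : W ⟶ (Y ⟶[V] Y')) :
    f ≫ tensL V X Y Y' =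
      (λ_ W).inv ≫ (eId V X ⊗ₘ f) ≫ MonoidalVCategory.tensorMap X X Y Y' := by
  rw [tensL, leftUnitor_inv_naturality_assoc, ← MonoidalCategory.tensorHom_def'_assoc]

theorem elt_tensR {X X' : A} (Y : A) {W : V} (f : W ⟶ (X ⟶[V] X')) :
    f ≫ tensR V X X' Y =
      (ρ_ W).inv ≫ (f ⊗ₘ eId V Y) ≫ MonoidalVCategory.tensorMap X X' Y Y := by
  rw [tensR, rightUnitor_inv_naturality_assoc, ← MonoidalCategory.tensorHom_def_assoc]

theorem comp_tensorHom' {P P' Q R S : V} (f : P ⟶ P') (g : P' ⟶ Q) (k : R ⟶ S) :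
    (f ≫ g) ⊗ₘ k = (f ▷ R) ≫ (g ⊗ₘ k) := by
  rw [← tensorHom_id, tensorHom_comp_tensorHom, Category.id_comp]

theorem tensorHom_comp' {P P' Q R S : V} (f : P ⟶ P') (g : P' ⟶ Q) (k : R ⟶ S) :
    k ⊗ₘ (f ≫ g) = (R ◁ f) ≫ (k ⊗ₘ g) := by
  rw [← id_tensorHom, tensorHom_comp_tensorHom, Category.id_comp]

theorem tensL_tensL (X Y Z Z' : A) :
    tensL V Y Z Z' ≫ tensL V X _ _ ≫ eHomWhiskerRight V (α_ X Y Z).hom _ =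
      tensL V (X ⊗ Y) Z Z' ≫ eHomWhiskerLeft V _ (α_ X Y Z').hom := by
  have e := associator_elt V (eId V X) (eId V Y) (𝟙 (Z ⟶[V] Z'))
  rw [← Category.assoc, elt_tensL, tensL_eq, tensL_eq V (X ⊗ Y), ← eId_tensorMap, comp_tensorHom',
    tensorHom_comp']
  simp only [Category.assoc, e]
  monoidal

theorem tensR_tensR (X X' Y Z : A) :
    tensR V X X' Y ≫ tensR V _ _ Z ≫ eHomWhiskerLeft V _ (α_ X' Y Z).hom =
      tensR V X X' (Y ⊗ Z) ≫ eHomWhiskerRight V (α_ X Y Z).hom _ := by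
  have e := associator_elt V (𝟙 (X ⟶[V] X')) (eId V Y) (eId V Z)
  rw [← Category.assoc, elt_tensR, tensR_eq, tensR_eq V _ _ (Y ⊗ Z), ← eId_tensorMap,
    comp_tensorHom', tensorHom_comp']
  simp only [Category.assoc, e]
  monoidal

theorem tensL_tensR (X Y Y' Z : A) :
    tensL V X Y Y' ≫ tensR V _ _ Z ≫ eHomWhiskerLeft V _ (α_ X Y' Z).hom =
      tensR V Y Y' Z ≫ tensL V X _ _ ≫ eHomWhiskerRight V (α_ X Y Z).hom _ := by
  have e := associator_elt V (eId V X) (𝟙 (Y ⟶[V] Y')) (eId V Z)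
  rw [← Category.assoc, elt_tensR, tensL_eq, ← Category.assoc (tensR V _ _ _), elt_tensL,
    tensR_eq, comp_tensorHom', tensorHom_comp']
  have c : (ρ_ (Y ⟶[V] Y')).inv ≫ (λ_ (Y ⟶[V] Y')).inv ▷ (𝟙_ V) ≫ (α_ _ _ _).hom =
    (λ_ _).inv ≫ (𝟙_ V) ◁ (ρ_ _).inv := by monoidal
  simp only [Category.assoc, e, reassoc_of% c]

end Tensor

/-! ### Transposition along the two evaluations. -/

section Closed

variable (V : Type u) [Category.{w} V] [MonoidalCategory V] [SymmetricCategory V]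
variable {A : Type u₁} [Category.{u₂} A] [MonoidalCategory A] [EnrichedOrdinaryCategory V A]
  [MonoidalVCategory V A]

theorem mapSnd_revTensorFunctor (X B B' : A) :
    mapSnd (revTensorFunctor V) X B B' = tensR V B B' X := by
  simp only [mapSnd, homMap₂, revTensorFunctor, tensR]
  rw [BraidedCategory.braiding_naturality_left_assoc]
  simp

theorem mapFst_revTensorFunctor (X X' B : A) :
    mapFst (revTensorFunctor V) X X' B = tensL V B X X' := by
  simp only [mapFst, homMap₂, revTensorFunctor, tensL]
  rw [BraidedCategory.braiding_naturality_right_assoc]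
  simp

variable [ClosedVCategory V A]

/-- The action `A(Y, Y') ⟶ A(Y^X, Y'^X)`. -/
def rhomSnd (X Y Y' : A) : (Y ⟶[V] Y') ⟶ (rhom V X Y ⟶[V] rhom V X Y') :=
  mapSnd (rhomFunctor V) (op X) Y Y'

/-- The action `A(X', X) ⟶ A(Y^X, Y^X')`. -/
def rhomFst (X' X Y : A) : (X' ⟶[V] X) ⟶ (rhom V X Y ⟶[V] rhom V X' Y) :=
  mapFst (rhomFunctor V) (op X) (op X') Y

/-- The action `A(Y, Y') ⟶ A(^X Y, ^X Y')`. -/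
def lhomSnd (X Y Y' : A) : (Y ⟶[V] Y') ⟶ (lhom V X Y ⟶[V] lhom V X Y') :=
  mapSnd (lhomFunctor V) (op X) Y Y'

/-- The action `A(X', X) ⟶ A(^X Y, ^X' Y)`. -/
def lhomFst (X' X Y : A) : (X' ⟶[V] X) ⟶ (lhom V X Y ⟶[V] lhom V X' Y) :=
  mapFst (lhomFunctor V) (op X) (op X') Y

/-- This and the three equations after it describe the internal hom actions by their transposes, and
hence determine them by `rhom_elt_ext` and `lhom_elt_ext`. The naturality proofs below transpose and
then rewrite with them. -/
theorem rhomSnd_rev (X Y Y' : A) :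
    rhomSnd V X Y Y' ≫ tensL V X _ _ ≫ eHomWhiskerLeft V _ (rev V X Y') =
      eHomWhiskerRight V (rev V X Y) Y' :=
  mapSnd_homFunctor_transp (tensorFunctor V) (rhom V) (fun X Y : A => rev V X Y) X Y Y'

theorem rhomFst_rev (X' X Y : A) :
    rhomFst V X' X Y ≫ tensL V X' _ _ ≫ eHomWhiskerLeft V _ (rev V X' Y) =
      tensR V X' X (rhom V X Y) ≫ eHomWhiskerLeft V _ (rev V X Y) :=
  mapFst_homFunctor_transp (tensorFunctor V) (rhom V) (fun X Y : A => rev V X Y) X' X Y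

theorem lhomSnd_lev (X Y Y' : A) :
    lhomSnd V X Y Y' ≫ tensR V _ _ X ≫ eHomWhiskerLeft V _ (lev V X Y') =
      eHomWhiskerRight V (lev V X Y) Y' := by
  rw [← mapSnd_revTensorFunctor]
  exact mapSnd_homFunctor_transp (revTensorFunctor V) (lhom V) (fun X Y : A => lev V X Y) X Y Y'

theorem lhomFst_lev (X' X Y : A) :
    lhomFst V X' X Y ≫ tensR V _ _ X' ≫ eHomWhiskerLeft V _ (lev V X' Y) =
      tensL V (lhom V X Y) X' X ≫ eHomWhiskerLeft V _ (lev V X Y) := by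
  rw [← mapSnd_revTensorFunctor, ← mapFst_revTensorFunctor]
  exact mapFst_homFunctor_transp (revTensorFunctor V) (lhom V) (fun X Y : A => lev V X Y) X' X Y

/-- Transposition is an isomorphism in `V`, hence monic. The arbitrary source `W` is what allows
enriched naturality to be tested on transposes; `rhom_hom_ext` is the case of ordinary morphisms. -/
theorem rhom_elt_ext {X B Y : A} {W : V} {f g : W ⟶ (B ⟶[V] rhom V X Y)}
    (h : f ≫ tensL V X B _ ≫ eHomWhiskerLeft V _ (rev V X Y) =
      g ≫ tensL V X B _ ≫ eHomWhiskerLeft V _ (rev V X Y)) : f = g :=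
  (cancel_mono (tensL V X B (rhom V X Y) ≫ eHomWhiskerLeft V (X ⊗ B) (rev V X Y))).1 h

theorem lhom_elt_ext {X B Y : A} {W : V} {f g : W ⟶ (B ⟶[V] lhom V X Y)}
    (h : f ≫ tensR V B _ X ≫ eHomWhiskerLeft V _ (lev V X Y) =
      g ≫ tensR V B _ X ≫ eHomWhiskerLeft V _ (lev V X Y)) : f = g :=
  (cancel_mono (tensR V B (lhom V X Y) X ≫ eHomWhiskerLeft V (B ⊗ X) (lev V X Y))).1 h

theorem rhom_hom_ext {X B Y : A} {f g : B ⟶ rhom V X Y}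
    (h : X ◁ f ≫ rev V X Y = X ◁ g ≫ rev V X Y) : f = g := by
  apply (eHomEquiv V).injective
  apply rhom_elt_ext
  rw [reassoc_of% eHomEquiv_tensL, reassoc_of% eHomEquiv_tensL, eHomEquiv_eHomWhiskerLeft,
    eHomEquiv_eHomWhiskerLeft, h]

theorem lhom_hom_ext {X B Y : A} {f g : B ⟶ lhom V X Y}
    (h : f ▷ X ≫ lev V X Y = g ▷ X ≫ lev V X Y) : f = g := by
  apply (eHomEquiv V).injective
  apply lhom_elt_ext
  rw [reassoc_of% eHomEquiv_tensR, reassoc_of% eHomEquiv_tensR, eHomEquiv_eHomWhiskerLeft,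
    eHomEquiv_eHomWhiskerLeft, h]

@[simp]
theorem rcurry_rev {X B Y : A} (f : X ⊗ B ⟶ Y) : X ◁ rcurry V f ≫ rev V X Y = f := by
  apply (eHomEquiv V).injective
  rw [← eHomEquiv_eHomWhiskerLeft, ← eHomEquiv_tensL, Category.assoc, rcurry,
    Equiv.apply_symm_apply, Category.assoc, IsIso.inv_hom_id, Category.comp_id]

@[simp]
theorem lcurry_lev {X B Y : A} (f : B ⊗ X ⟶ Y) : lcurry V f ▷ X ≫ lev V X Y = f := by
  apply (eHomEquiv V).injective
  rw [← eHomEquiv_eHomWhiskerLeft, ← eHomEquiv_tensR, Category.assoc, lcurry,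
    Equiv.apply_symm_apply, Category.assoc, IsIso.inv_hom_id, Category.comp_id]

/-- The morphism `Y^f : Y^X ⟶ Y^X'`. -/
def rpre {X' X : A} (f : X' ⟶ X) (Y : A) : rhom V X Y ⟶ rhom V X' Y :=
  rcurry V (f ▷ _ ≫ rev V X Y)

/-- The morphism `^X f : ^X Y ⟶ ^X Z`. -/
def lpost (X : A) {Y Z : A} (f : Y ⟶ Z) : lhom V X Y ⟶ lhom V X Z :=
  lcurry V (lev V X Y ≫ f)

theorem eHomEquiv_rhomSnd (X : A) {Y Y' : A} (g : Y ⟶ Y') :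
    eHomEquiv V g ≫ rhomSnd V X Y Y' = eHomEquiv V (rpost V X g) := by
  apply rhom_elt_ext
  rw [Category.assoc, rhomSnd_rev, eHomEquiv_eHomWhiskerRight, reassoc_of% eHomEquiv_tensL,
    eHomEquiv_eHomWhiskerLeft, rpost, rcurry_rev]

theorem eHomEquiv_rhomFst {X' X : A} (f : X' ⟶ X) (Y : A) :
    eHomEquiv V f ≫ rhomFst V X' X Y = eHomEquiv V (rpre V f Y) := by
  apply rhom_elt_ext
  rw [Category.assoc, rhomFst_rev, reassoc_of% eHomEquiv_tensR, reassoc_of% eHomEquiv_tensL,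
    eHomEquiv_eHomWhiskerLeft, eHomEquiv_eHomWhiskerLeft, rpre, rcurry_rev]

theorem eHomEquiv_lhomSnd (X : A) {Y Y' : A} (g : Y ⟶ Y') :
    eHomEquiv V g ≫ lhomSnd V X Y Y' = eHomEquiv V (lpost V X g) := by
  apply lhom_elt_ext
  rw [Category.assoc, lhomSnd_lev, eHomEquiv_eHomWhiskerRight, reassoc_of% eHomEquiv_tensR,
    eHomEquiv_eHomWhiskerLeft, lpost, lcurry_lev]

theorem onSnd_rhomFunctor (X : A) {Y Y' : A} (g : Y ⟶ Y') :
    onSnd (rhomFunctor V) (op X) g = rpost V X g :=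
  (onHom_eq_iff _ _ _).2 (eHomEquiv_rhomSnd V X g)

theorem onFst_rhomFunctor {X' X : A} (f : X' ⟶ X) (Y : A) :
    onFst (rhomFunctor V) f.op Y = rpre V f Y :=
  (onHom_eq_iff _ _ _).2 (eHomEquiv_rhomFst V f Y)

end Closed

end Tambara

namespace Tambara

section

variable {V : Type u} [Category.{w} V] [MonoidalCategory V]
variable {C : Type u₁} [Category.{v₁} C] [EnrichedOrdinaryCategory V C]

instance (X : C) {Y Z : C} (g : Y ⟶ Z) [IsIso g] : IsIso (eHomWhiskerLeft V X g) :=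
  ⟨eHomWhiskerLeft V X (inv g), by rw [← eHomWhiskerLeft_comp]; simp,
    by rw [← eHomWhiskerLeft_comp]; simp⟩

instance {X Y : C} (f : X ⟶ Y) [IsIso f] (Z : C) : IsIso (eHomWhiskerRight V f Z) :=
  ⟨eHomWhiskerRight V (inv f) Z, by rw [← eHomWhiskerRight_comp]; simp,
    by rw [← eHomWhiskerRight_comp]; simp⟩

end

/-! ### The canonical morphisms of `A` and their `V`-naturality. -/

section ClosedConstants

variable (V : Type u) [Category.{w} V] [MonoidalCategory V] [SymmetricCategory V]
variable {A : Type u₁} [Category.{u₂} A] [MonoidalCategory A] [EnrichedOrdinaryCategory V A]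
  [MonoidalVCategory V A] [ClosedVCategory V A]

@[simp]
theorem rpost_rev (X : A) {Y Z : A} (f : Y ⟶ Z) :
    X ◁ rpost V X f ≫ rev V X Z = rev V X Y ≫ f := rcurry_rev V _

@[simp]
theorem rpost_rev_assoc (X : A) {Y Z W : A} (f : Y ⟶ Z) (k : Z ⟶ W) :
    X ◁ rpost V X f ≫ rev V X Z ≫ k =
      rev V X Y ≫ f ≫ k := by
  rw [reassoc_of% rpost_rev]

@[simp]
theorem rpre_rev {X' X : A} (f : X' ⟶ X) (Y : A) :
    X' ◁ rpre V f Y ≫ rev V X' Y = f ▷ _ ≫ rev V X Y := rcurry_rev V _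

@[simp]
theorem rpre_rev_assoc {X' X : A} (f : X' ⟶ X) (Y : A) {W : A} (k : Y ⟶ W) :
    X' ◁ rpre V f Y ≫ rev V X' Y ≫ k =
      f ▷ _ ≫ rev V X Y ≫ k := by
  rw [reassoc_of% rpre_rev]

@[simp]
theorem lpost_lev (X : A) {Y Z : A} (f : Y ⟶ Z) :
    lpost V X f ▷ X ≫ lev V X Z = lev V X Y ≫ f := lcurry_lev V _

@[simp]
theorem lpost_lev_assoc (X : A) {Y Z W : A} (f : Y ⟶ Z) (k : Z ⟶ W) :
    lpost V X f ▷ X ≫ lev V X Z ≫ k =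
      lev V X Y ≫ f ≫ k := by
  rw [reassoc_of% lpost_lev]

@[simp]
theorem rcoev_rev (X Y : A) : X ◁ rcoev V X Y ≫ rev V X (X ⊗ Y) = 𝟙 _ := rcurry_rev V _

@[simp]
theorem lcoev_lev (X Y : A) : lcoev V X Y ▷ X ≫ lev V X (Y ⊗ X) = 𝟙 _ := lcurry_lev V _

@[simp]
theorem rassoc_rev (X Y Z : A) :
    (X ⊗ Y) ◁ rassoc V X Y Z ≫ rev V (X ⊗ Y) Z =
      (α_ X Y _).hom ≫ (X ◁ rev V Y (rhom V X Z)) ≫ rev V X Z := rcurry_rev V _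

@[simp]
theorem rassoc_rev_assoc (X Y Z : A) {W : A} (k : Z ⟶ W) :
    (X ⊗ Y) ◁ rassoc V X Y Z ≫ rev V (X ⊗ Y) Z ≫ k =
      (α_ X Y _).hom ≫ (X ◁ rev V Y (rhom V X Z)) ≫ rev V X Z ≫ k := by
  rw [reassoc_of% rassoc_rev]

@[simp]
theorem lassoc_lev (X Y Z : A) :
    lassoc V X Y Z ▷ X ≫ lev V X (lhom V Y Z) = lcurry V ((α_ _ X Y).hom ≫ lev V (X ⊗ Y) Z) :=
  lcurry_lev V _

@[simp]
theorem lrswap_lev (X Y Z : A) :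
    lrswap V X Y Z ▷ Y ≫ lev V Y (rhom V X Z) =
      rcurry V ((α_ X _ Y).inv ≫ (rev V X (lhom V Y Z) ▷ Y) ≫ lev V Y Z) :=
  lcurry_lev V _

@[simp]
theorem lrswap_lev_assoc (X Y Z : A) {W : A} (k : rhom V X Z ⟶ W) :
    lrswap V X Y Z ▷ Y ≫ lev V Y (rhom V X Z) ≫ k =
      rcurry V ((α_ X _ Y).inv ≫ (rev V X (lhom V Y Z) ▷ Y) ≫ lev V Y Z) ≫ k := by
  rw [reassoc_of% lrswap_lev]

/-- The morphism `Y^X ⟶ (B ⊗ Y)^(B ⊗ X)` given by tensoring with `B` on the left. -/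
def ract (B X Y : A) : rhom V X Y ⟶ rhom V (B ⊗ X) (B ⊗ Y) :=
  rpost V X (rcoev V B Y) ≫ rassoc V B X (B ⊗ Y)

/-- The morphism `Y^X ⟶ ^B ((Y ⊗ B)^X)` given by tensoring with `B` on the right. -/
def lact (B X Y : A) : rhom V X Y ⟶ lhom V B (rhom V X (Y ⊗ B)) :=
  rpost V X (lcoev V B Y) ≫ lrswap V X B (Y ⊗ B)

@[simp]
-- By the triangle identity `rcoev_rev`, the coevaluation in `ract` cancels against the evaluation
-- at `B`, leaving `B ⊗ e_r`.
theorem ract_rev (B X Y : A) :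
    (B ⊗ X) ◁ ract V B X Y ≫ rev V (B ⊗ X) (B ⊗ Y) = (α_ B X _).hom ≫ B ◁ rev V X Y := by
  rw [ract, MonoidalCategory.whiskerLeft_comp, Category.assoc, rassoc_rev,
    associator_naturality_right_assoc, ← MonoidalCategory.whiskerLeft_comp_assoc, rpost_rev,
    MonoidalCategory.whiskerLeft_comp_assoc, rcoev_rev, Category.comp_id]

@[simp]
theorem ract_rev_assoc (B X Y : A) {W : A} (k : B ⊗ Y ⟶ W) :
    (B ⊗ X) ◁ ract V B X Y ≫ rev V (B ⊗ X) (B ⊗ Y) ≫ k =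
      (α_ B X _).hom ≫ B ◁ rev V X Y ≫ k := by
  rw [reassoc_of% ract_rev]

@[simp]
-- The same cancellation for `lcoev`. The target of `lact` is a double internal hom, so one
-- transpose still leaves an `rcurry`; `lact_lev_rev` removes it and leaves `e_r ⊗ B`.
theorem lact_lev (B X Y : A) :
    lact V B X Y ▷ B ≫ lev V B (rhom V X (Y ⊗ B)) =
      rcurry V ((α_ X _ B).inv ≫ rev V X Y ▷ B) := by
  apply rhom_hom_ext
  rw [lact, comp_whiskerRight, Category.assoc, lrswap_lev,
    MonoidalCategory.whiskerLeft_comp, Category.assoc, rcurry_rev, rcurry_rev,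
    associator_inv_naturality_middle_assoc,
    ← comp_whiskerRight_assoc, rpost_rev, comp_whiskerRight_assoc, lcoev_lev, Category.comp_id]

/-- Transposing along `X ⊗ Y` after `rassoc` is transposing along `Y` and then along `X`. This, with
its analogues for `ract` and `lact`, turns naturality of these morphisms into naturality of
evaluations and associators. -/
theorem eHomWhiskerLeft_rassoc_rev (W X Y Z : A) :
    eHomWhiskerLeft V W (rassoc V X Y Z) ≫ tensL V (X ⊗ Y) W _ ≫ eHomWhiskerLeft V _ (rev V _ Z) =
      tensL V Y W _ ≫ eHomWhiskerLeft V _ (rev V Y (rhom V X Z)) ≫ tensL V X _ _ ≫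
        eHomWhiskerLeft V _ (rev V X Z) ≫ eHomWhiskerRight V (α_ X Y W).hom _ := by
  rw [reassoc_of% eHomWhiskerLeft_tensL, ← eHomWhiskerLeft_comp, rassoc_rev, eHomWhiskerLeft_comp,
    ← reassoc_of% tensL_tensL, reassoc_of% eHomWhiskerLeft_tensL, eHom_whisker_exchange,
    eHomWhiskerLeft_comp, eHom_whisker_exchange_assoc]

theorem eHomWhiskerLeft_ract_rev (W B X Y : A) :
    eHomWhiskerLeft V W (ract V B X Y) ≫ tensL V (B ⊗ X) W _ ≫
        eHomWhiskerLeft V _ (rev V _ (B ⊗ Y)) =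
      tensL V X W _ ≫ eHomWhiskerLeft V _ (rev V X Y) ≫ tensL V B _ _ ≫
        eHomWhiskerRight V (α_ B X W).hom _ := by
  rw [reassoc_of% eHomWhiskerLeft_tensL, ← eHomWhiskerLeft_comp, ract_rev, eHomWhiskerLeft_comp,
    ← reassoc_of% tensL_tensL, reassoc_of% eHomWhiskerLeft_tensL, eHom_whisker_exchange]

theorem tensL_tensR_inv (X Y Y' Z : A) :
    tensL V X Y Y' ≫ tensR V _ _ Z ≫ eHomWhiskerRight V (α_ X Y Z).inv _ =
      tensR V Y Y' Z ≫ tensL V X _ _ ≫ eHomWhiskerLeft V _ (α_ X Y' Z).inv := by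
  rw [← cancel_mono (eHomWhiskerLeft V _ (α_ X Y' Z).hom), Category.assoc,
    Category.assoc, Category.assoc, Category.assoc, ← eHom_whisker_exchange,
    reassoc_of% tensL_tensR, ← eHomWhiskerLeft_comp, ← eHomWhiskerRight_comp, Iso.inv_hom_id,
    Iso.inv_hom_id, eHomWhiskerRight_id, eHomWhiskerLeft_id]

theorem tensR_tensR_inv (X X' Y Z : A) :
    tensR V X X' Y ≫ tensR V _ _ Z ≫ eHomWhiskerRight V (α_ X Y Z).inv _ =
      tensR V X X' (Y ⊗ Z) ≫ eHomWhiskerLeft V _ (α_ X' Y Z).inv := by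
  rw [← cancel_mono (eHomWhiskerLeft V _ (α_ X' Y Z).hom), Category.assoc,
    Category.assoc, Category.assoc, ← eHom_whisker_exchange,
    reassoc_of% tensR_tensR, ← eHomWhiskerLeft_comp, ← eHomWhiskerRight_comp, Iso.inv_hom_id,
    Iso.inv_hom_id, eHomWhiskerRight_id, eHomWhiskerLeft_id]

theorem tensL_tensL_inv (X Y Z Z' : A) :
    tensL V Y Z Z' ≫ tensL V X _ _ ≫ eHomWhiskerLeft V _ (α_ X Y Z').inv =
      tensL V (X ⊗ Y) Z Z' ≫ eHomWhiskerRight V (α_ X Y Z).inv _ := by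
  rw [← cancel_mono (eHomWhiskerRight V (α_ X Y Z).hom _), Category.assoc,
    Category.assoc, Category.assoc, eHom_whisker_exchange,
    reassoc_of% tensL_tensL, ← eHomWhiskerLeft_comp, ← eHomWhiskerRight_comp, Iso.hom_inv_id,
    Iso.hom_inv_id, eHomWhiskerRight_id, eHomWhiskerLeft_id]

theorem eHomWhiskerLeft_leftUnitor_inv (X X' : A) :
    eHomWhiskerLeft V X (λ_ X').inv =
      tensL V (𝟙_ A) X X' ≫ eHomWhiskerRight V (λ_ X).inv _ := by
  rw [← cancel_mono (eHomWhiskerLeft V X (λ_ X').hom), Category.assoc, ← eHom_whisker_exchange,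
    reassoc_of% tensL_unit, ← eHomWhiskerLeft_comp, ← eHomWhiskerRight_comp, Iso.inv_hom_id,
    Iso.inv_hom_id, eHomWhiskerRight_id, eHomWhiskerLeft_id]

theorem lact_lev_rev (B X Y : A) :
    X ◁ lact V B X Y ▷ B ≫ X ◁ lev V B (rhom V X (Y ⊗ B)) ≫ rev V X (Y ⊗ B) =
      (α_ X _ B).inv ≫ rev V X Y ▷ B := by
  rw [← MonoidalCategory.whiskerLeft_comp_assoc, lact_lev, rcurry_rev]

theorem eHomWhiskerLeft_lact_lev (W B X Y : A) :
    eHomWhiskerLeft V W (lact V B X Y) ≫ tensR V W _ B ≫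
        eHomWhiskerLeft V _ (lev V B (rhom V X (Y ⊗ B))) ≫ tensL V X _ _ ≫
          eHomWhiskerLeft V _ (rev V X (Y ⊗ B)) =
      tensL V X W _ ≫ eHomWhiskerLeft V _ (rev V X Y) ≫ tensR V _ _ B ≫
        eHomWhiskerRight V (α_ X W B).inv _ := by
  rw [reassoc_of% eHomWhiskerLeft_tensR, ← eHomWhiskerLeft_comp_assoc, lact_lev,
    reassoc_of% eHomWhiskerLeft_tensL, ← eHomWhiskerLeft_comp, rcurry_rev,
    reassoc_of% eHomWhiskerLeft_tensR,
    eHom_whisker_exchange, eHomWhiskerLeft_comp, reassoc_of% tensL_tensR_inv]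

theorem rassoc_natural_right (X Y Z Z' : A) :
    rhomSnd V X Z Z' ≫ rhomSnd V Y _ _ ≫ eHomWhiskerLeft V _ (rassoc V X Y Z') =
      rhomSnd V (X ⊗ Y) Z Z' ≫ eHomWhiskerRight V (rassoc V X Y Z) _ := by
  apply rhom_elt_ext
  simp only [Category.assoc, eHomWhiskerLeft_rassoc_rev, reassoc_of% rhomSnd_rev,
    reassoc_of% eHomWhiskerRight_tensL, ← eHom_whisker_exchange, ← eHom_whisker_exchange_assoc,
    ← eHomWhiskerRight_comp, rassoc_rev]

theorem rassoc_natural_middle (X Y' Y Z : A) :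
    rhomFst V Y' Y _ ≫ eHomWhiskerLeft V _ (rassoc V X Y' Z) =
      tensL V X Y' Y ≫ rhomFst V (X ⊗ Y') (X ⊗ Y) Z ≫ eHomWhiskerRight V (rassoc V X Y Z) _ := by
  apply rhom_elt_ext
  simp only [Category.assoc, eHomWhiskerLeft_rassoc_rev, reassoc_of% rhomFst_rev,
    reassoc_of% eHomWhiskerRight_tensL, ← eHom_whisker_exchange]
  conv_rhs => rw [eHom_whisker_exchange, ← reassoc_of% tensR_exchange, ← eHomWhiskerLeft_comp,
    rassoc_rev, eHomWhiskerLeft_comp, reassoc_of% tensL_tensR, eHomWhiskerLeft_comp]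
  rw [reassoc_of% eHomWhiskerLeft_tensL, eHom_whisker_exchange, eHom_whisker_exchange_assoc]

/-- After transposition each side applies the hom object of `X` to the outer tensor factor, followed
by evaluations; `tensR_exchange` and the naturality of the associator in that factor identify them.
-/
theorem rassoc_natural_left (X' X Y Z : A) :
    rhomFst V X' X Z ≫ rhomSnd V Y _ _ ≫ eHomWhiskerLeft V _ (rassoc V X' Y Z) =
      tensR V X' X Y ≫ rhomFst V (X' ⊗ Y) (X ⊗ Y) Z ≫ eHomWhiskerRight V (rassoc V X Y Z) _ := by
  apply rhom_elt_ext
  simp only [Category.assoc, eHomWhiskerLeft_rassoc_rev, reassoc_of% rhomSnd_rev,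
    reassoc_of% rhomFst_rev,
    reassoc_of% eHomWhiskerRight_tensL, ← eHom_whisker_exchange, ← eHom_whisker_exchange_assoc]
  conv_rhs => rw [eHom_whisker_exchange, ← reassoc_of% tensR_exchange, ← eHomWhiskerLeft_comp,
    rassoc_rev, eHomWhiskerLeft_comp, reassoc_of% tensR_tensR, eHomWhiskerLeft_comp]
  rw [eHom_whisker_exchange_assoc, ← reassoc_of% tensR_exchange, eHom_whisker_exchange,
    eHom_whisker_exchange_assoc]

theorem ract_natural_right (B X Y Y' : A) :
    rhomSnd V X Y Y' ≫ eHomWhiskerLeft V _ (ract V B X Y') =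
      tensL V B Y Y' ≫ rhomSnd V (B ⊗ X) _ _ ≫ eHomWhiskerRight V (ract V B X Y) _ := by
  apply rhom_elt_ext
  simp only [Category.assoc, eHomWhiskerLeft_ract_rev, reassoc_of% rhomSnd_rev,
    reassoc_of% eHomWhiskerRight_tensL, ← eHom_whisker_exchange,
    ← eHomWhiskerRight_comp, ract_rev]

theorem ract_natural_left (B X' X Y : A) :
    rhomFst V X' X Y ≫ eHomWhiskerLeft V _ (ract V B X' Y) =
      tensL V B X' X ≫ rhomFst V (B ⊗ X') (B ⊗ X) _ ≫ eHomWhiskerRight V (ract V B X Y) _ := by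
  apply rhom_elt_ext
  simp only [Category.assoc, eHomWhiskerLeft_ract_rev, reassoc_of% rhomFst_rev,
    reassoc_of% eHomWhiskerRight_tensL, ← eHom_whisker_exchange]
  conv_rhs => rw [eHom_whisker_exchange, ← reassoc_of% tensR_exchange, ← eHomWhiskerLeft_comp,
    ract_rev, eHomWhiskerLeft_comp, reassoc_of% tensL_tensR]
  rw [reassoc_of% eHomWhiskerLeft_tensL, eHom_whisker_exchange]

/-- Transposed, both sides move `B` to `B'` beside `e_r : X ⊗ Y^X ⟶ Y`, once after the evaluation
and once before it. The interchange law `tensR_exchange` says that the order is immaterial. -/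
theorem ract_extranatural (B B' X Y : A) :
    tensR V B B' Y ≫ rhomSnd V (B ⊗ X) (B ⊗ Y) (B' ⊗ Y) ≫ eHomWhiskerRight V (ract V B X Y) _ =
      tensR V B B' X ≫ rhomFst V (B ⊗ X) (B' ⊗ X) (B' ⊗ Y) ≫
        eHomWhiskerRight V (ract V B' X Y) _ := by
  apply rhom_elt_ext
  simp only [Category.assoc, reassoc_of% rhomFst_rev, reassoc_of% rhomSnd_rev,
    reassoc_of% eHomWhiskerRight_tensL, ← eHom_whisker_exchange]
  conv_rhs => rw [eHom_whisker_exchange, ← reassoc_of% tensR_exchange, ← eHomWhiskerLeft_comp,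
    ract_rev, eHomWhiskerLeft_comp, reassoc_of% tensR_tensR]
  rw [← eHomWhiskerRight_comp, ract_rev, eHomWhiskerRight_comp, ← reassoc_of% tensR_exchange,
    eHom_whisker_exchange]

theorem lact_natural_right (B X Y Y' : A) :
    rhomSnd V X Y Y' ≫ eHomWhiskerLeft V _ (lact V B X Y') =
      tensR V Y Y' B ≫ rhomSnd V X _ _ ≫ lhomSnd V B _ _ ≫ eHomWhiskerRight V (lact V B X Y) _ := by
  apply lhom_elt_ext
  apply rhom_elt_ext
  simp only [Category.assoc, eHomWhiskerLeft_lact_lev, reassoc_of% rhomSnd_rev,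
    reassoc_of% lhomSnd_lev, reassoc_of% eHomWhiskerRight_tensR,
    reassoc_of% eHomWhiskerRight_tensL, ← eHom_whisker_exchange, ← eHom_whisker_exchange_assoc]
  simp only [← eHomWhiskerRight_comp, lact_lev_rev, Category.assoc]

theorem lact_natural_left (B X' X Y : A) :
    rhomFst V X' X Y ≫ eHomWhiskerLeft V _ (lact V B X' Y) =
      rhomFst V X' X _ ≫ lhomSnd V B _ _ ≫ eHomWhiskerRight V (lact V B X Y) _ := by
  apply lhom_elt_ext
  apply rhom_elt_ext
  simp only [Category.assoc, eHomWhiskerLeft_lact_lev, reassoc_of% rhomFst_rev,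
    reassoc_of% lhomSnd_lev, reassoc_of% eHomWhiskerRight_tensR,
    reassoc_of% eHomWhiskerRight_tensL, ← eHom_whisker_exchange, ← eHom_whisker_exchange_assoc]
  conv_rhs => rw [← eHomWhiskerRight_comp, eHom_whisker_exchange,
    ← MonoidalCategory.whiskerLeft_comp, ← reassoc_of% tensR_exchange, ← eHomWhiskerLeft_comp,
    lact_lev, rcurry_rev, eHomWhiskerLeft_comp, ← reassoc_of% tensR_tensR_inv]
  rw [reassoc_of% eHomWhiskerLeft_tensR, eHom_whisker_exchange]

/-- The parameter `B` occurs in `Y ⊗ B` and as the exponent of the left internal hom. Two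
transpositions turn the latter into a tensor factor, and interchange with `e_r` on the left applies.
-/
theorem lact_extranatural (B B' X Y : A) :
    tensL V Y B B' ≫ rhomSnd V X _ _ ≫ lhomSnd V B _ _ ≫ eHomWhiskerRight V (lact V B X Y) _ =
      lhomFst V B B' (rhom V X (Y ⊗ B')) ≫ eHomWhiskerRight V (lact V B' X Y) _ := by
  apply lhom_elt_ext
  apply rhom_elt_ext
  simp only [Category.assoc, reassoc_of% rhomSnd_rev,
    reassoc_of% lhomSnd_lev, reassoc_of% lhomFst_lev, reassoc_of% eHomWhiskerRight_tensR,
    reassoc_of% eHomWhiskerRight_tensL, ← eHom_whisker_exchange, ← eHom_whisker_exchange_assoc]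
  rw [← eHomWhiskerRight_comp, ← eHomWhiskerRight_comp, Category.assoc, lact_lev_rev]
  conv_rhs => rw [eHom_whisker_exchange, ← reassoc_of% eHomWhiskerRight_tensL,
    eHom_whisker_exchange_assoc, ← reassoc_of% tensL_exchange, ← eHomWhiskerLeft_comp_assoc,
    lact_lev,
    reassoc_of% eHomWhiskerLeft_tensL, ← eHomWhiskerLeft_comp, rcurry_rev, eHomWhiskerLeft_comp,
    reassoc_of% tensL_tensL_inv, ← eHom_whisker_exchange, reassoc_of% tensL_exchange]
  rw [eHomWhiskerRight_comp]

theorem runit_natural (Y Y' : A) :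
    rhomSnd V (𝟙_ A) Y Y' ≫ eHomWhiskerLeft V _ (runit V Y') =
      eHomWhiskerRight V (runit V Y) _ := by
  rw [runit, runit, eHomWhiskerLeft_comp, eHomWhiskerRight_comp, eHomWhiskerLeft_leftUnitor_inv,
    Category.assoc, ← eHom_whisker_exchange, reassoc_of% rhomSnd_rev]

end ClosedConstants

end Tambara

namespace Tambara

/-! ### Coherence identities between the canonical morphisms. -/

section ClosedIdentities

variable (V : Type u) [Category.{w} V] [MonoidalCategory V] [SymmetricCategory V]
variable {A : Type u₁} [Category.{u₂} A] [MonoidalCategory A] [EnrichedOrdinaryCategory V A]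
  [MonoidalVCategory V A] [ClosedVCategory V A]

theorem lrswap_lev_rev (X Y Z : A) :
    X ◁ lrswap V X Y Z ▷ Y ≫ X ◁ lev V Y (rhom V X Z) ≫ rev V X Z =
      (α_ X _ Y).inv ≫ (rev V X (lhom V Y Z) ▷ Y) ≫ lev V Y Z := by
  rw [← MonoidalCategory.whiskerLeft_comp_assoc, lrswap_lev, rcurry_rev]

theorem lassoc_lev_lev (X Y Z : A) :
    lassoc V X Y Z ▷ X ▷ Y ≫ lev V X (lhom V Y Z) ▷ Y ≫ lev V Y Z =
      (α_ _ X Y).hom ≫ lev V (X ⊗ Y) Z := by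
  rw [← comp_whiskerRight_assoc, lassoc_lev, lcurry_lev]

theorem rpost_comp (X : A) {Y Z W : A} (f : Y ⟶ Z) (g : Z ⟶ W) :
    rpost V X (f ≫ g) = rpost V X f ≫ rpost V X g := by
  apply rhom_hom_ext
  simp

theorem lpost_comp (X : A) {Y Z W : A} (f : Y ⟶ Z) (g : Z ⟶ W) :
    lpost V X (f ≫ g) = lpost V X f ≫ lpost V X g := by
  apply lhom_hom_ext
  simp

@[simp]
theorem rpost_id (X Y : A) : rpost V X (𝟙 Y) = 𝟙 _ := by
  apply rhom_hom_ext
  simp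

@[simp]
theorem lpost_id (X Y : A) : lpost V X (𝟙 Y) = 𝟙 _ := by
  apply lhom_hom_ext
  simp

theorem ract_unit (X Y : A) :
    ract V (𝟙_ A) X Y ≫ rpre V (λ_ X).inv _ ≫ rpost V X (λ_ Y).hom = 𝟙 _ := by
  apply rhom_hom_ext
  simp only [MonoidalCategory.whiskerLeft_comp, Category.assoc, rpost_rev, rpre_rev_assoc,
    whisker_exchange_assoc, ract_rev_assoc]
  simp

/-- Both sides transpose to `e_r` tensored on the left with `B` and `B'`, up to associators.
Applying a `V`-functor `F` gives the tensor law for the left action of `T_F`. -/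
theorem ract_tensor (B B' X Y : A) :
    ract V (B ⊗ B') X Y = ract V B' X Y ≫ ract V B (B' ⊗ X) (B' ⊗ Y) ≫
      rpre V (α_ B B' X).hom _ ≫ rpost V _ (α_ B B' Y).inv := by
  apply rhom_hom_ext
  simp only [MonoidalCategory.whiskerLeft_comp, Category.assoc, rpost_rev, rpre_rev_assoc,
    whisker_exchange_assoc, ract_rev_assoc, ract_rev, associator_naturality_right_assoc]
  simp only [← MonoidalCategory.whiskerLeft_comp_assoc, ract_rev]
  simp

theorem rassoc_unit (X Z : A) :
    rassoc V X (𝟙_ A) Z ≫ rpre V (ρ_ X).inv Z = runit V (rhom V X Z) := by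
  apply rhom_hom_ext
  simp only [MonoidalCategory.whiskerLeft_comp, Category.assoc, rpre_rev,
    whisker_exchange_assoc, rassoc_rev, runit]
  simp

theorem lact_unit (X Y : A) :
    lact V (𝟙_ A) X Y ≫ lunit V _ ≫ rpost V X (ρ_ Y).hom = 𝟙 _ := by
  apply rhom_hom_ext
  simp only [MonoidalCategory.whiskerLeft_comp, Category.assoc, rpost_rev, lunit]
  rw [← MonoidalCategory.whiskerLeft_comp_assoc, rightUnitor_inv_naturality,
    MonoidalCategory.whiskerLeft_comp_assoc, reassoc_of% lact_lev_rev]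
  simp

/-- Both sides transpose to the two evaluations, at `B` and at `X`, tensored with `B'`. It brings a
second right action inside the exponent `B`, where `θ` can be slid past it. -/
theorem rassoc_lact (X B B' Y : A) :
    rassoc V X B Y ≫ lact V B' (X ⊗ B) Y =
      rpost V B (lact V B' X Y) ≫ lrswap V B B' (rhom V X (Y ⊗ B')) ≫
        lpost V B' (rassoc V X B (Y ⊗ B')) := by
  apply lhom_hom_ext
  apply rhom_hom_ext
  simp only [MonoidalCategory.whiskerLeft_comp, Category.assoc, comp_whiskerRight, lact_lev_rev,
    lpost_lev, rassoc_rev]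
  conv_lhs => rw [associator_inv_naturality_middle_assoc, ← comp_whiskerRight, rassoc_rev]
  conv_rhs => rw [← MonoidalCategory.whiskerLeft_comp_assoc,
    ← MonoidalCategory.whiskerLeft_comp_assoc]
  -- The inner evaluation at `B` on the right-hand side: the swap disappears and `lact` comes to
  -- stand after `e_r`.
  have e : B ◁ (rpost V B (lact V B' X Y) ▷ B' ≫ lrswap V B B' (rhom V X (Y ⊗ B')) ▷ B' ≫
      lev V B' _) ≫ rev V B _ = (α_ _ _ _).inv ≫ rev V B _ ▷ B' ≫ lact V B' X Y ▷ B' ≫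
        lev V B' _ := by
    rw [MonoidalCategory.whiskerLeft_comp, MonoidalCategory.whiskerLeft_comp, Category.assoc,
      Category.assoc, lrswap_lev_rev, associator_inv_naturality_middle_assoc,
      ← comp_whiskerRight_assoc, rpost_rev, comp_whiskerRight_assoc]
  conv_rhs => rw [associator_naturality_right_assoc, ← MonoidalCategory.whiskerLeft_comp_assoc,
    Category.assoc, e]
  simp only [MonoidalCategory.whiskerLeft_comp, Category.assoc, lact_lev_rev, comp_whiskerRight,
    associator_inv_naturality_middle_assoc]
  simp

theorem rassoc_rassoc (X B B' W : A) :
    rpost V B' (rassoc V X B W) ≫ rassoc V (X ⊗ B) B' W ≫ rpre V (α_ X B B').inv W =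
      rassoc V B B' (rhom V X W) ≫ rassoc V X (B ⊗ B') W := by
  apply rhom_hom_ext
  simp only [MonoidalCategory.whiskerLeft_comp, Category.assoc, rpre_rev, whisker_exchange_assoc,
    rassoc_rev, associator_naturality_right_assoc]
  simp only [← MonoidalCategory.whiskerLeft_comp_assoc, rassoc_rev, rpost_rev]
  simp only [MonoidalCategory.whiskerLeft_comp, Category.assoc,
    rassoc_rev, associator_naturality_right_assoc]
  simp

/-- Tensoring on the right with `B` and then `B'` agrees with tensoring with `B ⊗ B'`: all three
nested internal homs transpose to `e_r` tensored with `B ⊗ B'`, up to associators. -/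
theorem lact_lact (B B' X Y : A) :
    lact V B X Y ≫ lpost V B (lact V B' X (Y ⊗ B)) =
      lact V (B ⊗ B') X Y ≫ lpost V (B ⊗ B') (rpost V X (α_ Y B B').inv) ≫
        lassoc V B B' (rhom V X ((Y ⊗ B) ⊗ B')) := by
  apply lhom_hom_ext
  apply lhom_hom_ext
  apply rhom_hom_ext
  simp only [MonoidalCategory.whiskerLeft_comp, Category.assoc, comp_whiskerRight, lact_lev_rev,
    lpost_lev]
  -- On the left-hand side the outer tensoring with `B'` is already transposed; this transposes the
  -- inner one.
  have e1 : X ◁ lact V B X Y ▷ B ▷ B' ≫ X ◁ lev V B (rhom V X (Y ⊗ B)) ▷ B' ≫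
      (α_ X (rhom V X (Y ⊗ B)) B').inv ≫ rev V X (Y ⊗ B) ▷ B' =
      X ◁ (α_ _ B B').hom ≫ (α_ X _ (B ⊗ B')).inv ≫ rev V X Y ▷ (B ⊗ B') ≫ (α_ Y B B').inv := by
    rw [associator_inv_naturality_middle_assoc, associator_inv_naturality_middle_assoc,
      ← comp_whiskerRight, ← comp_whiskerRight, lact_lev_rev]
    simp
  -- On the right-hand side the two evaluations after `lassoc` merge into one at `B ⊗ B'`, and the
  -- associator of `Y` moves outside.
  have e2 : X ◁ lpost V (B ⊗ B') (rpost V X (α_ Y B B').inv) ▷ B ▷ B' ≫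
      X ◁ lassoc V B B' (rhom V X ((Y ⊗ B) ⊗ B')) ▷ B ▷ B' ≫
        X ◁ lev V B (lhom V B' (rhom V X ((Y ⊗ B) ⊗ B'))) ▷ B' ≫
          X ◁ lev V B' (rhom V X ((Y ⊗ B) ⊗ B')) ≫ rev V X ((Y ⊗ B) ⊗ B') =
      X ◁ (α_ _ B B').hom ≫ X ◁ lev V (B ⊗ B') (rhom V X (Y ⊗ (B ⊗ B'))) ≫ rev V X _ ≫
        (α_ Y B B').inv := by
    rw [← rpost_rev, ← MonoidalCategory.whiskerLeft_comp_assoc X (lev V (B ⊗ B') _), ← lpost_lev]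
    simp only [← MonoidalCategory.whiskerLeft_comp_assoc]
    rw [lassoc_lev_lev, associator_naturality_left_assoc]
  rw [e1, e2, ← MonoidalCategory.whiskerLeft_comp_assoc, associator_naturality_left,
    MonoidalCategory.whiskerLeft_comp_assoc, reassoc_of% lact_lev_rev]

/-- Tensoring on the left and on the right commute up to an associator. With `ract_rassoc`, this is
the part of the bimodule axiom of `T_F` that does not involve `θ`. -/
theorem ract_lact (B B' X Y : A) :
    ract V B X Y ≫ lact V B' (B ⊗ X) (B ⊗ Y) =
      lact V B' X Y ≫ lpost V B' (ract V B X (Y ⊗ B') ≫ rpost V (B ⊗ X) (α_ B Y B').inv) := by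
  apply lhom_hom_ext
  apply rhom_hom_ext
  simp only [MonoidalCategory.whiskerLeft_comp, Category.assoc, comp_whiskerRight, lact_lev_rev,
    lpost_lev]
  rw [associator_inv_naturality_middle_assoc, ← comp_whiskerRight, ract_rev,
    ← MonoidalCategory.whiskerLeft_comp_assoc, rpost_rev, ract_rev_assoc,
    associator_naturality_right_assoc]
  simp only [← MonoidalCategory.whiskerLeft_comp_assoc]
  simp

theorem ract_rassoc (B B' X Y : A) :
    rpost V B' (ract V B X (Y ⊗ B') ≫ rpost V (B ⊗ X) (α_ B Y B').inv) ≫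
        rassoc V (B ⊗ X) B' ((B ⊗ Y) ⊗ B') =
      rassoc V X B' (Y ⊗ B') ≫ ract V B (X ⊗ B') (Y ⊗ B') ≫
        rpre V (α_ B X B').hom _ ≫ rpost V _ (α_ B Y B').inv := by
  apply rhom_hom_ext
  simp only [MonoidalCategory.whiskerLeft_comp, Category.assoc, rpost_rev, rpre_rev_assoc,
    whisker_exchange_assoc, ract_rev_assoc, rassoc_rev, associator_naturality_right_assoc]
  simp only [← MonoidalCategory.whiskerLeft_comp_assoc,
    rpost_rev, rassoc_rev]
  rw [MonoidalCategory.whiskerLeft_comp, MonoidalCategory.whiskerLeft_comp, Category.assoc,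
    Category.assoc, rpost_rev, ract_rev_assoc, associator_naturality_right_assoc]
  simp

/-- A triangle identity: evaluating after tensoring undoes the coevaluation and leaves `rassoc`.
This computes `β_l` of `T_F`; `lact_rpost_lev` plays the same role for `β_r`. -/
theorem ract_rpost_rev (B X Y : A) :
    ract V B X (rhom V B Y) ≫ rpost V (B ⊗ X) (rev V B Y) = rassoc V B X Y := by
  apply rhom_hom_ext
  simp only [MonoidalCategory.whiskerLeft_comp, Category.assoc, rpost_rev, ract_rev_assoc,
    rassoc_rev]

theorem lact_rpost_lev (B X Y : A) :
    lact V B X (lhom V B Y) ≫ lpost V B (rpost V X (lev V B Y)) = lrswap V X B Y := by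
  apply lhom_hom_ext
  apply rhom_hom_ext
  simp only [MonoidalCategory.whiskerLeft_comp, Category.assoc, comp_whiskerRight,
    reassoc_of% lact_lev_rev,
    lpost_lev, rpost_rev, lrswap_lev_rev]

theorem rassoc_rpost (X Y : A) {Z Z' : A} (f : Z ⟶ Z') :
    rassoc V X Y Z ≫ rpost V (X ⊗ Y) f = rpost V Y (rpost V X f) ≫ rassoc V X Y Z' := by
  apply rhom_hom_ext
  simp only [MonoidalCategory.whiskerLeft_comp, Category.assoc, rpost_rev, rassoc_rev_assoc,
    rassoc_rev, associator_naturality_right_assoc, ← MonoidalCategory.whiskerLeft_comp_assoc,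
    rpost_rev]

theorem rpre_id (X Y : A) : rpre V (𝟙 X) Y = 𝟙 _ := by
  apply rhom_hom_ext
  simp

instance (X Y Z : A) : IsIso (rassoc V X Y Z) :=
  ⟨rcurry V (rcurry V ((α_ X Y _).inv ≫ rev V (X ⊗ Y) Z)), by
    apply rhom_hom_ext
    rw [MonoidalCategory.whiskerLeft_comp, Category.assoc, rcurry_rev]
    apply rhom_hom_ext
    rw [MonoidalCategory.whiskerLeft_comp, Category.assoc, rcurry_rev,
      associator_inv_naturality_right_assoc, rassoc_rev]
    simp, by
    apply rhom_hom_ext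
    rw [MonoidalCategory.whiskerLeft_comp_assoc, rassoc_rev, associator_naturality_right_assoc,
      ← MonoidalCategory.whiskerLeft_comp_assoc, rcurry_rev, rcurry_rev]
    simp⟩

instance (X Y Z : A) : IsIso (lrswap V X Y Z) := by
  refine ⟨rcurry V (lcurry V ((α_ X _ Y).hom ≫ X ◁ lev V Y (rhom V X Z) ≫ rev V X Z)), ?_, ?_⟩
  · apply rhom_hom_ext
    apply lhom_hom_ext
    rw [MonoidalCategory.whiskerLeft_comp_assoc, rcurry_rev, comp_whiskerRight_assoc, lcurry_lev,
      associator_naturality_middle_assoc, lrswap_lev_rev]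
    simp
  · apply lhom_hom_ext
    apply rhom_hom_ext
    rw [comp_whiskerRight_assoc, MonoidalCategory.whiskerLeft_comp_assoc,
      MonoidalCategory.whiskerLeft_comp_assoc, lrswap_lev_rev,
      associator_inv_naturality_middle_assoc, ← comp_whiskerRight_assoc, rcurry_rev, lcurry_lev]
    simp

instance (Y : A) : IsIso (runit V Y) := by
  refine ⟨rcurry V (λ_ Y).hom, ?_, ?_⟩
  · apply rhom_hom_ext
    rw [MonoidalCategory.whiskerLeft_comp_assoc, rcurry_rev, runit]
    simp
  · rw [runit, leftUnitor_inv_naturality_assoc, rcurry_rev, Iso.inv_hom_id]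

end ClosedIdentities

end Tambara

namespace Tambara

section

variable {V : Type u} [Category.{w} V] [MonoidalCategory V] [BraidedCategory V]
variable {C : Type u₁} [EnrichedCategory V C] {D : Type u₂} [EnrichedCategory V D]
  {E : Type u₃} [EnrichedCategory V E] {E' : Type*} [EnrichedCategory V E']

theorem mapSnd_functor_comp (M : EnrichedFunctor V (TProd C D) E) (F : EnrichedFunctor V E E')
    (X : C) (B B' : D) :
    mapSnd (M.comp V F) X B B' = mapSnd M X B B' ≫ F.map (M.obj ⟨X, B⟩) (M.obj ⟨X, B'⟩) := by
  rw [mapSnd, mapSnd, Category.assoc, Category.assoc]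
  rfl

theorem mapFst_functor_comp (M : EnrichedFunctor V (TProd C D) E) (F : EnrichedFunctor V E E')
    (X X' : C) (B : D) :
    mapFst (M.comp V F) X X' B = mapFst M X X' B ≫ F.map (M.obj ⟨X, B⟩) (M.obj ⟨X', B⟩) := by
  rw [mapFst, mapFst, Category.assoc, Category.assoc]
  rfl

end

/-! ### The Cayley image of a lax half-braiding is a left strong Tambara module. -/

section CayleyImage

attribute [local instance] MonoidalClosed.enrichedOrdinaryCategorySelf

variable {V : Type u} [Category.{w} V] [MonoidalCategory V] [SymmetricCategory V]
  [MonoidalClosed V]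

section

variable {A : Type u₁} [Category.{u₂} A] [EnrichedOrdinaryCategory V A]
  (F : EnrichedFunctor V A V)

@[simp]
theorem mapHom_id (X : A) : mapHom F (𝟙 X) = 𝟙 (F.obj X) := onHom_id F X

theorem mapHom_comp {X Y Z : A} (f : X ⟶ Y) (g : Y ⟶ Z) :
    mapHom F (f ≫ g) = mapHom F f ≫ mapHom F g := onHom_comp F f g

theorem eHomEquiv_mapHom {X Y : A} (f : X ⟶ Y) :
    eHomEquiv V (mapHom F f) = eHomEquiv V f ≫ F.map X Y := eHomEquiv_onHom F f

instance mapHom_isIso {X Y : A} (f : X ⟶ Y) [IsIso f] : IsIso (mapHom F f) := onHom_isIso F f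

theorem map_eHomWhiskerLeft_mapHom (X : A) {Y Z : A} (g : Y ⟶ Z) :
    F.map X Y ≫ eHomWhiskerLeft V _ (mapHom F g) = eHomWhiskerLeft V X g ≫ F.map X Z :=
  (eHomWhiskerLeft_map F X g).symm

theorem eHomWhiskerRight_map_mapHom {X Y : A} (f : X ⟶ Y) (Z : A) :
    eHomWhiskerRight V f Z ≫ F.map X Z = F.map Y Z ≫ eHomWhiskerRight V (mapHom F f) _ :=
  eHomWhiskerRight_map F f Z

end

variable {A : Type w} [Category.{u₂} A] [MonoidalCategory A] [EnrichedOrdinaryCategory V A]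
  [MonoidalVCategory V A] [ClosedVCategory V A]

theorem modR_rhomFunctor_comp (F : EnrichedFunctor V A V) (X Y Y' : A) :
    modR ((rhomFunctor V).comp V F) X Y Y' = rhomSnd V X Y Y' ≫ F.map _ _ :=
  mapSnd_functor_comp (rhomFunctor V) F (op X) Y Y'

theorem modL_rhomFunctor_comp (F : EnrichedFunctor V A V) (X' X Y : A) :
    modL ((rhomFunctor V).comp V F) X' X Y = rhomFst V X' X Y ≫ F.map _ _ :=
  mapFst_functor_comp (rhomFunctor V) F (op X) (op X') Y

theorem onPair_rhomFunctor {X X' Y Y' : A} (f : X' ⟶ X) (g : Y ⟶ Y') :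
    onPair (rhomFunctor V) f.op g = rpre V f Y ≫ rpost V X' g :=
  (onPair_eq (rhomFunctor V) f.op g).trans
    (congrArg₂ (fun (a : rhom V X Y ⟶ rhom V X' Y) (b : rhom V X' Y ⟶ rhom V X' Y') => a ≫ b)
      (onFst_rhomFunctor V f Y) (onSnd_rhomFunctor V X' g))

theorem modMap_rhomFunctor_comp (F : EnrichedFunctor V A V) {X X' Y Y' : A} (f : X' ⟶ X)
    (g : Y ⟶ Y') :
    modMap ((rhomFunctor V).comp V F) f g = mapHom F (rpre V f Y ≫ rpost V X' g) := by
  rw [← onPair_rhomFunctor]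
  -- Both sides have the same name `𝟙_ V ⟶ [-, -]` up to the bracketing of composites.
  refine congrArg (eHomEquiv V).symm ?_
  refine Eq.trans ?_ (congrArg (· ≫ F.map _ _) ((eHomEquiv V).apply_symm_apply _).symm)
  refine Eq.trans ?_ (Category.assoc _ _ _).symm
  exact congrArg (_ ≫ ·) (Category.assoc _ _ _).symm

namespace HalfBraidingData

variable (P : HalfBraidingData V A)

/-- The morphism `α_r` of the Tambara module `T_F`. -/
def rightAct (B X Y : A) :
    P.functor.obj (rhom V X Y) ⟶ P.functor.obj (rhom V (X ⊗ B) (Y ⊗ B)) :=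
  mapHom P.functor (lact V B X Y) ≫ P.θ B (rhom V X (Y ⊗ B)) ≫
    mapHom P.functor (rassoc V X B (Y ⊗ B))

namespace IsLaxCentral

variable {P}

theorem natural_right (hP : P.IsLaxCentral) (X Y Y' : A) :
    lhomSnd V X Y Y' ≫ P.functor.map _ _ ≫ eHomWhiskerLeft V _ (P.θ X Y') =
      rhomSnd V X Y Y' ≫ P.functor.map _ _ ≫ eHomWhiskerRight V (P.θ X Y) _ := by
  have h := IsVNatural.mapSnd (M := (lhomFunctor V).comp V P.functor)
    (N := (rhomFunctor V).comp V P.functor) (t := fun X Y => P.θ X.unop Y) hP.natural (op X) Y Y'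
  have e := mapSnd_functor_comp (lhomFunctor V) P.functor (op X) Y Y'
  have e' := mapSnd_functor_comp (rhomFunctor V) P.functor (op X) Y Y'
  rw [← Category.assoc, ← Category.assoc]
  exact (congrArg (· ≫ _) e).symm.trans (h.trans (congrArg (· ≫ _) e'))

theorem natural_left (hP : P.IsLaxCentral) (X' X Y : A) :
    lhomFst V X' X Y ≫ P.functor.map _ _ ≫ eHomWhiskerLeft V _ (P.θ X' Y) =
      rhomFst V X' X Y ≫ P.functor.map _ _ ≫ eHomWhiskerRight V (P.θ X Y) _ := by
  have h := IsVNatural.mapFst (M := (lhomFunctor V).comp V P.functor)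
    (N := (rhomFunctor V).comp V P.functor) (t := fun X Y => P.θ X.unop Y) hP.natural
    (op X) (op X') Y
  have e := mapFst_functor_comp (lhomFunctor V) P.functor (op X) (op X') Y
  have e' := mapFst_functor_comp (rhomFunctor V) P.functor (op X) (op X') Y
  rw [← Category.assoc, ← Category.assoc]
  exact (congrArg (· ≫ _) e).symm.trans (h.trans (congrArg (· ≫ _) e'))

theorem θ_natural (hP : P.IsLaxCentral) (X : A) {Y Y' : A} (f : Y ⟶ Y') :
    mapHom P.functor (lpost V X f) ≫ P.θ X Y' = P.θ X Y ≫ mapHom P.functor (rpost V X f) := by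
  apply (eHomEquiv V).injective
  rw [← eHomEquiv_eHomWhiskerLeft, ← eHomEquiv_eHomWhiskerRight, eHomEquiv_mapHom,
    eHomEquiv_mapHom, ← eHomEquiv_lhomSnd, ← eHomEquiv_rhomSnd]
  simp only [Category.assoc, hP.natural_right]

theorem rightAct_natural_right (hP : P.IsLaxCentral) (B X Y Y' : A) :
    (rhomSnd V X Y Y' ≫ P.functor.map _ _) ≫ eHomWhiskerLeft V _ (P.rightAct B X Y') =
      tensR V Y Y' B ≫ (rhomSnd V (X ⊗ B) _ _ ≫ P.functor.map _ _) ≫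
        eHomWhiskerRight V (P.rightAct B X Y) _ := by
  simp only [rightAct, eHomWhiskerLeft_comp, eHomWhiskerRight_comp, Category.assoc,
    reassoc_of% lact_natural_right, reassoc_of% eHomWhiskerRight_map_mapHom,
    ← eHom_whisker_exchange, ← eHom_whisker_exchange_assoc, reassoc_of% (natural_right hP),
    reassoc_of% map_eHomWhiskerLeft_mapHom, reassoc_of% rassoc_natural_right]

/-- In `θ_{B, (Y ⊗ B)^X}` the variable `X` sits inside the second argument, so naturality of `θ` in
that argument suffices; `lact` and `rassoc` are natural in `X` already in `A`. -/
theorem rightAct_natural_left (hP : P.IsLaxCentral) (B X' X Y : A) :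
    (rhomFst V X' X Y ≫ P.functor.map _ _) ≫ eHomWhiskerLeft V _ (P.rightAct B X' Y) =
      tensR V X' X B ≫ (rhomFst V (X' ⊗ B) (X ⊗ B) (Y ⊗ B) ≫ P.functor.map _ _) ≫
        eHomWhiskerRight V (P.rightAct B X Y) _ := by
  simp only [rightAct, eHomWhiskerLeft_comp, eHomWhiskerRight_comp, Category.assoc,
    reassoc_of% lact_natural_left, reassoc_of% eHomWhiskerRight_map_mapHom,
    ← eHom_whisker_exchange, ← eHom_whisker_exchange_assoc, reassoc_of% (natural_right hP),
    reassoc_of% map_eHomWhiskerLeft_mapHom, reassoc_of% rassoc_natural_left]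

/-- `B` occurs both as the exponent of `θ` and in `Y ⊗ B`. The left-hand side crosses `θ` by
naturality in the second argument, the right-hand side by naturality in the first, and what is left
is `lact_extranatural` under `F`. -/
theorem rightAct_extranatural (hP : P.IsLaxCentral) (B B' X Y : A) :
    tensL V Y B B' ≫ (rhomSnd V (X ⊗ B) _ _ ≫ P.functor.map _ _) ≫
        eHomWhiskerRight V (P.rightAct B X Y) _ =
      tensL V X B B' ≫ (rhomFst V (X ⊗ B) (X ⊗ B') (Y ⊗ B') ≫ P.functor.map _ _) ≫
        eHomWhiskerRight V (P.rightAct B' X Y) _ := by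
  have h : tensL V Y B B' ≫ rhomSnd V (X ⊗ B) _ _ ≫
      eHomWhiskerRight V (rassoc V X B (Y ⊗ B)) _ = _ :=
    congrArg (_ ≫ ·) (rassoc_natural_right V X B (Y ⊗ B) (Y ⊗ B')).symm
  have h' := (reassoc_of% lact_extranatural V B B' X Y) (P.functor.map _ _ ≫
    eHomWhiskerLeft V _ (P.θ B (rhom V X (Y ⊗ B'))) ≫
      eHomWhiskerLeft V _ (mapHom P.functor (rassoc V X B (Y ⊗ B'))))
  simp only [rightAct, eHomWhiskerRight_comp, Category.assoc,
    ← reassoc_of% eHomWhiskerRight_map_mapHom, reassoc_of% h, ← reassoc_of% rassoc_natural_middle]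
  simp only [reassoc_of% eHomWhiskerRight_map_mapHom,
    ← eHom_whisker_exchange, ← eHom_whisker_exchange_assoc, reassoc_of% (natural_right hP),
    reassoc_of% (natural_left hP),
    reassoc_of% map_eHomWhiskerLeft_mapHom] at h' ⊢
  exact h'

theorem rightAct_unit (hP : P.IsLaxCentral) (X Y : A) :
    P.rightAct (𝟙_ A) X Y ≫ mapHom P.functor (rpre V (ρ_ X).inv _ ≫ rpost V X (ρ_ Y).hom) =
      𝟙 _ := by
  rw [rightAct, mapHom_comp, Category.assoc, Category.assoc, ← reassoc_of% mapHom_comp, rassoc_unit,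
    reassoc_of% hP.unit, ← mapHom_comp, ← mapHom_comp, lact_unit, mapHom_id]

theorem rightAct_tensor (hP : P.IsLaxCentral) (B B' X Y : A) :
    P.rightAct (B ⊗ B') X Y =
      P.rightAct B X Y ≫ P.rightAct B' (X ⊗ B) (Y ⊗ B) ≫
        mapHom P.functor (rpre V (α_ X B B').inv _ ≫ rpost V _ (α_ Y B B').hom) := by
  -- The tensor law of `θ` is needed at `(Y ⊗ B) ⊗ B'`, where the iterated action ends, so `θ` is
  -- conjugated by the associator of `Y`.
  have e : P.θ (B ⊗ B') (rhom V X (Y ⊗ (B ⊗ B'))) =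
      mapHom P.functor (lpost V (B ⊗ B') (rpost V X (α_ Y B B').inv)) ≫
        P.θ (B ⊗ B') (rhom V X ((Y ⊗ B) ⊗ B')) ≫
          mapHom P.functor (rpost V (B ⊗ B') (rpost V X (α_ Y B B').hom)) := by
    rw [← θ_natural hP, ← reassoc_of% mapHom_comp]
    rw [← lpost_comp, ← rpost_comp, Iso.inv_hom_id, rpost_id, lpost_id, mapHom_id,
      Category.id_comp]
  simp only [rightAct, Category.assoc]
  rw [e, hP.tensor]
  simp only [Category.assoc, ← mapHom_comp, ← reassoc_of% mapHom_comp]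
  rw [← lact_lact, rassoc_lact]
  simp only [mapHom_comp, Category.assoc]
  rw [reassoc_of% (θ_natural hP), reassoc_of% (θ_natural hP)]
  simp only [← mapHom_comp, ← reassoc_of% mapHom_comp]
  rw [reassoc_of% rassoc_rassoc, rassoc_rpost]

/-- The left action is the image under `F` of a morphism of `A`, hence slides across `θ` by
naturality. -/
theorem rightAct_bimodule (hP : P.IsLaxCentral) (B B' X Y : A) :
    mapHom P.functor (ract V B X Y) ≫ P.rightAct B' (B ⊗ X) (B ⊗ Y) =
      P.rightAct B' X Y ≫ mapHom P.functor (ract V B (X ⊗ B') (Y ⊗ B')) ≫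
        mapHom P.functor (rpre V (α_ B X B').hom _ ≫ rpost V _ (α_ B Y B').inv) := by
  simp only [rightAct, Category.assoc, ← mapHom_comp, ← reassoc_of% mapHom_comp]
  rw [ract_lact, ← ract_rassoc]
  simp only [mapHom_comp _ (lact V _ _ _), mapHom_comp _ _ (rassoc V _ _ _), Category.assoc]
  rw [reassoc_of% (θ_natural hP)]

end IsLaxCentral

theorem leftAct_natural_right (F : EnrichedFunctor V A V) (B X Y Y' : A) :
    (rhomSnd V X Y Y' ≫ F.map _ _) ≫ eHomWhiskerLeft V _ (mapHom F (ract V B X Y')) =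
      tensL V B Y Y' ≫ (rhomSnd V (B ⊗ X) _ _ ≫ F.map _ _) ≫
        eHomWhiskerRight V (mapHom F (ract V B X Y)) _ := by
  rw [Category.assoc, map_eHomWhiskerLeft_mapHom, reassoc_of% ract_natural_right,
    eHomWhiskerRight_map_mapHom, Category.assoc]

theorem leftAct_natural_left (F : EnrichedFunctor V A V) (B X' X Y : A) :
    (rhomFst V X' X Y ≫ F.map _ _) ≫ eHomWhiskerLeft V _ (mapHom F (ract V B X' Y)) =
      tensL V B X' X ≫ (rhomFst V (B ⊗ X') (B ⊗ X) _ ≫ F.map _ _) ≫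
        eHomWhiskerRight V (mapHom F (ract V B X Y)) _ := by
  rw [Category.assoc, map_eHomWhiskerLeft_mapHom, reassoc_of% ract_natural_left,
    eHomWhiskerRight_map_mapHom, Category.assoc]

theorem leftAct_extranatural (F : EnrichedFunctor V A V) (B B' X Y : A) :
    tensR V B B' Y ≫ (rhomSnd V (B ⊗ X) (B ⊗ Y) (B' ⊗ Y) ≫ F.map _ _) ≫
        eHomWhiskerRight V (mapHom F (ract V B X Y)) _ =
      tensR V B B' X ≫ (rhomFst V (B ⊗ X) (B' ⊗ X) (B' ⊗ Y) ≫ F.map _ _) ≫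
        eHomWhiskerRight V (mapHom F (ract V B' X Y)) _ := by
  rw [Category.assoc, Category.assoc, ← eHomWhiskerRight_map_mapHom, reassoc_of% ract_extranatural,
    eHomWhiskerRight_map_mapHom]

theorem leftAct_unit (F : EnrichedFunctor V A V) (X Y : A) :
    mapHom F (ract V (𝟙_ A) X Y) ≫ mapHom F (rpre V (λ_ X).inv _ ≫ rpost V X (λ_ Y).hom) =
      𝟙 _ := by
  rw [← mapHom_comp, ract_unit, mapHom_id]

theorem leftAct_tensor (F : EnrichedFunctor V A V) (B B' X Y : A) :
    mapHom F (ract V (B ⊗ B') X Y) = mapHom F (ract V B' X Y) ≫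
      mapHom F (ract V B (B' ⊗ X) (B' ⊗ Y)) ≫
        mapHom F (rpre V (α_ B B' X).hom _ ≫ rpost V _ (α_ B B' Y).inv) := by
  rw [← mapHom_comp, ← mapHom_comp, ← ract_tensor]

theorem IsLaxCentral.isTambara_cayleyObj {P : HalfBraidingData V A} (hP : P.IsLaxCentral) :
    (cayleyObj P).IsTambara := by
  -- The actions of `T_F` on homs are those of the internal hom followed by `F`; with these
  -- translations each axiom is one of the preceding lemmas, up to unfolding `cayleyObj`.
  have eR := modR_rhomFunctor_comp P.functor
  have eL := modL_rhomFunctor_comp P.functor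
  have eM : ∀ {X X' Y Y' : A} (f : X' ⟶ X) (g : Y ⟶ Y'), _ := modMap_rhomFunctor_comp P.functor
  exact
  { αl_natural_right := fun B X Y Y' =>
      (congrArg (· ≫ _) (eR X Y Y')).trans ((leftAct_natural_right P.functor B X Y Y').trans
        (congrArg (fun k => _ ≫ k ≫ _) (eR _ _ _)).symm)
    αl_natural_left := fun B X' X Y =>
      (congrArg (· ≫ _) (eL X' X Y)).trans ((leftAct_natural_left P.functor B X' X Y).trans
        (congrArg (fun k => _ ≫ k ≫ _) (eL _ _ _)).symm)
    αl_extranatural := fun B B' X Y =>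
      (congrArg (fun k => _ ≫ k ≫ _) (eR _ _ _)).trans
        ((leftAct_extranatural P.functor B B' X Y).trans
          (congrArg (fun k => _ ≫ k ≫ _) (eL _ _ _)).symm)
    αl_unit := fun X Y => (congrArg (_ ≫ ·) (eM _ _)).trans (leftAct_unit P.functor X Y)
    αl_tensor := fun B B' X Y => (leftAct_tensor P.functor B B' X Y).trans
      (congrArg (fun k => _ ≫ _ ≫ k) (eM _ _)).symm
    αr_natural_right := fun B X Y Y' =>
      (congrArg (· ≫ _) (eR X Y Y')).trans ((hP.rightAct_natural_right B X Y Y').trans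
        (congrArg (fun k => _ ≫ k ≫ _) (eR _ _ _)).symm)
    αr_natural_left := fun B X' X Y =>
      (congrArg (· ≫ _) (eL X' X Y)).trans ((hP.rightAct_natural_left B X' X Y).trans
        (congrArg (fun k => _ ≫ k ≫ _) (eL _ _ _)).symm)
    αr_extranatural := fun B B' X Y =>
      (congrArg (fun k => _ ≫ k ≫ _) (eR _ _ _)).trans
        ((hP.rightAct_extranatural B B' X Y).trans
          (congrArg (fun k => _ ≫ k ≫ _) (eL _ _ _)).symm)
    αr_unit := fun X Y => (congrArg (_ ≫ ·) (eM _ _)).trans (hP.rightAct_unit X Y)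
    αr_tensor := fun B B' X Y => (hP.rightAct_tensor B B' X Y).trans
      (congrArg (fun k => _ ≫ _ ≫ k) (eM _ _)).symm
    bimodule := fun B B' X Y => (hP.rightAct_bimodule B B' X Y).trans
      (congrArg (fun k => _ ≫ _ ≫ k) (eM _ _)).symm }

theorem βl_cayleyObj (P : HalfBraidingData V A) (B X Y : A) :
    (cayleyObj P).βl B X Y = mapHom P.functor (rassoc V B X Y) := by
  have e : mapHom P.functor (ract V B X (rhom V B Y)) ≫
      mapHom P.functor (rpre V (𝟙 (B ⊗ X)) _ ≫ rpost V _ (rev V B Y)) =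
        mapHom P.functor (rassoc V B X Y) := by
    rw [rpre_id, Category.id_comp, ← mapHom_comp, ract_rpost_rev]
  exact (congrArg (_ ≫ ·) (modMap_rhomFunctor_comp P.functor _ _)).trans e

/-- Naturality moves `e_l` to the front of `θ`, where it cancels the coevaluation in `lact`. As
`lrswap` and `rassoc` are invertible, invertibility of `θ` gives right strength. -/
theorem IsLaxCentral.βr_cayleyObj {P : HalfBraidingData V A} (hP : P.IsLaxCentral) (B X Y : A) :
    (cayleyObj P).βr B X Y = mapHom P.functor (lrswap V X B Y) ≫ P.θ B (rhom V X Y) ≫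
      mapHom P.functor (rassoc V X B Y) := by
  have e : P.rightAct B X (lhom V B Y) ≫
      mapHom P.functor (rpre V (𝟙 (X ⊗ B)) _ ≫ rpost V _ (lev V B Y)) =
        mapHom P.functor (lrswap V X B Y) ≫ P.θ B (rhom V X Y) ≫
          mapHom P.functor (rassoc V X B Y) := by
    rw [rpre_id, Category.id_comp, rightAct, Category.assoc, Category.assoc, ← mapHom_comp,
      rassoc_rpost, mapHom_comp, ← reassoc_of% (θ_natural hP), ← reassoc_of% mapHom_comp,
      lact_rpost_lev]
  exact (congrArg (_ ≫ ·) (modMap_rhomFunctor_comp P.functor _ _)).trans e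

/-- `β_l` is the image under `F` of the isomorphism `rassoc`, so no condition on `θ` enters. -/
theorem leftStrong_cayleyObj (P : HalfBraidingData V A) : (cayleyObj P).LeftStrong := by
  intro B X Y
  rw [βl_cayleyObj]
  exact mapHom_isIso P.functor _

theorem IsLaxCentral.rightStrong_cayleyObj {P : HalfBraidingData V A} (hP : P.IsLaxCentral)
    (h : P.Invertible) : (cayleyObj P).RightStrong := by
  intro B X Y
  have := h
  have e : IsIso (mapHom P.functor (lrswap V X B Y) ≫ P.θ B (rhom V X Y) ≫
      mapHom P.functor (rassoc V X B Y)) := by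
    have := h B (rhom V X Y)
    infer_instance
  rw [hP.βr_cayleyObj]
  exact e

end HalfBraidingData

end CayleyImage

end Tambara

namespace Tambara

/-! ### Opposites, and the two actions of a module on morphisms. -/

section Opposites

variable {V : Type u} [Category.{w} V] [MonoidalCategory V] [BraidedCategory V]
variable {A : Type u₁} [Category.{u₂} A] [EnrichedOrdinaryCategory V A]

/-- Composition in `Aᵒᵖ` is that of `A` after the braiding, and braiding with the unit is trivial up
to unitors. -/
theorem eHomWhiskerRight_op {X X' : A} (f : X ⟶ X') (Z : A) :
    eHomWhiskerRight V f.op (op Z) = eHomWhiskerLeft V Z f := by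
  have e : eHomWhiskerRight V f.op (op Z) =
      (λ_ (Z ⟶[V] X)).inv ≫ eHomEquiv V f ▷ (Z ⟶[V] X) ≫ (β_ _ _).hom ≫ eComp V Z X X' := rfl
  rw [e, BraidedCategory.braiding_naturality_left_assoc, braiding_tensorUnit_left,
    eHomWhiskerLeft]
  simp

theorem eHomWhiskerLeft_op {X X' : A} (f : X ⟶ X') (Z : A) :
    eHomWhiskerLeft V (op Z) f.op = eHomWhiskerRight V f Z := by
  have e : eHomWhiskerLeft V (op Z) f.op =
      (ρ_ (X' ⟶[V] Z)).inv ≫ (X' ⟶[V] Z) ◁ eHomEquiv V f ≫ (β_ _ _).hom ≫ eComp V X X' Z := rfl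
  rw [e, BraidedCategory.braiding_naturality_right_assoc, braiding_tensorUnit_right,
    eHomWhiskerRight]
  simp

end Opposites

section Bimodules

attribute [local instance] MonoidalClosed.enrichedOrdinaryCategorySelf

variable {V : Type u} [Category.{w} V] [MonoidalCategory V] [SymmetricCategory V]
  [MonoidalClosed V]
variable {A : Type u₁} [Category.{u₂} A] [EnrichedOrdinaryCategory V A]
  (T : EnrichedFunctor V (TProd Aᵒᵖ A) V)

/-- The morphism `T(f, Y) : T(X, Y) ⟶ T(X', Y)` for `f : X' ⟶ X`. -/
def modPre {X' X : A} (f : X' ⟶ X) (Y : A) : T.obj ⟨op X, Y⟩ ⟶ T.obj ⟨op X', Y⟩ :=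
  onFst T f.op Y

/-- The morphism `T(X, g) : T(X, Y) ⟶ T(X, Y')` for `g : Y ⟶ Y'`. -/
def modPost (X : A) {Y Y' : A} (g : Y ⟶ Y') : T.obj ⟨op X, Y⟩ ⟶ T.obj ⟨op X, Y'⟩ :=
  onSnd T (op X) g

theorem modMap_eq {X X' Y Y' : A} (f : X' ⟶ X) (g : Y ⟶ Y') :
    modMap T f g = modPre T f Y ≫ modPost T X' g :=
  onPair_eq T f.op g

theorem modPost_modPre {X X' Y Y' : A} (f : X' ⟶ X) (g : Y ⟶ Y') :
    modPost T X g ≫ modPre T f Y' = modPre T f Y ≫ modPost T X' g :=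
  onSnd_onFst T f.op g

@[simp]
theorem modPre_id (X Y : A) : modPre T (𝟙 X) Y = 𝟙 _ := onFst_id T (op X) Y

@[simp]
theorem modPost_id (X Y : A) : modPost T X (𝟙 Y) = 𝟙 _ := onSnd_id T (op X) Y

theorem modPre_comp {X'' X' X : A} (f : X'' ⟶ X') (f' : X' ⟶ X) (Y : A) :
    modPre T (f ≫ f') Y = modPre T f' Y ≫ modPre T f Y := onFst_comp T f'.op f.op Y

theorem modPost_comp (X : A) {Y Y' Y'' : A} (g : Y ⟶ Y') (g' : Y' ⟶ Y'') :
    modPost T X (g ≫ g') = modPost T X g ≫ modPost T X g' := onSnd_comp T (op X) g g'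

instance {X' X : A} (f : X' ⟶ X) [IsIso f] (Y : A) : IsIso (modPre T f Y) :=
  onHom_isIso (fixSnd T Y) f.op

theorem eHomEquiv_modPre {X' X : A} (f : X' ⟶ X) (Y : A) :
    eHomEquiv V (modPre T f Y) = eHomEquiv V f ≫ modL T X' X Y := eHomEquiv_onFst T f.op Y

theorem eHomEquiv_modPost (X : A) {Y Y' : A} (g : Y ⟶ Y') :
    eHomEquiv V (modPost T X g) = eHomEquiv V g ≫ modR T X Y Y' := eHomEquiv_onSnd T (op X) g

theorem modR_modPost (X Y : A) {Z Z' : A} (g : Z ⟶ Z') :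
    modR T X Y Z ≫ eHomWhiskerLeft V _ (modPost T X g) = eHomWhiskerLeft V Y g ≫ modR T X Y Z' :=
  (eHomWhiskerLeft_mapSnd T (op X) Y g).symm

theorem eHomWhiskerRight_modR (X : A) {Y Y' : A} (f : Y ⟶ Y') (Z : A) :
    eHomWhiskerRight V f Z ≫ modR T X Y Z = modR T X Y' Z ≫ eHomWhiskerRight V (modPost T X f) _ :=
  eHomWhiskerRight_mapSnd T (op X) f Z

theorem modR_modPre {X' X : A} (f : X' ⟶ X) (Y Y' : A) :
    modR T X Y Y' ≫ eHomWhiskerLeft V _ (modPre T f Y') =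
      modR T X' Y Y' ≫ eHomWhiskerRight V (modPre T f Y) _ :=
  mapSnd_onFst T f.op Y Y'

theorem modL_modPost (X' X : A) {Y Y' : A} (g : Y ⟶ Y') :
    modL T X' X Y ≫ eHomWhiskerLeft V _ (modPost T X' g) =
      modL T X' X Y' ≫ eHomWhiskerRight V (modPost T X g) _ :=
  mapFst_onSnd T (op X) (op X') g

theorem modL_modPre {X'' X' : A} (f : X'' ⟶ X') (X Y : A) :
    modL T X' X Y ≫ eHomWhiskerLeft V _ (modPre T f Y) =
      eHomWhiskerRight V f X ≫ modL T X'' X Y :=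
  (eHomWhiskerLeft_mapFst T (op X) f.op Y).symm.trans
    (congrArg (· ≫ modL T X'' X Y) (eHomWhiskerLeft_op f X))

theorem eHomWhiskerLeft_modL (X' : A) {X X₁ : A} (f : X ⟶ X₁) (Y : A) :
    eHomWhiskerLeft V X' f ≫ modL T X' X₁ Y =
      modL T X' X Y ≫ eHomWhiskerRight V (modPre T f Y) _ :=
  (congrArg (· ≫ modL T X' X₁ Y) (eHomWhiskerRight_op f X')).symm.trans
    (eHomWhiskerRight_mapFst T f.op (op X') Y)

end Bimodules

/-! ### The half-braiding of a left strong Tambara module. -/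

section FromTambara

attribute [local instance] MonoidalClosed.enrichedOrdinaryCategorySelf

variable {V : Type u} [Category.{w} V] [MonoidalCategory V] [SymmetricCategory V]
  [MonoidalClosed V]
variable {A : Type w} [Category.{u₂} A] [MonoidalCategory A] [EnrichedOrdinaryCategory V A]
  [MonoidalVCategory V A]

namespace TambaraData

variable {T : TambaraData V A}

namespace IsTambara

theorem modPost_αl (hT : T.IsTambara) (B X : A) {Y Y' : A} (g : Y ⟶ Y') :
    modPost T.functor X g ≫ T.αl B X Y' = T.αl B X Y ≫ modPost T.functor (B ⊗ X) (B ◁ g) := by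
  apply (eHomEquiv V).injective
  rw [← eHomEquiv_eHomWhiskerLeft, ← eHomEquiv_eHomWhiskerRight, eHomEquiv_modPost,
    eHomEquiv_modPost, ← eHomEquiv_tensL]
  simp only [Category.assoc, hT.αl_natural_right]

theorem modPre_αl (hT : T.IsTambara) (B : A) {X' X : A} (f : X' ⟶ X) (Y : A) :
    modPre T.functor f Y ≫ T.αl B X' Y = T.αl B X Y ≫ modPre T.functor (B ◁ f) (B ⊗ Y) := by
  apply (eHomEquiv V).injective
  rw [← eHomEquiv_eHomWhiskerLeft, ← eHomEquiv_eHomWhiskerRight, eHomEquiv_modPre,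
    eHomEquiv_modPre, ← eHomEquiv_tensL]
  simp only [Category.assoc, hT.αl_natural_left]

theorem modPost_αr (hT : T.IsTambara) (B X : A) {Y Y' : A} (g : Y ⟶ Y') :
    modPost T.functor X g ≫ T.αr B X Y' = T.αr B X Y ≫ modPost T.functor (X ⊗ B) (g ▷ B) := by
  apply (eHomEquiv V).injective
  rw [← eHomEquiv_eHomWhiskerLeft, ← eHomEquiv_eHomWhiskerRight, eHomEquiv_modPost,
    eHomEquiv_modPost, ← eHomEquiv_tensR]
  simp only [Category.assoc, hT.αr_natural_right]

theorem modPre_αr (hT : T.IsTambara) (B : A) {X' X : A} (f : X' ⟶ X) (Y : A) :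
    modPre T.functor f Y ≫ T.αr B X' Y = T.αr B X Y ≫ modPre T.functor (f ▷ B) (Y ⊗ B) := by
  apply (eHomEquiv V).injective
  rw [← eHomEquiv_eHomWhiskerLeft, ← eHomEquiv_eHomWhiskerRight, eHomEquiv_modPre,
    eHomEquiv_modPre, ← eHomEquiv_tensR]
  simp only [Category.assoc, hT.αr_natural_left]

end IsTambara

variable [ClosedVCategory V A]

theorem βl_eq (T : TambaraData V A) (B X Y : A) :
    T.βl B X Y = T.αl B X (rhom V B Y) ≫ modPost T.functor (B ⊗ X) (rev V B Y) := by
  rw [βl, modMap_eq, modPre_id, Category.id_comp]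

theorem βr_eq (T : TambaraData V A) (B X Y : A) :
    T.βr B X Y = T.αr B X (lhom V B Y) ≫ modPost T.functor (X ⊗ B) (lev V B Y) := by
  rw [βr, modMap_eq, modPre_id, Category.id_comp]

/-- The morphism `T(I, Y^X) ⟶ T(X, Y)`. -/
def fromRhom (T : TambaraData V A) (X Y : A) :
    T.functor.obj ⟨op (𝟙_ A), rhom V X Y⟩ ⟶ T.functor.obj ⟨op X, Y⟩ :=
  T.αl X (𝟙_ A) (rhom V X Y) ≫ modPre T.functor (ρ_ X).inv _ ≫ modPost T.functor X (rev V X Y)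

/-- The morphism `T(I, ^X Y) ⟶ T(X, Y)`. -/
def fromLhom (T : TambaraData V A) (X Y : A) :
    T.functor.obj ⟨op (𝟙_ A), lhom V X Y⟩ ⟶ T.functor.obj ⟨op X, Y⟩ :=
  T.αr X (𝟙_ A) (lhom V X Y) ≫ modPre T.functor (λ_ X).inv _ ≫ modPost T.functor X (lev V X Y)

theorem fromRhom_eq (T : TambaraData V A) (X Y : A) :
    T.fromRhom X Y = T.βl X (𝟙_ A) Y ≫ modPre T.functor (ρ_ X).inv Y := by
  rw [fromRhom, βl_eq, Category.assoc, modPost_modPre]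

theorem fromLhom_eq (T : TambaraData V A) (X Y : A) :
    T.fromLhom X Y = T.βr X (𝟙_ A) Y ≫ modPre T.functor (λ_ X).inv Y := by
  rw [fromLhom, βr_eq, Category.assoc, modPost_modPre]

/-- By `fromRhom_eq`, only invertibility of `β_l(X, I, Y)` is involved, the unit constraint being
invertible. -/
theorem LeftStrong.isIso_fromRhom (h : T.LeftStrong) (X Y : A) : IsIso (T.fromRhom X Y) := by
  have := h X (𝟙_ A) Y
  rw [fromRhom_eq]
  infer_instance

theorem RightStrong.isIso_fromLhom (h : T.RightStrong) (X Y : A) : IsIso (T.fromLhom X Y) := by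
  have := h X (𝟙_ A) Y
  rw [fromLhom_eq]
  infer_instance

namespace IsTambara

theorem fromRhom_natural_right (hT : T.IsTambara) (X Y Y' : A) :
    rhomSnd V X Y Y' ≫ modR T.functor (𝟙_ A) _ _ ≫ eHomWhiskerLeft V _ (T.fromRhom X Y') =
      modR T.functor X Y Y' ≫ eHomWhiskerRight V (T.fromRhom X Y) _ := by
  simp only [fromRhom, eHomWhiskerLeft_comp, eHomWhiskerRight_comp, Category.assoc]
  rw [reassoc_of% hT.αl_natural_right, ← eHom_whisker_exchange_assoc, ← eHom_whisker_exchange,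
    reassoc_of% modR_modPre, ← eHom_whisker_exchange_assoc, reassoc_of% modR_modPost,
    reassoc_of% rhomSnd_rev, reassoc_of% eHomWhiskerRight_modR]

/-- `X` enters three times: as the parameter of `α_l`, as the exponent evaluated by `e_r`, and in
`ρ⁻¹`. Extranaturality handles the first two and naturality of the unitor the third. -/
theorem fromRhom_natural_left (hT : T.IsTambara) (X' X Y : A) :
    rhomFst V X' X Y ≫ modR T.functor (𝟙_ A) _ _ ≫ eHomWhiskerLeft V _ (T.fromRhom X' Y) =
      modL T.functor X' X Y ≫ eHomWhiskerRight V (T.fromRhom X Y) _ := by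
  have e : eHomWhiskerLeft V X' (ρ_ X).inv =
      tensR V X' X (𝟙_ A) ≫ eHomWhiskerRight V (ρ_ X').inv _ := by
    rw [← cancel_mono (eHomWhiskerLeft V X' (ρ_ X).hom), Category.assoc, ← eHom_whisker_exchange,
      reassoc_of% tensR_unit, ← eHomWhiskerLeft_comp, ← eHomWhiskerRight_comp, Iso.inv_hom_id,
      Iso.inv_hom_id, eHomWhiskerRight_id, eHomWhiskerLeft_id]
  simp only [fromRhom, eHomWhiskerLeft_comp, eHomWhiskerRight_comp, Category.assoc]
  rw [reassoc_of% hT.αl_natural_right, ← eHom_whisker_exchange_assoc, ← eHom_whisker_exchange,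
    reassoc_of% modR_modPre, ← eHom_whisker_exchange_assoc, reassoc_of% modR_modPost,
    reassoc_of% rhomFst_rev, ← reassoc_of% modR_modPost, eHom_whisker_exchange_assoc,
    ← reassoc_of% modR_modPre, eHom_whisker_exchange, eHom_whisker_exchange_assoc,
    reassoc_of% hT.αl_extranatural, ← eHom_whisker_exchange_assoc, ← eHom_whisker_exchange,
    reassoc_of% modL_modPre, ← reassoc_of% e, reassoc_of% eHomWhiskerLeft_modL,
    ← eHom_whisker_exchange_assoc, reassoc_of% modL_modPost]

theorem fromLhom_natural_right (hT : T.IsTambara) (X Y Y' : A) :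
    lhomSnd V X Y Y' ≫ modR T.functor (𝟙_ A) _ _ ≫ eHomWhiskerLeft V _ (T.fromLhom X Y') =
      modR T.functor X Y Y' ≫ eHomWhiskerRight V (T.fromLhom X Y) _ := by
  simp only [fromLhom, eHomWhiskerLeft_comp, eHomWhiskerRight_comp, Category.assoc]
  rw [reassoc_of% hT.αr_natural_right, ← eHom_whisker_exchange_assoc, ← eHom_whisker_exchange,
    reassoc_of% modR_modPre, ← eHom_whisker_exchange_assoc, reassoc_of% modR_modPost,
    reassoc_of% lhomSnd_lev, reassoc_of% eHomWhiskerRight_modR]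

theorem fromLhom_natural_left (hT : T.IsTambara) (X' X Y : A) :
    lhomFst V X' X Y ≫ modR T.functor (𝟙_ A) _ _ ≫ eHomWhiskerLeft V _ (T.fromLhom X' Y) =
      modL T.functor X' X Y ≫ eHomWhiskerRight V (T.fromLhom X Y) _ := by
  simp only [fromLhom, eHomWhiskerLeft_comp, eHomWhiskerRight_comp, Category.assoc]
  rw [reassoc_of% hT.αr_natural_right, ← eHom_whisker_exchange_assoc, ← eHom_whisker_exchange,
    reassoc_of% modR_modPre, ← eHom_whisker_exchange_assoc, reassoc_of% modR_modPost,
    reassoc_of% lhomFst_lev, ← reassoc_of% modR_modPost, eHom_whisker_exchange_assoc,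
    ← reassoc_of% modR_modPre, eHom_whisker_exchange, eHom_whisker_exchange_assoc,
    reassoc_of% hT.αr_extranatural, ← eHom_whisker_exchange_assoc, ← eHom_whisker_exchange,
    reassoc_of% modL_modPre, ← reassoc_of% (eHomWhiskerLeft_leftUnitor_inv V),
    reassoc_of% eHomWhiskerLeft_modL,
    ← eHom_whisker_exchange_assoc, reassoc_of% modL_modPost]

/-- The tensor law of `α_l`, transposed. With `lassoc_fromLhom` (the tensor law of `α_r`) and
`lrswap_fromLhom` (the bimodule axiom), it supplies the faces of the diagram for the tensor law of
`θ`. -/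
theorem rassoc_fromRhom (hT : T.IsTambara) (X Y Z : A) :
    modPost T.functor (𝟙_ A) (rassoc V X Y Z) ≫ T.fromRhom (X ⊗ Y) Z =
      T.fromRhom Y (rhom V X Z) ≫ T.βl X Y Z := by
  have e : (ρ_ (X ⊗ Y)).inv ≫ (α_ X Y (𝟙_ A)).hom = X ◁ (ρ_ Y).inv := by simp
  simp only [fromRhom, βl_eq, Category.assoc]
  rw [reassoc_of% hT.modPost_αl, reassoc_of% modPost_modPre, ← modPost_comp, rassoc_rev,
    reassoc_of% hT.modPost_αl, reassoc_of% hT.modPre_αl, hT.αl_tensor, modMap_eq]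
  simp only [Category.assoc]
  rw [reassoc_of% modPost_modPre, ← reassoc_of% modPre_comp, e, ← modPost_comp,
    Iso.inv_hom_id_assoc, modPost_comp]

theorem lassoc_fromLhom (hT : T.IsTambara) (X Y Z : A) :
    modPost T.functor (𝟙_ A) (lassoc V X Y Z) ≫ T.fromLhom X (lhom V Y Z) ≫ T.βr Y X Z =
      T.fromLhom (X ⊗ Y) Z := by
  have e : (λ_ (X ⊗ Y)).inv ≫ (α_ (𝟙_ A) X Y).inv = (λ_ X).inv ▷ Y := by simp
  simp only [fromLhom, βr_eq, Category.assoc]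
  rw [reassoc_of% hT.modPost_αr, reassoc_of% modPost_modPre, reassoc_of% hT.modPost_αr,
    reassoc_of% hT.modPost_αr, reassoc_of% hT.modPre_αr, hT.αr_tensor, modMap_eq, ← modPost_comp,
    ← modPost_comp, lassoc_lev_lev]
  simp only [Category.assoc]
  rw [reassoc_of% modPost_modPre, ← reassoc_of% modPre_comp, e, ← modPost_comp]

/-- Both composites act on `I` by `X` on the left and `Y` on the right and then evaluate; the
bimodule axiom exchanges the order of the actions. -/
theorem lrswap_fromLhom (hT : T.IsTambara) (X Y Z : A) :
    modPost T.functor (𝟙_ A) (lrswap V X Y Z) ≫ T.fromLhom Y (rhom V X Z) ≫ T.βl X Y Z =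
      T.fromRhom X (lhom V Y Z) ≫ T.βr Y X Z := by
  have e : (ρ_ X).inv ▷ Y ≫ (α_ X (𝟙_ A) Y).hom = X ◁ (λ_ Y).inv := by simp
  simp only [fromLhom, fromRhom, βl_eq, βr_eq, Category.assoc]
  rw [reassoc_of% hT.modPost_αr, reassoc_of% modPost_modPre, ← reassoc_of% modPost_comp,
    lrswap_lev, reassoc_of% hT.modPost_αl, reassoc_of% hT.modPre_αl,
    reassoc_of% hT.modPost_αr, reassoc_of% hT.modPre_αr, reassoc_of% hT.bimodule, modMap_eq]
  simp only [Category.assoc]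
  rw [reassoc_of% modPost_modPre, ← reassoc_of% modPre_comp, e, ← modPost_comp,
    ← modPost_comp, ← modPost_comp, rcurry_rev]

theorem fromRhom_unit (hT : T.IsTambara) (Y : A) :
    T.fromRhom (𝟙_ A) Y = modPost T.functor (𝟙_ A) (runit V Y) := by
  have h := hT.αl_unit (𝟙_ A) (rhom V (𝟙_ A) Y)
  rw [modMap_eq] at h
  rw [fromRhom, ← unitors_inv_equal, ← Category.id_comp (modPost T.functor _ (runit V Y)), ← h,
    Category.assoc, Category.assoc, ← modPost_comp, runit, Iso.hom_inv_id_assoc]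

theorem fromLhom_unit (hT : T.IsTambara) (Y : A) :
    T.fromLhom (𝟙_ A) Y = modPost T.functor (𝟙_ A) (lunit V Y) := by
  have h := hT.αr_unit (𝟙_ A) (lhom V (𝟙_ A) Y)
  rw [modMap_eq] at h
  rw [fromLhom, unitors_inv_equal, ← Category.id_comp (modPost T.functor _ (lunit V Y)), ← h,
    Category.assoc, Category.assoc, ← modPost_comp, lunit, Iso.hom_inv_id_assoc]

end IsTambara

/-- The morphism `θ : T(I, ^X Y) ⟶ T(I, Y^X)` associated with a left strong Tambara module. -/
def halfBraiding (T : TambaraData V A) (h : T.LeftStrong) (X Y : A) :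
    T.functor.obj ⟨op (𝟙_ A), lhom V X Y⟩ ⟶ T.functor.obj ⟨op (𝟙_ A), rhom V X Y⟩ :=
  T.fromLhom X Y ≫ @inv _ _ _ _ (T.fromRhom X Y) (h.isIso_fromRhom X Y)

theorem halfBraiding_fromRhom (h : T.LeftStrong) (X Y : A) :
    T.halfBraiding h X Y ≫ T.fromRhom X Y = T.fromLhom X Y := by
  have := h.isIso_fromRhom X Y
  rw [halfBraiding, Category.assoc, IsIso.inv_hom_id, Category.comp_id]

theorem isIso_halfBraiding (h : T.LeftStrong) (h' : T.RightStrong) (X Y : A) :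
    IsIso (T.halfBraiding h X Y) := by
  have := h.isIso_fromRhom X Y
  have := h'.isIso_fromLhom X Y
  rw [halfBraiding]
  infer_instance

namespace IsTambara

/-- Tested after the isomorphism `fromRhom`, the half-braiding becomes `fromLhom`, and both
comparisons are natural. -/
theorem halfBraiding_natural_right (hT : T.IsTambara) (h : T.LeftStrong) (X Y Y' : A) :
    (lhomSnd V X Y Y' ≫ modR T.functor (𝟙_ A) _ _) ≫
        eHomWhiskerLeft V _ (T.halfBraiding h X Y') =
      (rhomSnd V X Y Y' ≫ modR T.functor (𝟙_ A) _ _) ≫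
        eHomWhiskerRight V (T.halfBraiding h X Y) _ := by
  have := h.isIso_fromRhom X Y'
  rw [← cancel_mono (eHomWhiskerLeft V _ (T.fromRhom X Y')), Category.assoc, Category.assoc,
    Category.assoc, Category.assoc, ← eHomWhiskerLeft_comp, halfBraiding_fromRhom,
    hT.fromLhom_natural_right, ← eHom_whisker_exchange, reassoc_of% hT.fromRhom_natural_right,
    ← eHomWhiskerRight_comp, halfBraiding_fromRhom]

theorem halfBraiding_natural_left (hT : T.IsTambara) (h : T.LeftStrong) (X' X Y : A) :
    (lhomFst V X' X Y ≫ modR T.functor (𝟙_ A) _ _) ≫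
        eHomWhiskerLeft V _ (T.halfBraiding h X' Y) =
      (rhomFst V X' X Y ≫ modR T.functor (𝟙_ A) _ _) ≫
        eHomWhiskerRight V (T.halfBraiding h X Y) _ := by
  have := h.isIso_fromRhom X' Y
  rw [← cancel_mono (eHomWhiskerLeft V _ (T.fromRhom X' Y)), Category.assoc, Category.assoc,
    Category.assoc, Category.assoc, ← eHomWhiskerLeft_comp, halfBraiding_fromRhom,
    hT.fromLhom_natural_left, ← eHom_whisker_exchange, reassoc_of% hT.fromRhom_natural_left,
    ← eHomWhiskerRight_comp, halfBraiding_fromRhom]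

theorem halfBraiding_tensor (hT : T.IsTambara) (h : T.LeftStrong) (X Y Z : A) :
    T.halfBraiding h (X ⊗ Y) Z =
      modPost T.functor (𝟙_ A) (lassoc V X Y Z) ≫ T.halfBraiding h X (lhom V Y Z) ≫
        modPost T.functor (𝟙_ A) (lrswap V X Y Z) ≫ T.halfBraiding h Y (rhom V X Z) ≫
          modPost T.functor (𝟙_ A) (rassoc V X Y Z) := by
  have := h.isIso_fromRhom (X ⊗ Y) Z
  rw [← cancel_mono (T.fromRhom (X ⊗ Y) Z)]
  simp only [Category.assoc]
  -- The composite is consumed from its right end: `rassoc` yields `fromRhom` at `Y` and a `β_l`,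
  -- each factor `θ` trades a `fromRhom` for a `fromLhom`, and the swap turns the `β_l` into a
  -- `β_r`.
  rw [hT.rassoc_fromRhom, halfBraiding_fromRhom, reassoc_of% halfBraiding_fromRhom,
    hT.lrswap_fromLhom, reassoc_of% halfBraiding_fromRhom, hT.lassoc_fromLhom]

theorem halfBraiding_unit (hT : T.IsTambara) (h : T.LeftStrong) (Y : A) :
    T.halfBraiding h (𝟙_ A) Y ≫ modPost T.functor (𝟙_ A) (runit V Y) =
      modPost T.functor (𝟙_ A) (lunit V Y) := by
  rw [← hT.fromRhom_unit, ← hT.fromLhom_unit, halfBraiding_fromRhom]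

end IsTambara

/-- The pair `(T(I, -), θ)` associated with a left strong Tambara module `T`. -/
def toHalfBraiding (T : TambaraData V A) (h : T.LeftStrong) : HalfBraidingData V A where
  functor := fixFst T.functor (op (𝟙_ A))
  θ X Y := T.halfBraiding h X Y

theorem toHalfBraiding_invertible (h : T.LeftStrong) (h' : T.RightStrong) :
    (T.toHalfBraiding h).Invertible :=
  fun X Y => T.isIso_halfBraiding h h' X Y

theorem IsTambara.isLaxCentral_toHalfBraiding (hT : T.IsTambara) (h : T.LeftStrong) :
    (T.toHalfBraiding h).IsLaxCentral where
  natural := isVNatural_of_partial ((lhomFunctor V).comp V (T.toHalfBraiding h).functor)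
    ((rhomFunctor V).comp V (T.toHalfBraiding h).functor)
    (fun X Y => T.halfBraiding h X.unop Y)
    (fun X X' Y => (congrArg (· ≫ _) (mapFst_functor_comp (lhomFunctor V)
      (T.toHalfBraiding h).functor X X' Y)).trans
        ((hT.halfBraiding_natural_left h X'.unop X.unop Y).trans
          (congrArg (· ≫ _) (mapFst_functor_comp (rhomFunctor V)
            (T.toHalfBraiding h).functor X X' Y)).symm))
    (fun X Y Y' => (congrArg (· ≫ _) (mapSnd_functor_comp (lhomFunctor V)
      (T.toHalfBraiding h).functor X Y Y')).trans
        ((hT.halfBraiding_natural_right h X.unop Y Y').trans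
          (congrArg (· ≫ _) (mapSnd_functor_comp (rhomFunctor V)
            (T.toHalfBraiding h).functor X Y Y')).symm))
  -- For the functor `T(I, -)`, `mapHom` is `modPost` at `I` by definition.
  tensor X Y Z := hT.halfBraiding_tensor h X Y Z
  unit Y := hT.halfBraiding_unit h Y

end TambaraData

end FromTambara

end Tambara

/-! ### Elements of hom objects, and essential surjectivity. -/

namespace Tambara

/-- An isomorphism in the underlying category of `C`, from mutually inverse elements of hom
objects. -/
def forgetIso {V : Type u} [Category.{w} V] [MonoidalCategory V] {C : Type u₁}
    [EnrichedCategory V C] {x y : C} (f : 𝟙_ V ⟶ (x ⟶[V] y)) (g : 𝟙_ V ⟶ (y ⟶[V] x))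
    (hfg : (λ_ (𝟙_ V)).inv ≫ (f ⊗ₘ g) ≫ eComp V x y x = eId V x)
    (hgf : (λ_ (𝟙_ V)).inv ≫ (g ⊗ₘ f) ≫ eComp V y x y = eId V y) :
    ForgetEnrichment.of V x ≅ ForgetEnrichment.of V y where
  hom := ForgetEnrichment.homOf V f
  inv := ForgetEnrichment.homOf V g
  hom_inv_id := by
    rw [← ForgetEnrichment.homOf_comp, hfg, ForgetEnrichment.homOf_eId]
  inv_hom_id := by
    rw [← ForgetEnrichment.homOf_comp, hgf, ForgetEnrichment.homOf_eId]

section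

attribute [local instance] MonoidalClosed.enrichedOrdinaryCategorySelf

variable {V : Type u} [Category.{w} V] [MonoidalCategory V] [BraidedCategory V]
  [MonoidalClosed V] [HasLimits V]

theorem isNatFamily_eHomEquiv {C : Type w} [EnrichedCategory V C] {F G : EnrichedFunctor V C V}
    {t : ∀ c, F.obj c ⟶ G.obj c} (h : ∀ c d, F.map c d ≫ eHomWhiskerLeft V _ (t d) =
      G.map c d ≫ eHomWhiskerRight V (t c) _) :
    IsNatFamily F G (fun c => eHomEquiv V (t c)) := by
  intro c d
  rw [elt_eHomEquiv, eHomEquiv_elt, h, braiding_tensorUnit_right, Category.assoc,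
    Iso.inv_hom_id_assoc]

namespace OpFunctor

variable {C : Type w} [EnrichedCategory V C] {J : Type w} {s t : J → C} {P Q R : OpFunctor V s t}

/-- Compatibility of a family of morphisms with the structure of `P` and `Q`. -/
structure IsMorphism (κ : ∀ c, P.functor.obj c ⟶ Q.functor.obj c) : Prop where
  natural (c d : C) : P.functor.map c d ≫ eHomWhiskerLeft V _ (κ d) =
    Q.functor.map c d ≫ eHomWhiskerRight V (κ c) _
  comm (j : J) : P.op j ≫ κ (t j) = κ (s j) ≫ Q.op j

/-- The element of the hom object given by a compatible family of morphisms. -/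
def elt {κ : ∀ c, P.functor.obj c ⟶ Q.functor.obj c} (h : IsMorphism κ) : 𝟙_ V ⟶ hom P Q :=
  homLift (fun c => eHomEquiv V (κ c)) (isNatFamily_eHomEquiv h.natural) (fun j => by
    rw [eHomEquiv_eHomWhiskerLeft, eHomEquiv_eHomWhiskerRight, h.comm])

theorem elt_pr {κ : ∀ c, P.functor.obj c ⟶ Q.functor.obj c} (h : IsMorphism κ) (c : C) :
    elt h ≫ pr P Q c = eHomEquiv V (κ c) :=
  homLift_pr _ _ _ c

theorem elt_homComp {κ : ∀ c, P.functor.obj c ⟶ Q.functor.obj c} (h : IsMorphism κ)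
    {κ' : ∀ c, Q.functor.obj c ⟶ P.functor.obj c} (h' : IsMorphism κ')
    (e : ∀ c, κ c ≫ κ' c = 𝟙 _) :
    (λ_ (𝟙_ V)).inv ≫ (elt h ⊗ₘ elt h') ≫ homComp P Q P = homId P := by
  apply hom_ext
  intro c
  rw [Category.assoc, Category.assoc, homComp_pr, tensorHom_comp_tensorHom_assoc, elt_pr, elt_pr,
    homId_pr, ← eHomEquiv_comp, e, eHomEquiv_id]

/-- Each square for the inverse can be tested after composing with the invertible `κ`, where it
becomes the square for `κ`. So pointwise inverses of `fromRhom` need no separate verification. -/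
theorem IsMorphism.of_inverse {κ : ∀ c, P.functor.obj c ⟶ Q.functor.obj c} (h : IsMorphism κ)
    {κ' : ∀ c, Q.functor.obj c ⟶ P.functor.obj c} (e : ∀ c, κ c ≫ κ' c = 𝟙 _)
    (e' : ∀ c, κ' c ≫ κ c = 𝟙 _) : IsMorphism κ' where
  natural c d := by
    have : IsIso (κ d) := ⟨κ' d, e d, e' d⟩
    rw [← cancel_mono (eHomWhiskerLeft V _ (κ d)), Category.assoc, Category.assoc,
      ← eHomWhiskerLeft_comp, e', eHomWhiskerLeft_id, ← eHom_whisker_exchange,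
      reassoc_of% h.natural, ← eHomWhiskerRight_comp, e', eHomWhiskerRight_id]
  comm j := by
    have : IsIso (κ (t j)) := ⟨κ' (t j), e _, e' _⟩
    rw [← cancel_mono (κ (t j)), Category.assoc, Category.assoc, e', h.comm, reassoc_of% e',
      Category.comp_id]

end OpFunctor

end

section Essential

attribute [local instance] MonoidalClosed.enrichedOrdinaryCategorySelf

variable {V : Type u} [Category.{w} V] [MonoidalCategory V] [SymmetricCategory V]
  [MonoidalClosed V]
variable {A : Type w} [Category.{u₂} A] [MonoidalCategory A] [EnrichedOrdinaryCategory V A]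
  [MonoidalVCategory V A] [ClosedVCategory V A]

namespace TambaraData

variable {T : TambaraData V A}

namespace IsTambara

/-- The tensor law of `α_l` at `B`, `X` and the unit: acting by `B ⊗ X` on `I` is acting by `X` and
then by `B`. Thus `fromRhom` respects the left actions. -/
theorem ract_fromRhom (hT : T.IsTambara) (B X Y : A) :
    modPost T.functor (𝟙_ A) (ract V B X Y) ≫ T.fromRhom (B ⊗ X) (B ⊗ Y) =
      T.fromRhom X Y ≫ T.αl B X Y := by
  have e : (ρ_ (B ⊗ X)).inv ≫ (α_ B X (𝟙_ A)).hom = B ◁ (ρ_ X).inv := by simp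
  simp only [fromRhom, Category.assoc]
  rw [reassoc_of% hT.modPost_αl, reassoc_of% modPost_modPre, ← modPost_comp, ract_rev,
    hT.modPost_αl, reassoc_of% hT.modPre_αl, hT.αl_tensor, modMap_eq]
  simp only [Category.assoc]
  rw [reassoc_of% modPost_modPre, ← reassoc_of% modPre_comp, e, ← modPost_comp,
    Iso.inv_hom_id_assoc]

theorem rpost_fromRhom (hT : T.IsTambara) (X : A) {Y Y' : A} (g : Y ⟶ Y') :
    modPost T.functor (𝟙_ A) (rpost V X g) ≫ T.fromRhom X Y' =
      T.fromRhom X Y ≫ modPost T.functor X g := by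
  apply (eHomEquiv V).injective
  rw [← eHomEquiv_eHomWhiskerLeft, ← eHomEquiv_eHomWhiskerRight, eHomEquiv_modPost,
    eHomEquiv_modPost, ← eHomEquiv_rhomSnd]
  simp only [Category.assoc, hT.fromRhom_natural_right]

/-- `θ` becomes `fromLhom`, the bimodule axiom in the form of `lrswap_fromLhom` produces `β_r`, and
the triangle identity for `lcoev` reduces `β_r` to `α_r`. -/
theorem rightAct_fromRhom (hT : T.IsTambara) (h : T.LeftStrong) (B X Y : A) :
    (modPost T.functor (𝟙_ A) (rpost V X (lcoev V B Y) ≫ lrswap V X B (Y ⊗ B)) ≫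
        T.halfBraiding h B (rhom V X (Y ⊗ B)) ≫
          modPost T.functor (𝟙_ A) (rassoc V X B (Y ⊗ B))) ≫ T.fromRhom (X ⊗ B) (Y ⊗ B) =
      T.fromRhom X Y ≫ T.αr B X Y := by
  simp only [Category.assoc]
  rw [hT.rassoc_fromRhom, reassoc_of% halfBraiding_fromRhom, modPost_comp, Category.assoc,
    hT.lrswap_fromLhom, reassoc_of% hT.rpost_fromRhom, βr_eq, reassoc_of% hT.modPost_αr,
    ← modPost_comp, lcoev_lev, modPost_id, Category.comp_id]

theorem isMorphism_fromRhom [HasLimits V] (hT : T.IsTambara) (h : T.LeftStrong) :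
    OpFunctor.IsMorphism (P := (cayleyObj (T.toHalfBraiding h)).toOps) (Q := T.toOps)
      (fun x => T.fromRhom x.fst.unop x.snd) where
  natural c d := homMap₂_natural_of_partial ((rhomFunctor V).comp V (T.toHalfBraiding h).functor)
    T.functor (fun X Y => T.fromRhom X.unop Y)
    (fun X X' Y => (congrArg (· ≫ _) (mapFst_functor_comp (rhomFunctor V)
      (T.toHalfBraiding h).functor X X' Y)).trans
        ((Category.assoc _ _ _).trans (hT.fromRhom_natural_left X'.unop X.unop Y)))
    (fun X Y Y' => (congrArg (· ≫ _) (mapSnd_functor_comp (rhomFunctor V)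
      (T.toHalfBraiding h).functor X Y Y')).trans
        ((Category.assoc _ _ _).trans (hT.fromRhom_natural_right X.unop Y Y')))
    c.fst d.fst c.snd d.snd
  comm
    | .inl p => hT.ract_fromRhom p.1 p.2.1 p.2.2
    | .inr p => hT.rightAct_fromRhom h p.1 p.2.1 p.2.2

end IsTambara

end TambaraData

end Essential

end Tambara

namespace Tambara

/-! ### Identities at the unit and transport of natural families. -/

section UnitIdentities

variable (V : Type u) [Category.{w} V] [MonoidalCategory V] [SymmetricCategory V]
variable {A : Type u₁} [Category.{u₂} A] [MonoidalCategory A] [EnrichedOrdinaryCategory V A]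
  [MonoidalVCategory V A] [ClosedVCategory V A]

theorem rassoc_unit_left (X Z : A) :
    rassoc V (𝟙_ A) X Z ≫ rpre V (λ_ X).inv Z = rpost V X (runit V Z) := by
  apply rhom_hom_ext
  simp only [MonoidalCategory.whiskerLeft_comp, Category.assoc, rpost_rev, rpre_rev,
    whisker_exchange_assoc, rassoc_rev, runit]
  simp

theorem lrswap_unit (Y Z : A) :
    lrswap V (𝟙_ A) Y Z ≫ lpost V Y (runit V Z) = runit V (lhom V Y Z) := by
  apply lhom_hom_ext
  rw [comp_whiskerRight, Category.assoc, lpost_lev, lrswap_lev_assoc, runit,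
    leftUnitor_inv_naturality_assoc, rcurry_rev, runit]
  simp

end UnitIdentities

section

attribute [local instance] MonoidalClosed.enrichedOrdinaryCategorySelf

variable {V : Type u} [Category.{w} V] [MonoidalCategory V] [BraidedCategory V]
  [MonoidalClosed V] [HasLimits V]

/-- Naturality is transported along `a` on the source and `b` on the target. Only `a` has to be
invertible, so that the square for `k` may be tested after precomposing with it. -/
theorem IsNatFamily.conj {C : Type w} [EnrichedCategory V C] {F F' G G' : EnrichedFunctor V C V}
    {W : V} {t : ∀ c, W ⟶ EnrichedCategory.Hom (F'.obj c) (G'.obj c)} (ht : IsNatFamily F' G' t)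
    {k : ∀ c, W ⟶ EnrichedCategory.Hom (F.obj c) (G.obj c)}
    {a : ∀ c, F'.obj c ⟶ F.obj c} (ia : ∀ c, IsIso (a c)) {b : ∀ c, G'.obj c ⟶ G.obj c}
    (ha : ∀ c d, F'.map c d ≫ eHomWhiskerLeft V _ (a d) =
      F.map c d ≫ eHomWhiskerRight V (a c) _)
    (hb : ∀ c d, G'.map c d ≫ eHomWhiskerLeft V _ (b d) =
      G.map c d ≫ eHomWhiskerRight V (b c) _)
    (hk : ∀ c, k c ≫ eHomWhiskerRight V (a c) _ = t c ≫ eHomWhiskerLeft V _ (b c)) :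
    IsNatFamily F G k := by
  have mid : ∀ {X Y Z Y' : V} {P Q : V} (f : P ⟶ EnrichedCategory.Hom X Y) (m : Y ⟶ Y')
      (g : Q ⟶ EnrichedCategory.Hom Y' Z), ((f ≫ eHomWhiskerLeft V X m) ⊗ₘ g) ≫ eComp V X Y' Z =
        (f ⊗ₘ (g ≫ eHomWhiskerRight V m Z)) ≫ eComp V X Y Z := by
    intro X Y Z Y' P Q f m g
    conv_lhs => rw [← Category.comp_id g, ← tensorHom_comp_tensorHom_assoc, tensorHom_id]
    rw [eComp_whisker_middle, ← id_tensorHom, tensorHom_comp_tensorHom_assoc, Category.comp_id]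
  have right : ∀ {X Y Z X' : V} {P Q : V} (f : P ⟶ EnrichedCategory.Hom X Y) (m : X' ⟶ X)
      (g : Q ⟶ EnrichedCategory.Hom Y Z), (f ⊗ₘ g) ≫ eComp V X Y Z ≫ eHomWhiskerRight V m Z =
        ((f ≫ eHomWhiskerRight V m Y) ⊗ₘ g) ≫ eComp V X' Y Z := by
    intro X Y Z X' P Q f m g
    rw [eComp_eHomWhiskerRight, ← tensorHom_id, tensorHom_comp_tensorHom_assoc, Category.comp_id]
  have left : ∀ {X Y Z Z' : V} {P Q : V} (f : P ⟶ EnrichedCategory.Hom X Y) (m : Z ⟶ Z')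
      (g : Q ⟶ EnrichedCategory.Hom Y Z), (f ⊗ₘ g) ≫ eComp V X Y Z ≫ eHomWhiskerLeft V X m =
        (f ⊗ₘ (g ≫ eHomWhiskerLeft V Y m)) ≫ eComp V X Y Z' := by
    intro X Y Z Z' P Q f m g
    rw [eComp_eHomWhiskerLeft, ← id_tensorHom, tensorHom_comp_tensorHom_assoc, Category.comp_id]
  intro c d
  have := ia c
  rw [← cancel_mono (eHomWhiskerRight V (a c) (G.obj d)), Category.assoc, Category.assoc,
    Category.assoc, right, ← ha, mid, hk, ← left, reassoc_of% ht, left, hb, right, hk, mid]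

/-- The partial actions of a two-variable functor are the joint action precomposed with unitors and
identities, so a jointly natural family restricts to one natural in each variable. -/
theorem natSquare_precomp {a b c d U U' W : V} (m : U ⟶ U') {f : U' ⟶ EnrichedCategory.Hom a b}
    {g : U' ⟶ EnrichedCategory.Hom c d} {p : W ⟶ EnrichedCategory.Hom a c}
    {q : W ⟶ EnrichedCategory.Hom b d}
    (h : (f ⊗ₘ q) ≫ eComp V a b d = (β_ U' W).hom ≫ (p ⊗ₘ g) ≫ eComp V a c d) :
    ((m ≫ f) ⊗ₘ q) ≫ eComp V a b d = (β_ U W).hom ≫ (p ⊗ₘ (m ≫ g)) ≫ eComp V a c d := by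
  rw [← Category.id_comp q, ← tensorHom_comp_tensorHom_assoc, h, tensorHom_id,
    BraidedCategory.braiding_naturality_left_assoc, ← id_tensorHom,
    tensorHom_comp_tensorHom_assoc, Category.id_comp]

theorem IsNatFamily.fixFst {C D : Type w} [EnrichedCategory V C] [EnrichedCategory V D]
    {M N : EnrichedFunctor V (TProd C D) V} {W : V}
    {t : ∀ x, W ⟶ EnrichedCategory.Hom (M.obj x) (N.obj x)} (ht : IsNatFamily M N t) (X : C) :
    IsNatFamily (fixFst M X) (fixFst N X) (fun B => t ⟨X, B⟩) := fun B B' =>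
  natSquare_precomp (λ_ _).inv (natSquare_precomp (eId V X ▷ _) (ht ⟨X, B⟩ ⟨X, B'⟩))

theorem IsNatFamily.fixSnd {C D : Type w} [EnrichedCategory V C] [EnrichedCategory V D]
    {M N : EnrichedFunctor V (TProd C D) V} {W : V}
    {t : ∀ x, W ⟶ EnrichedCategory.Hom (M.obj x) (N.obj x)} (ht : IsNatFamily M N t) (B : D) :
    IsNatFamily (fixSnd M B) (fixSnd N B) (fun X => t ⟨X, B⟩) := fun X X' =>
  natSquare_precomp (ρ_ _).inv (natSquare_precomp (_ ◁ eId V B) (ht ⟨X, B⟩ ⟨X', B⟩))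

theorem IsNatFamily.whisker_onHom {C : Type w} [Category.{v₁} C] [EnrichedOrdinaryCategory V C]
    {F G : EnrichedFunctor V C V} {W : V}
    {t : ∀ X, W ⟶ EnrichedCategory.Hom (F.obj X) (G.obj X)} (ht : IsNatFamily F G t)
    {X Y : C} (f : X ⟶ Y) :
    t X ≫ eHomWhiskerLeft V _ (onHom G f) = t Y ≫ eHomWhiskerRight V (onHom F f) _ := by
  have e := natSquare_precomp (eHomEquiv V f) (ht X Y)
  rw [← eHomEquiv_onHom, ← eHomEquiv_onHom, eHomEquiv_elt, elt_eHomEquiv,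
    braiding_tensorUnit_left, Category.assoc, Iso.inv_hom_id_assoc, cancel_epi] at e
  exact e.symm

end

/-! ### The Cayley `V`-functor is fully faithful on the lax centre. -/

section FullyFaithful

attribute [local instance] MonoidalClosed.enrichedOrdinaryCategorySelf

variable {V : Type u} [Category.{w} V] [MonoidalCategory V] [SymmetricCategory V]
  [MonoidalClosed V]
variable {A : Type w} [Category.{u₂} A] [MonoidalCategory A] [EnrichedOrdinaryCategory V A]
  [MonoidalVCategory V A] [ClosedVCategory V A]

theorem onSnd_rhomFunctor_comp (F : EnrichedFunctor V A V) (X : A) {Y Y' : A} (g : Y ⟶ Y') :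
    onSnd ((rhomFunctor V).comp V F) (op X) g = mapHom F (rpost V X g) := by
  refine (onHom_eq_iff _ _ _).2 (Eq.trans ?_ (eHomEquiv_mapHom F (rpost V X g)).symm)
  refine (congrArg (eHomEquiv V g ≫ ·) (modR_rhomFunctor_comp F X Y Y')).trans ?_
  rw [← eHomEquiv_rhomSnd, Category.assoc]
  rfl

theorem onFst_rhomFunctor_comp (F : EnrichedFunctor V A V) {X' X : A} (f : X' ⟶ X) (Y : A) :
    onFst ((rhomFunctor V).comp V F) f.op Y = mapHom F (rpre V f Y) := by
  refine (onHom_eq_iff _ _ _).2 (Eq.trans ?_ (eHomEquiv_mapHom F (rpre V f Y)).symm)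
  refine (congrArg (eHomEquiv V f ≫ ·) (modL_rhomFunctor_comp F X' X Y)).trans ?_
  rw [← eHomEquiv_rhomFst, Category.assoc]
  rfl

namespace HalfBraidingData

/-- The right action on `T_F(I, -) ≅ F`, followed by evaluation, is `θ` itself. Hence
transformations compatible with `α_r` are compatible with `θ`. -/
theorem IsLaxCentral.runit_θ {P : HalfBraidingData V A} (hP : P.IsLaxCentral) (X Y : A) :
    P.rightAct X (𝟙_ A) (lhom V X Y) ≫ mapHom P.functor (rpost V _ (lev V X Y)) ≫
        mapHom P.functor (rpre V (λ_ X).inv Y) =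
      mapHom P.functor (runit V (lhom V X Y)) ≫ P.θ X Y := by
  rw [rightAct, Category.assoc, Category.assoc, ← mapHom_comp, ← mapHom_comp,
    reassoc_of% rassoc_rpost,
    rassoc_unit_left, mapHom_comp, ← reassoc_of% (θ_natural hP), ← hP.θ_natural,
    ← reassoc_of% mapHom_comp, lact_rpost_lev, ← reassoc_of% mapHom_comp, lrswap_unit]

variable [HasLimits V] (P Q : HalfBraidingData V A)

/-- The projection from the hom object between the Tambara modules `T_F` and `T_G` to
`[F(Y^X), G(Y^X)]`. -/
def cayleyPr (X Y : A) : OpFunctor.hom (cayleyObj P).toOps (cayleyObj Q).toOps ⟶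
    EnrichedCategory.Hom (P.functor.obj (rhom V X Y)) (Q.functor.obj (rhom V X Y)) :=
  OpFunctor.pr (cayleyObj P).toOps (cayleyObj Q).toOps ⟨op X, Y⟩

theorem cayleyPr_ract (B X Y : A) :
    cayleyPr P Q X Y ≫ eHomWhiskerLeft V _ (mapHom Q.functor (ract V B X Y)) =
      cayleyPr P Q (B ⊗ X) (B ⊗ Y) ≫ eHomWhiskerRight V (mapHom P.functor (ract V B X Y)) _ :=
  OpFunctor.pr_op (cayleyObj P).toOps (cayleyObj Q).toOps (.inl (B, X, Y))

theorem cayleyPr_rightAct (B X Y : A) :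
    cayleyPr P Q X Y ≫ eHomWhiskerLeft V _ (Q.rightAct B X Y) =
      cayleyPr P Q (X ⊗ B) (Y ⊗ B) ≫ eHomWhiskerRight V (P.rightAct B X Y) _ :=
  OpFunctor.pr_op (cayleyObj P).toOps (cayleyObj Q).toOps (.inr (B, X, Y))

theorem isNatFamily_cayleyPr :
    IsNatFamily ((rhomFunctor V).comp V P.functor) ((rhomFunctor V).comp V Q.functor)
      (OpFunctor.pr (cayleyObj P).toOps (cayleyObj Q).toOps) :=
  OpFunctor.isNatFamily_pr (cayleyObj P).toOps (cayleyObj Q).toOps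

theorem cayleyPr_rpost (X : A) {Y Y' : A} (g : Y ⟶ Y') :
    cayleyPr P Q X Y ≫ eHomWhiskerLeft V _ (mapHom Q.functor (rpost V X g)) =
      cayleyPr P Q X Y' ≫ eHomWhiskerRight V (mapHom P.functor (rpost V X g)) _ := by
  rw [← onSnd_rhomFunctor_comp, ← onSnd_rhomFunctor_comp]
  exact ((isNatFamily_cayleyPr P Q).fixFst (op X)).whisker_onHom g

theorem cayleyPr_rpre {X' X : A} (f : X' ⟶ X) (Y : A) :
    cayleyPr P Q X Y ≫ eHomWhiskerLeft V _ (mapHom Q.functor (rpre V f Y)) =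
      cayleyPr P Q X' Y ≫ eHomWhiskerRight V (mapHom P.functor (rpre V f Y)) _ := by
  rw [← onFst_rhomFunctor_comp, ← onFst_rhomFunctor_comp]
  exact ((isNatFamily_cayleyPr P Q).fixSnd Y).whisker_onHom f.op

/-- The restriction of a transformation `T_F ⟶ T_G` along `T_F(I, Z) ≅ F Z`. -/
def cayleyRes (Z : A) : OpFunctor.hom (cayleyObj P).toOps (cayleyObj Q).toOps ⟶
    EnrichedCategory.Hom (P.functor.obj Z) (Q.functor.obj Z) :=
  cayleyPr P Q (𝟙_ A) Z ≫ eHomWhiskerLeft V _ (mapHom Q.functor (runit V Z)) ≫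
    eHomWhiskerRight V (inv (mapHom P.functor (runit V Z))) _

theorem cayleyRes_runit (Z : A) :
    cayleyRes P Q Z ≫ eHomWhiskerRight V (mapHom P.functor (runit V Z)) _ =
      cayleyPr P Q (𝟙_ A) Z ≫ eHomWhiskerLeft V _ (mapHom Q.functor (runit V Z)) := by
  rw [cayleyRes, Category.assoc, Category.assoc, ← eHomWhiskerRight_comp, IsIso.hom_inv_id,
    eHomWhiskerRight_id, Category.comp_id]

theorem runit_natural_functor (F : EnrichedFunctor V A V) (Y Y' : A) :
    (rhomSnd V (𝟙_ A) Y Y' ≫ F.map _ _) ≫ eHomWhiskerLeft V _ (mapHom F (runit V Y')) =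
      F.map Y Y' ≫ eHomWhiskerRight V (mapHom F (runit V Y)) _ := by
  rw [Category.assoc, map_eHomWhiskerLeft_mapHom, reassoc_of% runit_natural,
    eHomWhiskerRight_map_mapHom]

theorem isNatFamily_cayleyRes : IsNatFamily P.functor Q.functor (cayleyRes P Q) :=
  IsNatFamily.conj (F' := fixFst ((rhomFunctor V).comp V P.functor) (op (𝟙_ A)))
    (G' := fixFst ((rhomFunctor V).comp V Q.functor) (op (𝟙_ A)))
    ((isNatFamily_cayleyPr P Q).fixFst (op (𝟙_ A)))
    (a := fun Z => mapHom P.functor (runit V Z))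
    (fun Z => mapHom_isIso P.functor (runit V Z)) (b := fun Z => mapHom Q.functor (runit V Z))
    (fun Y Y' => (congrArg (· ≫ _) (modR_rhomFunctor_comp P.functor (𝟙_ A) Y Y')).trans
      (runit_natural_functor P.functor Y Y'))
    (fun Y Y' => (congrArg (· ≫ _) (modR_rhomFunctor_comp Q.functor (𝟙_ A) Y Y')).trans
      (runit_natural_functor Q.functor Y Y'))
    (cayleyRes_runit P Q)

/-- A transformation commutes with `α_l`, with `e_r` and with the unitor, hence with the composite
`T_F(I, Y^X) ⟶ T_F(X, Y)` of these. That composite is the isomorphism `F(runit)` at `Y^X`, so the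
components at the unit determine all others. -/
theorem cayleyRes_rhom (X Y : A) : cayleyRes P Q (rhom V X Y) = cayleyPr P Q X Y := by
  have h := square_comp (square_comp (cayleyPr_ract P Q X (𝟙_ A) (rhom V X Y))
    (cayleyPr_rpost P Q _ (rev V X Y))) (cayleyPr_rpre P Q (ρ_ X).inv Y)
  rw [← mapHom_comp, ← mapHom_comp, ract_rpost_rev, ← mapHom_comp, ← mapHom_comp, ract_rpost_rev,
    rassoc_unit, ← cayleyRes_runit] at h
  exact (cancel_mono _).1 h

variable {P Q}

theorem cayleyRes_θ (hP : P.IsLaxCentral) (hQ : Q.IsLaxCentral) (X Y : A) :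
    cayleyRes P Q (lhom V X Y) ≫ eHomWhiskerLeft V _ (Q.θ X Y) =
      cayleyRes P Q (rhom V X Y) ≫ eHomWhiskerRight V (P.θ X Y) _ := by
  -- The pasted square runs along the composite computed in `runit_θ`; cancelling `F(runit)` leaves
  -- the square for `θ`.
  have h := square_comp (cayleyPr_rightAct P Q X (𝟙_ A) (lhom V X Y))
    (square_comp (cayleyPr_rpost P Q _ (lev V X Y)) (cayleyPr_rpre P Q (λ_ X).inv Y))
  rw [hP.runit_θ, hQ.runit_θ, eHomWhiskerLeft_comp, ← reassoc_of% cayleyRes_runit,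
    ← eHom_whisker_exchange, eHomWhiskerRight_comp, ← cayleyRes_rhom, ← Category.assoc,
    ← Category.assoc] at h
  exact (cancel_mono _).1 h

/-- The inverse of the action of the Cayley `V`-functor on homs. -/
def cayleyInv (hP : P.IsLaxCentral) (hQ : Q.IsLaxCentral) :
    OpFunctor.hom (cayleyObj P).toOps (cayleyObj Q).toOps ⟶ OpFunctor.hom P.toOps Q.toOps :=
  OpFunctor.homLift (P := P.toOps) (Q := Q.toOps) (cayleyRes P Q)
    (isNatFamily_cayleyRes P Q) (fun p => cayleyRes_θ hP hQ p.1 p.2)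

variable (P Q) in
/-- The projection from the hom object of the lax centre to `[F Z, G Z]`. -/
def laxPr (Z : A) : OpFunctor.hom P.toOps Q.toOps ⟶
    EnrichedCategory.Hom (P.functor.obj Z) (Q.functor.obj Z) :=
  OpFunctor.pr P.toOps Q.toOps Z

theorem cayleyInv_laxPr (hP : P.IsLaxCentral) (hQ : Q.IsLaxCentral) (Z : A) :
    cayleyInv hP hQ ≫ laxPr P Q Z = cayleyRes P Q Z :=
  OpFunctor.homLift_pr _ _ _ Z

theorem cayleyHom_cayleyPr (X Y : A) :
    cayleyHom P Q ≫ cayleyPr P Q X Y = laxPr P Q (rhom V X Y) :=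
  cayleyHom_pr P Q ⟨op X, Y⟩

theorem laxPr_mapHom {Y Z : A} (f : Y ⟶ Z) :
    laxPr P Q Y ≫ eHomWhiskerLeft V _ (mapHom Q.functor f) =
      laxPr P Q Z ≫ eHomWhiskerRight V (mapHom P.functor f) _ :=
  (OpFunctor.isNatFamily_pr P.toOps Q.toOps).whisker_mapHom f

/-- Restriction reads off the component at `Z^I`, which naturality along `runit` identifies with the
component at `Z`. -/
theorem cayleyHom_cayleyRes (Z : A) : cayleyHom P Q ≫ cayleyRes P Q Z = laxPr P Q Z := by
  rw [← cancel_mono (eHomWhiskerRight V (mapHom P.functor (runit V Z)) _), Category.assoc,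
    cayleyRes_runit, reassoc_of% cayleyHom_cayleyPr, laxPr_mapHom]

theorem isIso_cayleyHom (hP : P.IsLaxCentral) (hQ : Q.IsLaxCentral) : IsIso (cayleyHom P Q) := by
  refine ⟨cayleyInv hP hQ, OpFunctor.hom_ext fun Z => ?_, OpFunctor.hom_ext fun x => ?_⟩
  · have e : (cayleyHom P Q ≫ cayleyInv hP hQ) ≫ laxPr P Q Z = 𝟙 _ ≫ laxPr P Q Z := by
      rw [Category.assoc, cayleyInv_laxPr, Category.id_comp, cayleyHom_cayleyRes]
    exact e
  · have e (X Y : A) : (cayleyInv hP hQ ≫ cayleyHom P Q) ≫ cayleyPr P Q X Y =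
        𝟙 _ ≫ cayleyPr P Q X Y := by
      rw [Category.assoc, cayleyHom_cayleyPr, cayleyInv_laxPr, Category.id_comp, cayleyRes_rhom]
    exact e x.fst.unop x.snd

end HalfBraidingData

end FullyFaithful

/-! ### The two equivalences. -/

section Equivalences

attribute [local instance] MonoidalClosed.enrichedOrdinaryCategorySelf

variable {V : Type u} [Category.{w} V] [MonoidalCategory V] [SymmetricCategory V]
  [MonoidalClosed V] [HasLimits V]
variable {A : Type w} [Category.{u₂} A] [MonoidalCategory A] [EnrichedOrdinaryCategory V A]
  [MonoidalVCategory V A] [ClosedVCategory V A]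

/-- Full faithfulness needs only the lax centre axioms, and the isomorphism from the Cayley image of
`T(I, -)` only left strength. One argument therefore covers every pair of full subcategories that
`cayley` and `T ↦ T(I, -)` respect. -/
theorem isVEquivalence_restrict_cayley {p : HalfBraidingData V A → Prop}
    {q : TambaraData V A → Prop} (hp : ∀ P, p P → P.IsLaxCentral)
    (hq : ∀ T, q T → T.IsTambara ∧ T.LeftStrong)
    (h : ∀ P, p P → q (cayley.obj P))
    (h' : ∀ T (hT : q T), p (T.toHalfBraiding (hq T hT).2)) :
    IsVEquivalence V (restrict V cayley h) := by
  refine isVEquivalence_of_isIso_map (restrict V cayley h)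
    (fun P Q => HalfBraidingData.isIso_cayleyHom (hp _ P.property) (hp _ Q.property))
    (fun T => ⟨_, h' T.obj T.property⟩) (fun T => ?_)
  have hT := (hq _ T.property).1
  have hl := (hq _ T.property).2
  -- Left strength provides the pointwise inverses of the comparison; they automatically form a
  -- morphism of modules.
  choose g hg hg' using fun x : TProd Aᵒᵖ A => (hl.isIso_fromRhom x.fst.unop x.snd).out
  have m := hT.isMorphism_fromRhom hl
  have m' := m.of_inverse hg hg'
  exact forgetIso (OpFunctor.elt m) (OpFunctor.elt m') (OpFunctor.elt_homComp m m' hg)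
    (OpFunctor.elt_homComp m' m hg')

end Equivalences

end Tambara

end

theorem mainTheorem3 (V : Type u) [Category.{w} V] [MonoidalCategory V] [SymmetricCategory V]
    [MonoidalClosed V] [HasLimits V] [HasColimits V]
    (A : Type w) [Category.{u₂} A] [MonoidalCategory A] [EnrichedOrdinaryCategory V A]
    [Tambara.MonoidalVCategory V A] [Tambara.ClosedVCategory V A] :
    ∃ (h : ∀ P : Tambara.HalfBraidingData V A, P.IsLaxCentral →
          (Tambara.cayley.obj P).IsTambara ∧ (Tambara.cayley.obj P).LeftStrong)
      (h' : ∀ P : Tambara.HalfBraidingData V A, P.IsLaxCentral ∧ P.Invertible →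
          (Tambara.cayley.obj P).IsTambara ∧ (Tambara.cayley.obj P).LeftStrong ∧
            (Tambara.cayley.obj P).RightStrong),
      Tambara.IsVEquivalence V
        (Tambara.restrict V Tambara.cayley h :
          EnrichedFunctor V (Tambara.LaxCentre V A) (Tambara.TambLS V A)) ∧
      Tambara.IsVEquivalence V
        (Tambara.restrict V Tambara.cayley h' :
          EnrichedFunctor V (Tambara.Centre V A) (Tambara.TambS V A)) :=
  ⟨fun P hP => ⟨hP.isTambara_cayleyObj, P.leftStrong_cayleyObj⟩,
    fun P hP => ⟨hP.1.isTambara_cayleyObj, P.leftStrong_cayleyObj,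
      hP.1.rightStrong_cayleyObj hP.2⟩,
    Tambara.isVEquivalence_restrict_cayley (fun _ hP => hP) (fun _ hT => hT) _
      (fun _ hT => hT.1.isLaxCentral_toHalfBraiding hT.2),
    -- The preimage `T(I, -)` is the same as in the lax case; right strength adds invertibility of
    -- its half-braiding.
    Tambara.isVEquivalence_restrict_cayley (fun _ hP => hP.1) (fun _ hT => ⟨hT.1, hT.2.1⟩) _
      (fun _ hT => ⟨hT.1.isLaxCentral_toHalfBraiding hT.2.1,
        Tambara.TambaraData.toHalfBraiding_invertible hT.2.1 hT.2.2⟩)⟩
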